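/- **Setting.** Let $(G;A,B)$ be a double Lie group: $G$ is a Lie group (Hausdorff, second countable), $A,B\subset G$ are closed Lie subgroups, $A\cap B=\{e\}$ and $G=AB$. Write $g=a_L(g)b_R(g)=b_L(g)a_R(g)$ with $a_L(g),a_R(g)\in A$ and $b_L(g),b_R(g)\in B$. Let $G_A$ be the groupoid $G$ over $A$ with target $a_L$, source $a_R$, product $(b_1a)(ab_2)=b_1ab_2$ and inverse $s_A(g)=a_R(g)b_R(g)^{-1}$. Let $G_B$ be the groupoid $G$ over $B$ with product $m_B(a_1b,ba_2)=a_1ba_2$ and inverse $s_B(g)=b_R(g)a_R(g)^{-1}$, and put $\delta(g)=\{(g_1,g_2): m_B(g_1,g_2)=g\}$. Let $T^l_g=T_g(gB)$ and $T^r_g=T_g(Bg)$ be the tangent spaces of the left and right fibres of $G_A$. Let $\mathcal A(G_A)$ be the space of smooth compactly supported sections (bidensities) of $\Omega^{1/2}T^l\otimes\Omega^{1/2}T^r$, with $\omega^*(g)(v\otimes w)=\overline{\omega(s_A(g))(s_A w\otimes s_A v)}$. Let $$Q(g)=\frac{\det \mathrm{Ad}(g)}{\det(P_A\mathrm{Ad}(g)|_{\mathfrak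 a})\,\det(P_B\mathrm{Ad}(g)|_{\mathfrak b})},\qquad \mathfrak g=\mathfrak a\oplus\mathfrak b,$$ where $P_A,P_B$ are the projections onto $\mathfrak a,\mathfrak b$. Define $\tau_z(\omega)=|Q|^{iz}\omega$, $R(\omega)(g)(v\otimes w)=\omega(g^{-1})(w^{-1}\otimes v^{-1})$ and $\kappa=R\circ\tau_{i/2}$. For half-densities $\varphi,\psi$ on $G$ and $(g_1,g_2)\in\delta(g)$ put $$[\Phi_g(\varphi,\psi)(u)](v\otimes w)=\varphi(g_1)(w\,g^{-1}g_1\wedge\pi_1(u))\;\psi(g_2)(g_2g^{-1}v\wedge\pi_2(u)),$$ for $u\in\Lambda^{\max}T_{(g_1,g_2)}\delta(g)$, $v\in\Lambda^{\max}T^l_g$, $w\in\Lambda^{\max}T^r_g$, where $\pi_1,\pi_2$ are the tangent maps of the coordinate projections of $\delta(g)$. This is a $1$-density on $\delta(g)$ with values in $\Omega^{1/2}T^l_g\otimes\Omega^{1/2}T^r_g$. Let $$\hat\Phi(\varphi,\psi)(g)=|Q(g)|^{1/2}\int_{\delta(g)}\Phi_g(\overline{s_B\varphi},\psi),$$ where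 $s_B\varphi$ is the push-forward. Let $L^2(G)$ be the Hilbert space of square-integrable half-densities, with scalar product $(\varphi|\psi)=\int_G\bar\varphi\psi$. Let $W$ be the operator on $L^2(G)\otimes L^2(G)=L^2(G\times G)$ given by push-forward of half-densities by the diffeomorphism $W(s,t)=(sa_L(t)^{-1},\,b_R(sa_L(t)^{-1})\,t)$. For $x,y\in L^2(G)$ let $(\eta_{xy}\otimes\mathrm{id})W$ be the bounded operator with $(z|(\eta_{xy}\otimes \mathrm{id})W\,t)=(x\otimes z|W(y\otimes t))$ for all $z,t\in L^2(G)$. For $\omega\in\mathcal A(G_A)$ let $\pi_{id}(\omega)$ be the operator on $L^2(G)$ given on smooth compactly supported half-densities $\Psi$ as follows. Write $\omega=\lambda\otimes\rho$. For $x$ in the left fibre $zB$ put $y=s_A(x)z$ (product in $G_A$). Carry $\rho(x)\otimes\Psi(y)$ by the diffeomorphism $(x,y)\mapsto(x,xy)$, from $\{(x,y):a_R(x)=a_L(y)\}$ onto $\{(x,z):a_L(x)=a_L(z)\}$, to $\tilde\lambda_x\otimes\Psi_x(z)\in\Omega^{1/2}T^l_x\otimes\Omega^{1/2}T_zG$.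 Then $(\pi_{id}(\omega)\Psi)(z)=\int_{zB}[\lambda(x)\tilde\lambda_x]\otimes\Psi_x(z)$. Let $C_r^*(G_A)$ be the norm closure of $\pi_{id}(\mathcal A(G_A))$ in $B(L^2(G))$. **Proposition.** The push-forward $W$ is a well-defined unitary operator on $L^2(G)\otimes L^2(G)$. For all smooth compactly supported half-densities $\varphi,\psi$ on $G$: 1. $\hat\Phi(\varphi,\psi)\in\mathcal A(G_A)$; 2. $\kappa(\hat\Phi(\varphi,\psi))=\hat\Phi(\psi,\varphi)^*$; 3. $\pi_{id}(\hat\Phi(\varphi,\psi))$ is bounded, and $(\eta_{\varphi\psi}\otimes\mathrm{id})W=\pi_{id}(\hat\Phi(\varphi,\psi))$. Consequently the Baaj–Skandalis algebra $\overline{\mathrm{span}}\{(\eta_{xy}\otimes \mathrm{id})W: x,y\in L^2(G)\}$ of $W$ is contained in $C_r^*(G_A)$. -/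

import Mathlib

open scoped Manifold ContDiff InnerProductSpace
open MeasureTheory

namespace DLG

noncomputable section

/-- The model space of `n`-dimensional manifolds. -/
abbrev E (n : ℕ) : Type := EuclideanSpace ℝ (Fin n)

/-! ### Tangent vectors, frames, densities -/

/-- The standard basis of the model space. -/
def stdVec (n : ℕ) (i : Fin n) : E n := EuclideanSpace.single i (1 : ℝ)

/-- The tangent map of `f` at `x`, for manifolds modelled on `E n` and `E n'`. -/
def tmap (n n' : ℕ) {M M' : Type*} [TopologicalSpace M] [ChartedSpace (E n) M]
    [TopologicalSpace M'] [ChartedSpace (E n') M'] (f : M → M') (x : M) :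
    TangentSpace (𝓡 n) x →L[ℝ] TangentSpace (𝓡 n') (f x) :=
  mfderiv (𝓡 n) (𝓡 n') f x

/-- The tangent map of `f` at `x` as a linear map of the model spaces. (The tangent spaces of a
manifold modelled on `E n` are, by definition, copies of `E n`.) -/
def tlin (n n' : ℕ) {M M' : Type*} [TopologicalSpace M] [ChartedSpace (E n) M]
    [TopologicalSpace M'] [ChartedSpace (E n') M'] (f : M → M') (x : M) : E n →ₗ[ℝ] E n' :=
  (tmap n n' f x).toLinearMap

/-- A family of vectors indexed by a finite type with `n` elements, listed as an `n`-tuple.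
(Values of densities do not depend on the order. If the number of vectors is not `n`, the
value is the zero tuple; this never happens for double Lie groups.) -/
def asFin (n : ℕ) {ι V : Type*} [Fintype ι] [Zero V] (u : ι → V) : Fin n → V :=
  open Classical in
  if h : Fintype.card ι = n then u ∘ (Fintype.equivFinOfCardEq h).symm else 0

/-- The determinant of an `n`-tuple of vectors in the `n`-dimensional model space. -/
def frameDet {n : ℕ} (u : Fin n → E n) : ℝ := Matrix.det (Matrix.of fun i j => u i j)

section LieGroup

variable (n : ℕ) {H : Type*} [Group H] [TopologicalSpace H] [ChartedSpace (E n) H]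

/-- The vector `h X` in `T_h H`, for `X` in `T_e H`. -/
def leftVec (h : H) (X : E n) : TangentSpace (𝓡 n) h :=
  (tmap n n (fun x : H => h * x) 1 X : E n)

/-- The left-invariant frame `(h e_1, …, h e_n)` of `T_h H`, where `(e_i)` is a fixed basis
of `T_e H`. -/
def leftFrame (h : H) (i : Fin n) : TangentSpace (𝓡 n) h := leftVec n h (stdVec n i)

end LieGroup

section Measure

variable (n : ℕ) {M : Type*} [TopologicalSpace M] [ChartedSpace (E n) M]

/-- The coordinate frame `(∂_1, …, ∂_n)` of the chart around `x₀`, at the point with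
coordinates `y`. -/
def chartFrame (x₀ : M) (y : E n) (i : Fin n) :
    TangentSpace (𝓡 n) ((chartAt (E n) x₀).symm y) :=
  tmap n n (chartAt (E n) x₀).symm y (stdVec n i)

/-- The measure of a positive `1`-density `d` on a manifold: in every chart it is
`d(∂_1, …, ∂_n) dy_1 ⋯ dy_n`. On a manifold with a countable base these local measures are
the restrictions of one measure to the chart domains, and this measure is their supremum. -/
def densityMeasure [MeasurableSpace M] (d : ∀ x : M, (Fin n → TangentSpace (𝓡 n) x) → ℝ) :
    Measure M :=
  ⨆ x₀ : M, (((volume : Measure (E n)).restrict (chartAt (E n) x₀).target).withDensity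
    (fun y => ENNReal.ofReal (d ((chartAt (E n) x₀).symm y) (chartFrame n x₀ y)))).map
      (chartAt (E n) x₀).symm

variable (H : Type*) [Group H] [TopologicalSpace H] [ChartedSpace (E n) H]

/-- The left-invariant positive `1`-density on a Lie group which is `1` on the left-invariant
frame. -/
def leftDensity (h : H) (u : Fin n → TangentSpace (𝓡 n) h) : ℝ :=
  |frameDet (fun i => (tmap n n (fun x : H => h⁻¹ * x) h (u i) : E n))|

/-- The measure of the left-invariant density. -/
def refMeasure [MeasurableSpace H] : Measure H := densityMeasure n (leftDensity n H)

variable {H}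

/-- The integral over a Lie group of a complex `1`-density `D`: if `D = f · d₀`, with `d₀` the
left-invariant density, then the integral is that of the function `f` with respect to the
measure of `d₀`. -/
def densityIntegral [MeasurableSpace H]
    (D : ∀ h : H, (Fin n → TangentSpace (𝓡 n) h) → ℂ) : ℂ :=
  ∫ h : H, D h (leftFrame n h) ∂(refMeasure n H)

end Measure

/-! ### Half-densities on a Lie group and the Hilbert spaces -/

section HalfDensity

variable (n : ℕ) (G : Type*) [Group G] [TopologicalSpace G] [ChartedSpace (E n) G]

/-- Fields of complex-valued functions of frames; half-densities are among them. -/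
abbrev FrameField : Type _ := ∀ g : G, (Fin n → TangentSpace (𝓡 n) g) → ℂ

/-- Fields of complex-valued functions of frames on `G × G`. -/
abbrev FrameField₂ : Type _ :=
  ∀ p : G × G, (Fin n ⊕ Fin n → TangentSpace ((𝓡 n).prod (𝓡 n)) p) → ℂ

variable {G}

/-- The coefficient of a half-density with respect to the left-invariant frame. -/
def coeff (φ : FrameField n G) (g : G) : ℂ := φ g (leftFrame n g)

/-- Smooth half-densities on `G` with compact support. -/
structure IsHalfDensity (φ : FrameField n G) : Prop where
  homogeneous : ∀ (g : G) (M : Matrix (Fin n) (Fin n) ℝ) (u : Fin n → TangentSpace (𝓡 n) g),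
    φ g (fun j => ∑ i, M i j • u i) = ((|M.det| ^ (1 / 2 : ℝ) : ℝ) : ℂ) * φ g u
  smooth : ContMDiff (𝓡 n) 𝓘(ℝ, ℂ) ∞ (coeff n φ)
  compact : HasCompactSupport (coeff n φ)

/-- The half-density on `T_g G` which has the value `c` on the frame `F`. -/
def ofFrame {g : G} (F : Fin n → TangentSpace (𝓡 n) g) (c : ℂ)
    (u : Fin n → TangentSpace (𝓡 n) g) : ℂ :=
  (((|frameDet (fun i => (u i : E n))| / |frameDet (fun i => (F i : E n))|) ^ (1 / 2 : ℝ) : ℝ) : ℂ)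
    * c

/-- The frame of `T_(s,t) (G × G)` made of the left-invariant frames of the two factors. -/
def leftFrame₂ (p : G × G) (i : Fin n ⊕ Fin n) : TangentSpace ((𝓡 n).prod (𝓡 n)) p :=
  Sum.elim (fun i => ((leftFrame n p.1 i, 0) : E n × E n))
    (fun i => ((0, leftFrame n p.2 i) : E n × E n)) i

/-- The coefficient of a half-density on `G × G` with respect to the left-invariant frame. -/
def coeff₂ (Ψ : FrameField₂ n G) (p : G × G) : ℂ := Ψ p (leftFrame₂ n p)

/-- Smooth half-densities on `G × G` with compact support. -/
structure IsHalfDensity₂ (Ψ : FrameField₂ n G) : Prop where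
  homogeneous : ∀ (p : G × G) (M : Matrix (Fin n ⊕ Fin n) (Fin n ⊕ Fin n) ℝ)
    (u : Fin n ⊕ Fin n → TangentSpace ((𝓡 n).prod (𝓡 n)) p),
    Ψ p (fun j => ∑ i, M i j • u i) = ((|M.det| ^ (1 / 2 : ℝ) : ℝ) : ℂ) * Ψ p u
  smooth : ContMDiff ((𝓡 n).prod (𝓡 n)) 𝓘(ℝ, ℂ) ∞ (coeff₂ n Ψ)
  compact : HasCompactSupport (coeff₂ n Ψ)

/-- The class of a square-integrable function in `L²`. -/
def toL2 {X : Type*} [MeasurableSpace X] {μ : Measure X} (f : X → ℂ) : Lp ℂ 2 μ :=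
  open Classical in if hf : MemLp f 2 μ then hf.toLp f else 0

variable (G) [MeasurableSpace G]

/-- The Hilbert space `L²(G)` of square-integrable half-densities, a half-density being
represented by its coefficient with respect to the left-invariant frame. The scalar product
is then the integral of the `1`-density `φ̄ ψ`. -/
abbrev L2 : Type _ := Lp ℂ 2 (refMeasure n G)

/-- The Hilbert space `L²(G) ⊗ L²(G) = L²(G × G)` of square-integrable half-densities. -/
abbrev L2₂ : Type _ := Lp ℂ 2 ((refMeasure n G).prod (refMeasure n G))

variable {G}

/-- The vector of `L²(G)` given by a half-density. -/
def vec (φ : FrameField n G) : L2 n G := toL2 (coeff n φ)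

/-- The vector of `L²(G × G)` given by a half-density. -/
def vec₂ (Ψ : FrameField₂ n G) : L2₂ n G := toL2 (coeff₂ n Ψ)

/-- The vector `x ⊗ y` of `L²(G) ⊗ L²(G) = L²(G × G)`. -/
def tensor (x y : L2 n G) : L2₂ n G := toL2 (fun p : G × G => x p.1 * y p.2)

end HalfDensity

/-! ### Double Lie groups -/

/-- `(G; A, B)` is a double Lie group: `A` and `B` are closed (embedded) Lie subgroups of the
Lie group `G`, `A ∩ B = {e}` and `G = A B`. -/
structure IsDoubleLieGroup (n k m : ℕ) {G : Type*} [Group G] [TopologicalSpace G]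
    [ChartedSpace (E n) G] (A B : Subgroup G) [ChartedSpace (E k) A] [ChartedSpace (E m) B] :
    Prop where
  isClosed_left : IsClosed (A : Set G)
  isClosed_right : IsClosed (B : Set G)
  smooth_left : ContMDiff (𝓡 k) (𝓡 n) ∞ (Subtype.val : A → G)
  smooth_right : ContMDiff (𝓡 m) (𝓡 n) ∞ (Subtype.val : B → G)
  immersion_left : ∀ a : A, Function.Injective (tmap k n (Subtype.val : A → G) a)
  immersion_right : ∀ b : B, Function.Injective (tmap m n (Subtype.val : B → G) b)
  inf_eq_bot : A ⊓ B = ⊥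
  exists_mul : ∀ g : G, ∃ a ∈ A, ∃ b ∈ B, g = a * b

section Algebra

variable {G : Type*} [Group G] (A B : Subgroup G)

/-- The factors of `g = a b`. -/
def facAB (g : G) : A × B := Classical.epsilon fun p : A × B => g = (p.1 : G) * (p.2 : G)

/-- The factors of `g = b a`. -/
def facBA (g : G) : A × B := Classical.epsilon fun p : A × B => g = (p.2 : G) * (p.1 : G)

/-- `g = a_L(g) b_R(g) = b_L(g) a_R(g)`. -/
def aL (g : G) : A := (facAB A B g).1

/-- `g = a_L(g) b_R(g) = b_L(g) a_R(g)`. -/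
def bR (g : G) : B := (facAB A B g).2

/-- `g = a_L(g) b_R(g) = b_L(g) a_R(g)`. -/
def aR (g : G) : A := (facBA A B g).1

/-- `g = a_L(g) b_R(g) = b_L(g) a_R(g)`. -/
def bL (g : G) : B := (facBA A B g).2

/-- The inverse of the groupoid `G_A` (target `a_L`, source `a_R`). -/
def sA (g : G) : G := aR A B g * (bR A B g : G)⁻¹

/-- The product `(b₁ a) (a b₂) = b₁ a b₂` of the groupoid `G_A`, meant for `a_R(x) = a_L(y)`. -/
def mA (x y : G) : G := bL A B x * y

/-- The inverse of the groupoid `G_B` (target `b_L`, source `b_R`). -/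
def sB (g : G) : G := bR A B g * (aR A B g : G)⁻¹

/-- The fibre `δ(g)` of the transposed multiplication of the groupoid `G_B`, in which
`(a₁ b) (b a₂) = a₁ b a₂`. -/
def deltaFibre (g : G) : Set (G × G) :=
  {p | ∃ a₁ a₂ : A, ∃ b : B,
    p = ((a₁ : G) * (b : G), (b : G) * (a₂ : G)) ∧ g = (a₁ : G) * (b : G) * (a₂ : G)}

/-- The global parametrisation `a ↦ (g a_R(a g)⁻¹, a g)` of `δ(g)` by `A`. -/
def deltaParam (g : G) (a : A) : G × G := (g * (aR A B (a * g) : G)⁻¹, a * g)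

variable {A B} in
/-- `a ↦ (g a_R(a g)⁻¹, a g)` is a bijection of `A` onto `δ(g)`. -/
theorem bijOn_deltaParam (hinf : A ⊓ B = ⊥) (hAB : ∀ g : G, ∃ a ∈ A, ∃ b ∈ B, g = a * b)
    (g : G) : Set.BijOn (deltaParam A B g) Set.univ (deltaFibre A B g) := by
  have spec : ∀ x : G, x = (bL A B x : G) * (aR A B x : G) := by
    intro x
    obtain ⟨a, ha, b, hb, hx⟩ := hAB x⁻¹
    refine Classical.epsilon_spec (p := fun p : A × B => x = (p.2 : G) * (p.1 : G))
      ⟨(⟨a⁻¹, A.inv_mem ha⟩, ⟨b⁻¹, B.inv_mem hb⟩), ?_⟩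
    show x = b⁻¹ * a⁻¹
    rw [← mul_inv_rev, ← hx, inv_inv]
  have uniq : ∀ (b : B) (a : A), aR A B ((b : G) * (a : G)) = a := by
    intro b a
    have h := spec ((b : G) * (a : G))
    set b' := bL A B ((b : G) * (a : G))
    set a' := aR A B ((b : G) * (a : G))
    have h1 : (a' : G) * (a : G)⁻¹ = (b' : G)⁻¹ * (b : G) := by
      rw [eq_inv_mul_iff_mul_eq, ← mul_assoc, ← h, mul_inv_cancel_right]
    have h2 : (a' : G) * (a : G)⁻¹ ∈ A ⊓ B :=
      ⟨A.mul_mem a'.2 (A.inv_mem a.2), h1 ▸ B.mul_mem (B.inv_mem b'.2) b.2⟩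
    rw [hinf, Subgroup.mem_bot] at h2
    exact Subtype.ext (mul_inv_eq_one.mp h2)
  refine ⟨fun a _ => ?_, fun a _ a' _ h => ?_, ?_⟩
  · have h := spec ((a : G) * g)
    refine ⟨a⁻¹, aR A B (a * g), bL A B (a * g), Prod.ext ?_ h, ?_⟩
    · show g * (aR A B (a * g) : G)⁻¹ = (a : G)⁻¹ * (bL A B (a * g) : G)
      rw [mul_inv_eq_iff_eq_mul, mul_assoc, ← h, inv_mul_cancel_left]
    · show g = (a : G)⁻¹ * (bL A B (a * g) : G) * (aR A B (a * g) : G)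
      rw [mul_assoc, ← h, inv_mul_cancel_left]
  · exact Subtype.ext (mul_right_cancel (congrArg Prod.snd h))
  · rintro p ⟨a₁, a₂, b, rfl, rfl⟩
    refine ⟨a₁⁻¹, trivial, ?_⟩
    have h : ((a₁⁻¹ : A) : G) * ((a₁ : G) * (b : G) * (a₂ : G)) = (b : G) * (a₂ : G) := by
      simp [mul_assoc]
    refine Prod.ext ?_ h
    show (a₁ : G) * (b : G) * (a₂ : G) *
      (aR A B (((a₁⁻¹ : A) : G) * ((a₁ : G) * (b : G) * (a₂ : G))) : G)⁻¹ = _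
    rw [h, uniq, mul_inv_cancel_right]

/-- The inverse of the pentagonal map `W (s, t) = (s a_L(t)⁻¹, b_R(s a_L(t)⁻¹) t)`. -/
def Winv (p : G × G) : G × G :=
  (p.1 * aL A B ((bR A B p.1 : G)⁻¹ * p.2), (bR A B p.1 : G)⁻¹ * p.2)

end Algebra

section Bidensities

variable (n k m : ℕ) {G : Type*} [Group G] [TopologicalSpace G] [ChartedSpace (E n) G]
  (A B : Subgroup G) [ChartedSpace (E k) A] [ChartedSpace (E m) B]

/-- The vector `g X` in `T_g G`, for `X` tangent to the subgroup `S` at `e`. -/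
def subLeft (l : ℕ) (S : Subgroup G) [ChartedSpace (E l) S] (g : G) :
    E l →ₗ[ℝ] TangentSpace (𝓡 n) g :=
  tlin l n (fun s : S => g * (s : G)) 1

/-- The vector `X g` in `T_g G`, for `X` tangent to the subgroup `S` at `e`. -/
def subRight (l : ℕ) (S : Subgroup G) [ChartedSpace (E l) S] (g : G) :
    E l →ₗ[ℝ] TangentSpace (𝓡 n) g :=
  tlin l n (fun s : S => (s : G) * g) 1

/-- The tangent space at `g` of the left fibre `a_L⁻¹(a_L(g)) = g B` of `G_A`. -/
def Tl (g : G) : Submodule ℝ (TangentSpace (𝓡 n) g) := LinearMap.range (subLeft n m B g)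

/-- The tangent space at `g` of the right fibre `a_R⁻¹(a_R(g)) = B g` of `G_A`. -/
def Tr (g : G) : Submodule ℝ (TangentSpace (𝓡 n) g) := LinearMap.range (subRight n m B g)

/-- Fields of functions of a frame of `T_g^l G_A` and a frame of `T_g^r G_A`; bidensities, the
sections of the tensor product of the half-density bundles of `T^l` and `T^r`, are among them. -/
abbrev BiField : Type _ := ∀ g : G, (Fin m → Tl n m B g) → (Fin m → Tr n m B g) → ℂ

variable {n m B} in
/-- The value of `Ω(g)` on frames given as vectors of `T_g G`. -/
def BiField.app (Ω : BiField n m B) (g : G) (v w : Fin m → TangentSpace (𝓡 n) g) : ℂ :=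
  open Classical in
  if h : (∀ i, v i ∈ Tl n m B g) ∧ ∀ i, w i ∈ Tr n m B g then
    Ω g (fun i => ⟨v i, h.1 i⟩) (fun i => ⟨w i, h.2 i⟩) else 0

/-- The left-invariant frame `(g Y_i)` of `T^l G_A`, with `(Y_i)` a basis of `T_e B`. -/
def lFrame (g : G) (i : Fin m) : Tl n m B g :=
  ⟨subLeft n m B g (stdVec m i), LinearMap.mem_range_self _ _⟩

/-- The frame `(Y_i g)` of `T^r G_A`, with `(Y_i)` a basis of `T_e B`. -/
def rFrame (g : G) (i : Fin m) : Tr n m B g :=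
  ⟨subRight n m B g (stdVec m i), LinearMap.mem_range_self _ _⟩

/-- The elements of `𝒜(G_A)`: smooth bidensities with compact support. -/
structure IsBidensity (Ω : BiField n m B) : Prop where
  homogeneous_left : ∀ (g : G) (M : Matrix (Fin m) (Fin m) ℝ) (v : Fin m → Tl n m B g)
    (w : Fin m → Tr n m B g),
    Ω g (fun j => ∑ i, M i j • v i) w = ((|M.det| ^ (1 / 2 : ℝ) : ℝ) : ℂ) * Ω g v w
  homogeneous_right : ∀ (g : G) (M : Matrix (Fin m) (Fin m) ℝ) (v : Fin m → Tl n m B g)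
    (w : Fin m → Tr n m B g),
    Ω g v (fun j => ∑ i, M i j • w i) = ((|M.det| ^ (1 / 2 : ℝ) : ℝ) : ℂ) * Ω g v w
  smooth : ContMDiff (𝓡 n) 𝓘(ℝ, ℂ) ∞ (fun g : G => Ω g (lFrame n m B g) (rFrame n m B g))
  compact : HasCompactSupport (fun g : G => Ω g (lFrame n m B g) (rFrame n m B g))

/-- The involution `Ω^*(x)(v ⊗ w) = conj (Ω(s x)(s w ⊗ s v))`, with `s` the groupoid inverse. -/
def bistar (Ω : BiField n m B) : BiField n m B := fun g v w =>
  starRingEnd ℂ (Ω.app (sA A B g) (fun i => tmap n n (sA A B) g (w i))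
    (fun i => tmap n n (sA A B) g (v i)))

/-- `R(Ω)(g)(v ⊗ w) = Ω(g⁻¹)(w⁻¹ ⊗ v⁻¹)`, with the inverse of the group `G`. -/
def biR (Ω : BiField n m B) : BiField n m B := fun g v w =>
  Ω.app g⁻¹ (fun i => tmap n n (fun x : G => x⁻¹) g (w i))
    (fun i => tmap n n (fun x : G => x⁻¹) g (v i))

/-! ### The cocycle `Q`, the scaling group, the coinverse -/

/-- The Lie algebra of a Lie subgroup, as a subspace of `T_e G`. -/
def lieSub (l : ℕ) (S : Subgroup G) [ChartedSpace (E l) S] : Submodule ℝ (E n) :=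
  LinearMap.range (tlin l n (Subtype.val : S → G) 1)

/-- The adjoint representation. -/
def Ad (g : G) : E n →ₗ[ℝ] E n :=
  tlin n n (fun x : G => g * x * g⁻¹) 1

/-- The diagonal block `P_U T : U → U` of an operator, for a decomposition `U ⊕ V`. -/
def block (U V : Submodule ℝ (E n)) (T : E n →ₗ[ℝ] E n) : U →ₗ[ℝ] U :=
  open Classical in
  if h : IsCompl U V then Submodule.projectionOnto U V h ∘ₗ T ∘ₗ U.subtype else 0

/-- `Q(g) = det Ad(g) / (det g₁ det g₄)`, with `g₁ : 𝔞 → 𝔞` and `g₄ : 𝔟 → 𝔟` the diagonal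
blocks of `Ad(g)` with respect to `𝔤 = 𝔞 ⊕ 𝔟`. -/
def Q (g : G) : ℝ :=
  LinearMap.det (Ad n g) /
    (LinearMap.det (block n (lieSub n k A) (lieSub n m B) (Ad n g)) *
      LinearMap.det (block n (lieSub n m B) (lieSub n k A) (Ad n g)))

/-- `τ_z(Ω) = |Q|^{iz} Ω`. -/
def tau (z : ℂ) (Ω : BiField n m B) : BiField n m B := fun g v w =>
  ((|Q n k m A B g| : ℝ) : ℂ) ^ (Complex.I * z) * Ω g v w

/-- The coinverse `κ = R ∘ τ_{i/2}`. -/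
def kappa (Ω : BiField n m B) : BiField n m B := biR n m B (tau n k m A B (Complex.I / 2) Ω)

/-! ### The bidensity built from two half-densities -/

/-- The complex conjugate of the push-forward of a half-density by the involution `s_B`. -/
def conjPushB (φ : FrameField n G) : FrameField n G := fun g u =>
  starRingEnd ℂ (φ (sB A B g) (fun i => tmap n n (sB A B) g (u i)))

/-- The `1`-density `Φ_g(φ, ψ)(·)(v ⊗ w)` on `δ(g)`,
`u ↦ φ(g₁)(w a' ∧ π₁ u) ψ(g₂)(ã v ∧ π₂ u)`, where `a' = g⁻¹ g₁` and `ã = g₂ g⁻¹`, read on `A`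
through the parametrisation `a ↦ (g₁, g₂) = (g a_R(a g)⁻¹, a g)` of `δ(g)`;
so `a' = a_R(a g)⁻¹` and `ã = a`. -/
def PhiDensity (φ ψ : FrameField n G) (g : G) (v : Fin m → Tl n m B g) (w : Fin m → Tr n m B g)
    (a : A) (u : Fin k → TangentSpace (𝓡 k) a) : ℂ :=
  φ (deltaParam A B g a).1
      (asFin n (Sum.elim
        (fun i => (tmap n n (fun x : G => x * (aR A B (a * g) : G)⁻¹) g (w i) : E n))
        (fun i => (tmap k n (fun a' : A => (deltaParam A B g a').1) a (u i) : E n)))) *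
    ψ (deltaParam A B g a).2
      (asFin n (Sum.elim
        (fun i => (tmap n n (fun x : G => (a : G) * x) g (v i) : E n))
        (fun i => (tmap k n (fun a' : A => (deltaParam A B g a').2) a (u i) : E n))))

variable [MeasurableSpace G]

/-- `Φ(φ, ψ)(g)` is the integral of `Φ_g(φ, ψ)` over `δ(g)`. -/
def Phi (φ ψ : FrameField n G) : BiField n m B := fun g v w =>
  densityIntegral k (PhiDensity n k m A B φ ψ g v w)

/-- `Φ̂(φ, ψ) = |Q|^{1/2} Φ(conj (s_B φ), ψ)`. -/
def PhiHat (φ ψ : FrameField n G) : BiField n m B := fun g v w =>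
  ((|Q n k m A B g| ^ (1 / 2 : ℝ) : ℝ) : ℂ) *
    Phi n k m A B (conjPushB n A B φ) ψ g v w

/-! ### The identity representation and the reduced algebra of `G_A` -/

/-- The frame `(Y_1 z, …, Y_m z, z X_1, …, z X_k)` of `T_z G`, with `(Y_i)` a basis of `T_e B`
and `(X_j)` a basis of `T_e A`. Its first part is a frame of `T_z^r G_A`, its second part
projects to the frame `(a_R(z) X_j)` of the tangent space of the unit space `A`. -/
def adaptedFrame (z : G) : Fin n → TangentSpace (𝓡 n) z :=
  asFin n (Sum.elim (fun i => (subRight n m B z (stdVec m i) : E n))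
    (fun j => (subLeft n k A z (stdVec k j) : E n)))

/-- The `1`-density on the left fibre `F_l(z) = z B` whose integral is `(π_id(Ω) Ψ)(z)` evaluated
on the adapted frame. At `x ∈ F_l(z)` put `y = x⁻¹ z` (in `G_A`). The isomorphism
`t : (x, y) ↦ (x, x y)` of the composable pairs onto the pairs with equal targets maps
`ρ(x) ⊗ Ψ(y)` to `λ'(x) ⊗ Ψ'(z)`, where
`λ'(x)(v) Ψ'(z)(r ∧ z X) = ρ(x)(r y⁻¹) Ψ(y)((v⁻¹ z) ∧ y X)`
for `v` in `T_x^l`, `r` in `T_z^r` and `X` in `T_e A`; multiplied by `λ(x)(v)` it is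
`Ω(x)(v ⊗ r y⁻¹) Ψ(y)((v⁻¹ z) ∧ y X)`. Products and inverses of vectors are taken in the
groupoid `G_A`; the fibre is parametrised by `b ↦ x = z b`. -/
def piDensity (Ω : BiField n m B) (Ψ : FrameField n G) (z : G)
    (b : B) (u : Fin m → TangentSpace (𝓡 m) b) : ℂ :=
  let x : G := z * b
  let y : G := mA A B (sA A B x) z
  let v : Fin m → E n := fun i => tmap m n (fun b' : B => z * (b' : G)) b (u i)
  let ry : Fin m → E n := fun i =>
    tmap n n (fun z' : G => mA A B z' (sA A B y)) z (rFrame n m B z i)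
  let vz : Fin m → E n := fun i => tmap n n (fun x' : G => mA A B (sA A B x') z) x (v i)
  Ω.app x v ry *
    Ψ y (asFin n (Sum.elim vz (fun j => (subLeft n k A y (stdVec k j) : E n))))

/-- The half-density `π_id(Ω) Ψ`. -/
def piId (Ω : BiField n m B) (Ψ : FrameField n G) : FrameField n G := fun z =>
  ofFrame n (adaptedFrame n k m A B z) (densityIntegral m (piDensity n k m A B Ω Ψ z))

/-- The bounded operator `T` on `L²(G)` is `π_id(Ω)` (which is given on the dense subspace of
smooth half-densities with compact support). -/
def IsPiId (Ω : BiField n m B) (T : L2 n G →L[ℂ] L2 n G) : Prop :=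
  ∀ Ψ : FrameField n G, IsHalfDensity n Ψ →
    (T (vec n Ψ) : G → ℂ) =ᵐ[refMeasure n G] coeff n (piId n k m A B Ω Ψ)

/-- The reduced algebra `C_r^*(G_A)`: the norm closure of `π_id(𝒜(G_A))` in `B(L²(G))`. -/
def reducedAlgebra : Set (L2 n G →L[ℂ] L2 n G) :=
  closure {T | ∃ Ω : BiField n m B, IsBidensity n m B Ω ∧ IsPiId n k m A B Ω T}

/-! ### The multiplicative unitary and its algebra -/

/-- The push-forward of a half-density on `G × G` by the pentagonal diffeomorphism `W`. -/
def pushW (Ψ : FrameField₂ n G) : FrameField₂ n G := fun p u =>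
  Ψ (Winv A B p) (fun i => mfderiv ((𝓡 n).prod (𝓡 n)) ((𝓡 n).prod (𝓡 n)) (Winv A B) p (u i))

/-- The unitary operator `W` on `L²(G) ⊗ L²(G)` is the push-forward of half-densities by the
pentagonal diffeomorphism. -/
def IsMultUnitary (W : L2₂ n G ≃ₗᵢ[ℂ] L2₂ n G) : Prop :=
  ∀ Ψ : FrameField₂ n G, IsHalfDensity₂ n Ψ →
    (W (vec₂ n Ψ) : G × G → ℂ) =ᵐ[(refMeasure n G).prod (refMeasure n G)]
      coeff₂ n (pushW n A B Ψ)

variable {n} in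
/-- `T = (η_{xy} ⊗ id) W`, that is `(z | T t) = (x ⊗ z | W (y ⊗ t))` for all `z`, `t`. -/
def IsSlice (W : L2₂ n G ≃ₗᵢ[ℂ] L2₂ n G) (x y : L2 n G) (T : L2 n G →L[ℂ] L2 n G) : Prop :=
  ∀ z t : L2 n G, ⟪z, T t⟫_ℂ = ⟪tensor n x z, W (tensor n y t)⟫_ℂ

variable {n} in
/-- The Baaj–Skandalis algebra of `W`: the norm closure of the linear span of the operators
`(η_{xy} ⊗ id) W`. -/
def sliceAlgebra (W : L2₂ n G ≃ₗᵢ[ℂ] L2₂ n G) : Set (L2 n G →L[ℂ] L2 n G) :=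
  closure (Submodule.span ℂ {T | ∃ x y : L2 n G, IsSlice W x y T} : Set (L2 n G →L[ℂ] L2 n G))

end Bidensities

end

end DLG

/-! A half-density on `G` is determined by its coefficient in the left-invariant frame. In these
terms every object of the statement is an integral of coefficients against left Haar measures, with
weights built from three positive functions: `modG g = |det Ad g|` and the absolute determinants
`modA g`, `modB g` of the diagonal blocks of `Ad g` on 𝔤 = 𝔞 ⊕ 𝔟. Each weight is a Jacobian, and
each Jacobian is computable because the derivative in question is block triangular. With D =
`baseDet`, and the same letters for half-densities and their coefficients, the resulting formulas
are: Φ̂(φ,ψ)(g) = (D² / (modA(g) modG(b_L(g))))^(1/2) ∫_A conj φ(a b_L(g)) ψ(a g) da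
(`PhiHat_coeff`); (π_id(Ω)Ψ)(z) = ∫_B Ω(zb) (modB(b_L(zb)) modB(a_R(zb)))^(1/2) Ψ(b_L(zb)⁻¹ z) db
(`piId_coeff`); (WΨ)(s,t) = modG(α⁻¹)^(1/2) Ψ(sα, b_R(s)⁻¹t) with α = a_L(b_R(s)⁻¹t)
(`pushW_coeff`); dg = D modA(b⁻¹) da db for g = ab (`refMeasure_eq_map`).

The factorisation maps must first be shown to be smooth (`contMDiff_fac`). A vector common to both
Lie algebras generates a curve in A ∩ B = {e}, so 𝔞 ∩ 𝔟 = 0; the surjection A × B → G bounds the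
dimension of G from above; the inverse function theorem at the identity, moved around by
translations, does the rest.

Membership of Φ̂(φ,ψ) in 𝒜(G_A) follows from the first formula by differentiation under an integral
over a compact set of A. The identity for κ follows from the substitution a ↦ a a_R(g) in that
integral (`corr_symm`); the weights then agree because complementary minors of inverse operators
agree, modA(g) = modG(g) modB(g⁻¹) (`modA_eq`), and because modA and modB are multiplicative along
the two factorisations.

For the slices, Fubini gives the operator with kernel conj φ(s) modG(α⁻¹)^(1/2) ψ(sα) Ψ(b_R(s)⁻¹z),
integrated over s in G. Put s = aβ and substitute β = b_L(zb). Then α = a_R(zb) and sα = a z b, so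
the integral over a is the one in Φ̂(φ,ψ)(zb) and the integral over b is the one in π_id; the
weights match by `weight_eq`. Finally, slices depend continuously on the two vectors, smooth
half-densities are dense, and the operators π_id(Ω) form a linear space, whence the inclusion of
algebras. -/

namespace DLG

set_option linter.unusedSectionVars false

noncomputable section

/-! ### Chain rules for tangent maps read in the model spaces -/

section TangentMaps

variable {V₁ V₂ V₃ : Type*} [NormedAddCommGroup V₁] [NormedSpace ℝ V₁]
  [NormedAddCommGroup V₂] [NormedSpace ℝ V₂] [NormedAddCommGroup V₃] [NormedSpace ℝ V₃]
  {H₁ H₂ H₃ : Type*} [TopologicalSpace H₁] [TopologicalSpace H₂] [TopologicalSpace H₃]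
  (I₁ : ModelWithCorners ℝ V₁ H₁) (I₂ : ModelWithCorners ℝ V₂ H₂) (I₃ : ModelWithCorners ℝ V₃ H₃)
  {M₁ M₂ M₃ : Type*} [TopologicalSpace M₁] [ChartedSpace H₁ M₁]
  [TopologicalSpace M₂] [ChartedSpace H₂ M₂] [TopologicalSpace M₃] [ChartedSpace H₃ M₃]

/-- The tangent map of `f` at `x`, as a continuous linear map of the model vector spaces. -/
def td (f : M₁ → M₂) (x : M₁) : V₁ →L[ℝ] V₂ := mfderiv I₁ I₂ f x

variable {I₁ I₂ I₃}

theorem td_comp {g : M₂ → M₃} {f : M₁ → M₂} {x : M₁} (hg : MDifferentiableAt I₂ I₃ g (f x))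
    (hf : MDifferentiableAt I₁ I₂ f x) :
    td I₁ I₃ (fun y => g (f y)) x = td I₂ I₃ g (f x) ∘L td I₁ I₂ f x :=
  mfderiv_comp x hg hf

/-- The base point of `g` is a separate variable, so that a value such as `g * 1` can be simplified
without rewriting inside a dependent type. -/
theorem td_comp_of_eq {g : M₂ → M₃} {f : M₁ → M₂} {x : M₁} {y : M₂} (hy : f x = y)
    (hg : MDifferentiableAt I₂ I₃ g y) (hf : MDifferentiableAt I₁ I₂ f x) :
    td I₁ I₃ (fun z => g (f z)) x = td I₂ I₃ g y ∘L td I₁ I₂ f x := by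
  subst hy; exact td_comp hg hf

theorem td_const (c : M₂) (x : M₁) : td I₁ I₂ (fun _ : M₁ => c) x = 0 :=
  mfderiv_const

theorem td_id (x : M₁) : td I₁ I₁ (fun y : M₁ => y) x = ContinuousLinearMap.id ℝ V₁ :=
  mfderiv_id

theorem td_congr {f g : M₁ → M₂} {x : M₁} (h : f =ᶠ[nhds x] g) :
    td I₁ I₂ f x = td I₁ I₂ g x :=
  Filter.EventuallyEq.mfderiv_eq h

theorem td_prodMk {f : M₁ → M₂} {g : M₁ → M₃} {x : M₁} (hf : MDifferentiableAt I₁ I₂ f x)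
    (hg : MDifferentiableAt I₁ I₃ g x) :
    td I₁ (I₂.prod I₃) (fun y => (f y, g y)) x = (td I₁ I₂ f x).prod (td I₁ I₃ g x) :=
  MDifferentiableAt.mfderiv_prod hf hg

theorem td_fst (x : M₁ × M₂) : td (I₁.prod I₂) I₁ (Prod.fst : M₁ × M₂ → M₁) x =
    ContinuousLinearMap.fst ℝ V₁ V₂ :=
  mfderiv_fst

theorem td_snd (x : M₁ × M₂) : td (I₁.prod I₂) I₂ (Prod.snd : M₁ × M₂ → M₂) x =
    ContinuousLinearMap.snd ℝ V₁ V₂ :=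
  mfderiv_snd

theorem td_prod_apply {f : M₁ × M₂ → M₃} {p : M₁ × M₂}
    (hf : MDifferentiableAt (I₁.prod I₂) I₃ f p) (v : V₁ × V₂) :
    td (I₁.prod I₂) I₃ f p v =
      td I₁ I₃ (fun z => f (z, p.2)) p.1 v.1 + td I₂ I₃ (fun z => f (p.1, z)) p.2 v.2 :=
  mfderiv_prod_eq_add_apply hf

end TangentMaps

/-! ### Derivatives of maps of Lie groups, trivialised by left translations -/

section Groups

variable {V₀ V₁ V₂ V₃ : Type*} [NormedAddCommGroup V₀] [NormedSpace ℝ V₀]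
  [NormedAddCommGroup V₁] [NormedSpace ℝ V₁]
  [NormedAddCommGroup V₂] [NormedSpace ℝ V₂] [NormedAddCommGroup V₃] [NormedSpace ℝ V₃]
  {H₀ H₁ H₂ H₃ : Type*} [TopologicalSpace H₀] [TopologicalSpace H₁] [TopologicalSpace H₂]
  [TopologicalSpace H₃]
  (I₀ : ModelWithCorners ℝ V₀ H₀)
  (I₁ : ModelWithCorners ℝ V₁ H₁) (I₂ : ModelWithCorners ℝ V₂ H₂) (I₃ : ModelWithCorners ℝ V₃ H₃)
  {M : Type*} [TopologicalSpace M] [ChartedSpace H₀ M]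
  {G₁ G₂ G₃ : Type*} [TopologicalSpace G₁] [ChartedSpace H₁ G₁] [Group G₁]
  [TopologicalSpace G₂] [ChartedSpace H₂ G₂] [Group G₂]
  [TopologicalSpace G₃] [ChartedSpace H₃ G₃] [Group G₃]

/-- The derivative of a map into a Lie group, trivialised by left translations. -/
def ltd (f : M → G₂) (x : M) : V₀ →L[ℝ] V₂ := td I₀ I₂ (fun y => (f x)⁻¹ * f y) x

/-- The derivative of a map between Lie groups, trivialised by left translations. -/
def gd (f : G₁ → G₂) (h : G₁) : V₁ →L[ℝ] V₂ := td I₁ I₂ (fun x => (f h)⁻¹ * f (h * x)) 1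

variable {I₀ I₁ I₂ I₃} [LieGroup I₁ ∞ G₁] [LieGroup I₂ ∞ G₂] [LieGroup I₃ ∞ G₃]

theorem mdiff_mul_left (c : G₁) : MDifferentiable I₁ I₁ (fun x : G₁ => c * x) :=
  (contMDiff_mul_left (I := I₁) (n := ∞) (a := c)).mdifferentiable (by simp)

theorem mdiff_mul_right (c : G₁) : MDifferentiable I₁ I₁ (fun x : G₁ => x * c) :=
  (contMDiff_mul_right (I := I₁) (n := ∞) (a := c)).mdifferentiable (by simp)

/-- The map `y ↦ (e x)⁻¹ * e y` sends `x` to 1, and composing it with `z ↦ (f (e x))⁻¹ * f (e x *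
z)` gives the trivialised composite. Trivialised derivatives therefore compose as operators between
Lie algebras, and their determinants multiply. -/
theorem ltd_comp {f : G₁ → G₂} {e : M → G₁} {x : M} (hf : MDifferentiable I₁ I₂ f)
    (he : MDifferentiableAt I₀ I₁ e x) :
    ltd I₀ I₂ (fun y => f (e y)) x = gd I₁ I₂ f (e x) ∘L ltd I₀ I₁ e x := by
  have h1 : MDifferentiableAt I₀ I₁ (fun y => (e x)⁻¹ * e y) x :=
    (mdiff_mul_left (e x)⁻¹ (e x)).comp x he
  have h2 : MDifferentiableAt I₁ I₂ (fun z => (f (e x))⁻¹ * f (e x * z)) 1 :=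
    (mdiff_mul_left (f (e x))⁻¹ _).comp _ ((hf _).comp _ (mdiff_mul_left (e x) 1))
  have := td_comp_of_eq (g := fun z => (f (e x))⁻¹ * f (e x * z)) (f := fun y => (e x)⁻¹ * e y)
    (x := x) (y := 1) (by simp) h2 h1
  simpa [ltd, gd] using this

theorem ltd_mul_left {f : G₁ → G₂} (hf : MDifferentiable I₁ I₂ f) (g : G₁) :
    ltd I₁ I₂ f g ∘L td I₁ I₁ (fun x => g * x) 1 = gd I₁ I₂ f g := by
  have h2 : MDifferentiableAt I₁ I₂ (fun z => (f g)⁻¹ * f z) (g * 1) :=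
    (mdiff_mul_left (f g)⁻¹ _).comp _ (hf _)
  have := td_comp (g := fun z => (f g)⁻¹ * f z) (f := fun y => g * y) (x := 1)
    h2 (mdiff_mul_left g 1)
  rw [mul_one] at this
  exact this.symm

theorem gd_comp {f : G₂ → G₃} {e : G₁ → G₂} (hf : MDifferentiable I₂ I₃ f)
    (he : MDifferentiable I₁ I₂ e) (g : G₁) :
    gd I₁ I₃ (fun y => f (e y)) g = gd I₂ I₃ f (e g) ∘L gd I₁ I₂ e g := by
  rw [← ltd_mul_left (f := fun y => f (e y)) (fun x => (hf (e x)).comp x (he x)) g,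
    ltd_comp hf (he g), ← ltd_mul_left he g]
  rfl

theorem gd_mul_left (c g : G₁) : gd I₁ I₁ (fun x : G₁ => c * x) g = ContinuousLinearMap.id ℝ V₁ := by
  simp [gd, mul_assoc, td_id]

/-- At the identity both partial maps of the product are identities. Later products are first
translated so that both factors take the value 1. -/
theorem td_mul_of_one {f e : M → G₂} {x : M} (hf : MDifferentiableAt I₀ I₂ f x)
    (he : MDifferentiableAt I₀ I₂ e x) (hf1 : f x = 1) (he1 : e x = 1) :
    td I₀ I₂ (fun y => f y * e y) x = td I₀ I₂ f x + td I₀ I₂ e x := by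
  have hm : MDifferentiableAt (I₂.prod I₂) I₂ (fun p : G₂ × G₂ => p.1 * p.2) (f x, e x) :=
    ((contMDiff_mul I₂ ∞).mdifferentiable (by simp)) _
  have h1 := td_comp (g := fun p : G₂ × G₂ => p.1 * p.2) (f := fun y => (f y, e y)) hm
    (hf.prodMk he)
  rw [show (fun y => f y * e y) = fun y => (fun p : G₂ × G₂ => p.1 * p.2) (f y, e y) from rfl, h1,
    td_prodMk hf he]
  ext v
  rw [ContinuousLinearMap.comp_apply, td_prod_apply hm]
  simp only [hf1, he1, mul_one, one_mul]
  rw [td_id]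
  rfl

theorem mdiff_inv : MDifferentiable I₁ I₁ (fun x : G₁ => x⁻¹) :=
  (contMDiff_inv I₁ ∞).mdifferentiable (by simp)

theorem mdiff_mul_mul {f e : M → G₂} (hf : MDifferentiable I₀ I₂ f)
    (he : MDifferentiable I₀ I₂ e) : MDifferentiable I₀ I₂ (fun x => f x * e x) := fun x =>
  MDifferentiableAt.comp (I' := I₂.prod I₂) (g := fun p : G₂ × G₂ => p.1 * p.2)
    (f := fun y => (f y, e y)) x
    (((contMDiff_mul I₂ ∞).mdifferentiable (by simp)) _) ((hf x).prodMk (he x))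

theorem mdiff_inv_fun {f : M → G₂} (hf : MDifferentiable I₀ I₂ f) :
    MDifferentiable I₀ I₂ (fun x => (f x)⁻¹) := mdiff_inv.comp hf

theorem td_inv_of_one {f : M → G₂} {x : M} (hf : MDifferentiable I₀ I₂ f) (hf1 : f x = 1) :
    td I₀ I₂ (fun y => (f y)⁻¹) x = - td I₀ I₂ f x := by
  have := td_mul_of_one (hf x) (mdiff_inv_fun hf x) hf1 (by simp [hf1])
  simp only [mul_inv_cancel, td_const] at this
  exact (neg_eq_of_add_eq_zero_right this.symm).symm

/-- The adjoint representation. -/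
def adj (I₁ : ModelWithCorners ℝ V₁ H₁) (g : G₁) : V₁ →L[ℝ] V₁ :=
  td I₁ I₁ (fun x : G₁ => g * x * g⁻¹) 1

theorem mdiff_conj (g : G₁) : MDifferentiable I₁ I₁ (fun x : G₁ => g * x * g⁻¹) := fun x =>
  (mdiff_mul_right g⁻¹ _).comp x (mdiff_mul_left g x)

theorem td_conj_comp {f : M → G₂} {x : M} (hf : MDifferentiableAt I₀ I₂ f x) (hf1 : f x = 1)
    (g : G₂) : td I₀ I₂ (fun y => g * f y * g⁻¹) x = adj I₂ g ∘L td I₀ I₂ f x := by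
  have := td_comp (g := fun x : G₂ => g * x * g⁻¹) (f := f) (x := x) (mdiff_conj g _) hf
  rw [hf1] at this
  exact this

theorem gd_mul_right (c g : G₁) : gd I₁ I₁ (fun x : G₁ => x * c) g = adj I₁ c⁻¹ := by
  have h : (fun x : G₁ => (g * c)⁻¹ * (g * x * c)) = fun x => c⁻¹ * x * (c⁻¹)⁻¹ := by
    funext x; group
  rw [gd, h]; rfl

theorem adj_mul (g h : G₁) : adj I₁ (g * h) = adj I₁ g ∘L adj I₁ h := by
  have := td_conj_comp (I₀ := I₁) (mdiff_conj h 1) (by simp) g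
  rw [show adj I₁ h = td I₁ I₁ (fun x : G₁ => h * x * h⁻¹) 1 from rfl, ← this, adj]
  congr 1; funext x; group

theorem adj_one : adj I₁ (1 : G₁) = ContinuousLinearMap.id ℝ V₁ := by
  simp [adj, td_id]

theorem adj_inv_comp (g : G₁) : adj I₁ g⁻¹ ∘L adj I₁ g = ContinuousLinearMap.id ℝ V₁ := by
  rw [← adj_mul, inv_mul_cancel, adj_one]

theorem adj_comp_inv (g : G₁) : adj I₁ g ∘L adj I₁ g⁻¹ = ContinuousLinearMap.id ℝ V₁ := by
  rw [← adj_mul, mul_inv_cancel, adj_one]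

/-- Left translation by `h⁻¹`, from the tangent space at `h` to the Lie algebra. -/
theorem td_inv_mul_comp {f : M → G₂} {x : M} (hf : MDifferentiableAt I₀ I₂ f x) :
    td I₂ I₂ (fun y => (f x)⁻¹ * y) (f x) ∘L td I₀ I₂ f x = ltd I₀ I₂ f x :=
  (td_comp (g := fun y => (f x)⁻¹ * y) (mdiff_mul_left _ _) hf).symm

theorem td_mul_left_inverse (g : G₁) :
    td I₁ I₁ (fun x => g⁻¹ * x) g ∘L td I₁ I₁ (fun x => g * x) 1 = ContinuousLinearMap.id ℝ V₁ := by
  have := td_comp (g := fun x => g⁻¹ * x) (f := fun x => g * x) (x := 1)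
    (mdiff_mul_left (I₁ := I₁) g⁻¹ (g * 1)) (mdiff_mul_left g 1)
  simp only [inv_mul_cancel_left, td_id, mul_one] at this
  exact this.symm

end Groups

end

end DLG

namespace DLG

set_option linter.unusedSectionVars false

noncomputable section

/-! ### Determinants of frames -/

theorem stdVec_eq (n : ℕ) (i : Fin n) : stdVec n i = (EuclideanSpace.basisFun (Fin n) ℝ).toBasis i := by
  simp [stdVec]

theorem frameDet_map {n : ℕ} (L : E n →ₗ[ℝ] E n) (u : Fin n → E n) :
    frameDet (fun i => L (u i)) = LinearMap.det L * frameDet u := by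
  set b := (EuclideanSpace.basisFun (Fin n) ℝ).toBasis
  have h : ∀ u : Fin n → E n, frameDet u = b.det u := by
    intro u
    rw [Module.Basis.det_apply, frameDet, ← Matrix.det_transpose]
    congr 1
  rw [h, h]
  exact Module.Basis.det_comp b L u

theorem frameDet_stdVec (n : ℕ) : frameDet (stdVec n) = 1 := by
  rw [frameDet, ← Matrix.det_one (n := Fin n) (R := ℝ)]
  congr 1
  ext i j
  simp [stdVec, Matrix.one_apply, eq_comm]

theorem frameDet_map_stdVec {n : ℕ} (L : E n →ₗ[ℝ] E n) :
    frameDet (fun i => L (stdVec n i)) = LinearMap.det L := by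
  rw [frameDet_map L (stdVec n), frameDet_stdVec, mul_one]

theorem measurableSet_inter_preimage {X Y : Type*} [TopologicalSpace X] [MeasurableSpace X]
    [BorelSpace X] [TopologicalSpace Y] [MeasurableSpace Y] [BorelSpace Y] {f : X → Y} {s : Set X}
    (hf : ContinuousOn f s) (hs : MeasurableSet s) {t : Set Y} (ht : MeasurableSet t) :
    MeasurableSet (s ∩ f ⁻¹' t) := by
  have h := (continuousOn_iff_continuous_domRestrict.mp hf).measurable ht
  have h2 := hs.subtype_image h
  convert h2 using 1
  ext x
  simp [Set.mem_image, and_comm]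

/-! ### The measure of the left-invariant density in coordinates -/

section Coord

variable {n : ℕ} {H : Type*} [Group H] [TopologicalSpace H] [ChartedSpace (E n) H]
  [LieGroup (𝓡 n) ∞ H]

/-- Coordinate systems which are differentiable in both directions. -/
structure IsCoord (e : OpenPartialHomeomorph H (E n)) : Prop where
  mdiff : MDifferentiableOn (𝓡 n) (𝓡 n) e e.source
  mdiff_symm : MDifferentiableOn (𝓡 n) (𝓡 n) e.symm e.target

theorem isCoord_chartAt (x : H) : IsCoord (chartAt (E n) x) := by
  have : IsManifold (𝓡 n) 1 H := IsManifold.of_le (n := ∞) (by simp)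
  constructor
  · exact mdifferentiableOn_atlas (chart_mem_atlas _ x)
  · exact mdifferentiableOn_atlas_symm (chart_mem_atlas _ x)

theorem IsCoord.mdiffAt {e : OpenPartialHomeomorph H (E n)} (he : IsCoord e) {x : H}
    (hx : x ∈ e.source) : MDifferentiableAt (𝓡 n) (𝓡 n) e x :=
  (he.mdiff x hx).mdifferentiableAt (e.open_source.mem_nhds hx)

theorem IsCoord.mdiffAt_symm {e : OpenPartialHomeomorph H (E n)} (he : IsCoord e) {x : E n}
    (hx : x ∈ e.target) : MDifferentiableAt (𝓡 n) (𝓡 n) e.symm x :=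
  (he.mdiff_symm x hx).mdifferentiableAt (e.open_target.mem_nhds hx)

/-- The coefficient of the left-invariant density in a coordinate system. -/
def coordDens (e : OpenPartialHomeomorph H (E n)) (y : E n) : ℝ :=
  |LinearMap.det (ltd (𝓡 n) (𝓡 n) e.symm y : E n →ₗ[ℝ] E n)|

theorem leftDensity_map {M : Type*} [TopologicalSpace M] [ChartedSpace (E n) M]
    {f : M → H} {x : M} (hf : MDifferentiableAt (𝓡 n) (𝓡 n) f x) (u : Fin n → E n) :
    leftDensity n H (f x) (fun i => (td (𝓡 n) (𝓡 n) f x (u i) : E n)) =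
      |LinearMap.det (ltd (𝓡 n) (𝓡 n) f x : E n →ₗ[ℝ] E n)| * |frameDet u| := by
  rw [← abs_mul, ← frameDet_map, ← td_inv_mul_comp hf]
  rfl

variable [MeasurableSpace H] [BorelSpace H]

/-- The measure of the left-invariant density on the domain of a coordinate system. -/
def coordMeasure (e : OpenPartialHomeomorph H (E n)) : Measure H :=
  (((volume : Measure (E n)).restrict e.target).withDensity
    (fun y => ENNReal.ofReal (coordDens e y))).map e.symm

theorem refMeasure_eq_iSup : refMeasure n H = ⨆ x : H, coordMeasure (chartAt (E n) x) := by
  rw [refMeasure, densityMeasure]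
  congr 1
  funext x
  rw [coordMeasure]
  congr 1
  -- Only the target of the chart matters. Outside it the inverse chart need not be differentiable,
  -- and the chain rule identifying the two densities is not available.
  rw [← withDensity_indicator (chartAt (E n) x).open_target.measurableSet,
    ← withDensity_indicator (chartAt (E n) x).open_target.measurableSet]
  congr 1
  funext y
  by_cases hy : y ∈ (chartAt (E n) x).target
  · simp only [Set.indicator_of_mem hy]
    have := leftDensity_map ((isCoord_chartAt x).mdiffAt_symm hy) (stdVec n)
    rw [frameDet_stdVec, abs_one, mul_one] at this
    rw [coordDens, ← this]
    rfl
  · simp [Set.indicator_of_notMem hy]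

theorem aemeasurable_symm (e : OpenPartialHomeomorph H (E n)) (f : E n → ENNReal) :
    AEMeasurable e.symm (((volume : Measure (E n)).restrict e.target).withDensity f) :=
  (e.continuousOn_symm.aemeasurable e.open_target.measurableSet).mono_ac
    (withDensity_absolutelyContinuous _ _)

theorem coordMeasure_apply (e : OpenPartialHomeomorph H (E n)) {S : Set H} (hS : MeasurableSet S) :
    coordMeasure e S = ∫⁻ y in e.target ∩ e.symm ⁻¹' S, ENNReal.ofReal (coordDens e y) := by
  rw [coordMeasure, Measure.map_apply_of_aemeasurable (aemeasurable_symm e _) hS, withDensity_apply',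
    Measure.restrict_restrict' e.open_target.measurableSet, Set.inter_comm]

theorem coordMeasure_compl (e : OpenPartialHomeomorph H (E n)) {S : Set H} (hS : MeasurableSet S) :
    coordMeasure e S = coordMeasure e (S ∩ e.source) := by
  rw [coordMeasure_apply e hS, coordMeasure_apply e (hS.inter e.open_source.measurableSet)]
  congr 2
  ext y
  simp only [Set.mem_inter_iff, Set.mem_preimage]
  constructor
  · rintro ⟨h1, h2⟩; exact ⟨h1, h2, e.map_target h1⟩
  · rintro ⟨h1, h2, -⟩; exact ⟨h1, h2⟩

/-- Change of variables along the transition map `T`: both inverse charts give the same point of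
`H`, so the trivialised derivative of `e.symm` is that of `e'.symm` composed with the derivative of
`T`. -/
theorem coordMeasure_congr {e e' : OpenPartialHomeomorph H (E n)} (he : IsCoord e)
    (he' : IsCoord e') {S : Set H} (hS : MeasurableSet S) (h1 : S ⊆ e.source)
    (h2 : S ⊆ e'.source) : coordMeasure e S = coordMeasure e' S := by
  rw [coordMeasure_apply e hS, coordMeasure_apply e' hS]
  set T : E n → E n := fun y => e' (e.symm y) with hT
  set s := e.target ∩ e.symm ⁻¹' S with hs
  have hsm : MeasurableSet s :=
    measurableSet_inter_preimage e.continuousOn_symm e.open_target.measurableSet hS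
  have himg : e'.target ∩ e'.symm ⁻¹' S = T '' s := by
    ext z
    constructor
    · rintro ⟨hz, hzS⟩
      refine ⟨e (e'.symm z), ⟨e.map_source (h1 hzS), ?_⟩, ?_⟩
      · simpa [e.left_inv (h1 hzS)] using hzS
      · simp [hT, e.left_inv (h1 hzS), e'.right_inv hz]
    · rintro ⟨y, ⟨hy, hyS⟩, rfl⟩
      exact ⟨e'.map_source (h2 hyS), by simpa [hT, e'.left_inv (h2 hyS)] using hyS⟩
  have hTd : ∀ y ∈ s, MDifferentiableAt (𝓡 n) (𝓡 n) T y := fun y hy =>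
    (he'.mdiffAt (h2 hy.2)).comp y (he.mdiffAt_symm hy.1)
  have hTd' : ∀ y ∈ s, HasFDerivWithinAt T (td (𝓡 n) (𝓡 n) T y) s y := fun y hy =>
    (hTd y hy).hasMFDerivAt.hasFDerivAt.hasFDerivWithinAt
  have hinj : Set.InjOn T s := by
    intro y hy y' hy' h
    have h3 : e.symm y = e.symm y' := e'.injOn (h2 hy.2) (h2 hy'.2) h
    exact e.symm.injOn hy.1 hy'.1 h3
  rw [himg, lintegral_image_eq_lintegral_abs_det_fderiv_mul volume hsm hTd' hinj]
  refine setLIntegral_congr_fun hsm fun y hy => ?_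
  simp only [coordDens]
  rw [← ENNReal.ofReal_mul (abs_nonneg _), ← abs_mul]
  congr 2
  have hev : (fun z => (e.symm y)⁻¹ * e.symm z) =ᶠ[nhds y]
      fun z => (e'.symm (T y))⁻¹ * e'.symm (T z) := by
    have : e.target ∩ e.symm ⁻¹' e'.source ∈ nhds y :=
      (e.symm.isOpen_inter_preimage e'.open_source).mem_nhds ⟨hy.1, h2 hy.2⟩
    filter_upwards [this] with z hz
    simp only [hT]
    rw [e'.left_inv hz.2, e'.left_inv (h2 hy.2)]
  have hc : ltd (𝓡 n) (𝓡 n) e.symm y = ltd (𝓡 n) (𝓡 n) e'.symm (T y) ∘L td (𝓡 n) (𝓡 n) T y := by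
    rw [ltd, td_congr hev]
    exact td_comp (g := fun z => (e'.symm (T y))⁻¹ * e'.symm z)
      ((mdiff_mul_left _ _).comp _ (he'.mdiffAt_symm (e'.map_source (h2 hy.2)))) (hTd y hy)
  rw [hc, mul_comm]
  exact LinearMap.det_comp _ _

variable [SecondCountableTopology H]

theorem exists_seq_cover (U : H → Set H) (hU : ∀ x, U x ∈ nhds x) :
    ∃ c : ℕ → H, ⋃ i, U (c i) = Set.univ := by
  obtain ⟨s, hs, hsU⟩ := TopologicalSpace.countable_cover_nhds hU
  have hne : s.Nonempty := by
    by_contra h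
    rw [Set.not_nonempty_iff_eq_empty] at h
    subst h
    simp only [Set.mem_empty_iff_false, Set.iUnion_of_empty, Set.iUnion_empty] at hsU
    exact (Set.empty_ne_univ hsU).elim
  obtain ⟨c, rfl⟩ := hs.exists_eq_range hne
  exact ⟨c, by simpa using hsU⟩

theorem measure_eq_tsum_disjointed {X : Type*} [MeasurableSpace X] (μ : Measure X)
    (U : ℕ → Set X) (hU : ∀ i, MeasurableSet (U i)) (hc : ⋃ i, U i = Set.univ) {S : Set X}
    (hS : MeasurableSet S) : μ S = ∑' i, μ (S ∩ disjointed U i) := by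
  rw [← measure_iUnion, ← Set.inter_iUnion, iUnion_disjointed, hc, Set.inter_univ]
  · intro i j hij
    exact ((disjoint_disjointed U) hij).mono Set.inter_subset_right Set.inter_subset_right
  · exact fun i => hS.inter (MeasurableSet.disjointed hU i)

/-- Chart measures agree on overlaps, so they can be glued: cutting `H` into countably many disjoint
pieces, each inside a chart, gives a measure `ν` which equals every chart measure on its chart. Thus
`ν` is an upper bound of the chart measures, and their supremum is squeezed between the chart
measure and `ν`. -/
theorem refMeasure_apply_chart (x : H) {S : Set H} (hS : MeasurableSet S)
    (h : S ⊆ (chartAt (E n) x).source) :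
    refMeasure n H S = coordMeasure (chartAt (E n) x) S := by
  obtain ⟨c, hc⟩ := exists_seq_cover (fun x : H => (chartAt (E n) x).source)
    (chart_source_mem_nhds (E n))
  set U : ℕ → Set H := fun i => (chartAt (E n) (c i)).source with hU
  have hUm : ∀ i, MeasurableSet (U i) := fun i => (chartAt (E n) (c i)).open_source.measurableSet
  have hP : ∀ i, MeasurableSet (disjointed U i) := fun i => MeasurableSet.disjointed hUm i
  refine le_antisymm ?_ ?_
  · set ν : Measure H := Measure.sum fun i =>
      (coordMeasure (chartAt (E n) (c i))).restrict (disjointed U i) with hν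
    have key : ∀ (y : H) {T : Set H}, MeasurableSet T → T ⊆ (chartAt (E n) y).source →
        coordMeasure (chartAt (E n) y) T = ν T := by
      intro y T hT hTy
      rw [hν, Measure.sum_apply _ hT, measure_eq_tsum_disjointed _ U hUm hc hT]
      refine tsum_congr fun i => ?_
      rw [Measure.restrict_apply hT]
      exact coordMeasure_congr (isCoord_chartAt _) (isCoord_chartAt _) (hT.inter (hP i))
        (Set.inter_subset_left.trans hTy)
        (Set.inter_subset_right.trans (disjointed_subset U i))
    have hle : refMeasure n H ≤ ν := by
      rw [refMeasure_eq_iSup]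
      refine iSup_le fun y => Measure.le_iff.mpr fun T hT => ?_
      rw [coordMeasure_compl _ hT, key y (hT.inter (chartAt (E n) y).open_source.measurableSet)
        Set.inter_subset_right]
      exact measure_mono Set.inter_subset_left
    rw [key x hS h]
    exact hle S
  · rw [refMeasure_eq_iSup]
    exact Measure.le_iff'.mp (le_iSup (fun x : H => coordMeasure (chartAt (E n) x)) x) S

/-- The reference measure in an arbitrary coordinate system. -/
theorem refMeasure_apply_of_subset {e : OpenPartialHomeomorph H (E n)} (he : IsCoord e)
    {S : Set H} (hS : MeasurableSet S) (h : S ⊆ e.source) :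
    refMeasure n H S = coordMeasure e S := by
  obtain ⟨c, hc⟩ := exists_seq_cover (fun x : H => (chartAt (E n) x).source)
    (chart_source_mem_nhds (E n))
  set U : ℕ → Set H := fun i => (chartAt (E n) (c i)).source with hU
  have hUm : ∀ i, MeasurableSet (U i) := fun i => (chartAt (E n) (c i)).open_source.measurableSet
  have hP : ∀ i, MeasurableSet (disjointed U i) := fun i => MeasurableSet.disjointed hUm i
  rw [measure_eq_tsum_disjointed _ U hUm hc hS, measure_eq_tsum_disjointed _ U hUm hc hS]
  refine tsum_congr fun i => ?_
  have h2 : S ∩ disjointed U i ⊆ (chartAt (E n) (c i)).source :=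
    Set.inter_subset_right.trans (disjointed_subset U i)
  rw [refMeasure_apply_chart (c i) (hS.inter (hP i)) h2]
  exact coordMeasure_congr (isCoord_chartAt _) he (hS.inter (hP i)) h2
    (Set.inter_subset_left.trans h)

theorem refMeasure_restrict_eq {e : OpenPartialHomeomorph H (E n)} (he : IsCoord e) :
    (refMeasure n H).restrict e.source = coordMeasure e := by
  ext S hS
  rw [Measure.restrict_apply hS, coordMeasure_compl e hS]
  exact refMeasure_apply_of_subset he (hS.inter e.open_source.measurableSet) Set.inter_subset_right

/-- Two measures which agree near every point are equal. -/
theorem measure_ext_of_nhds {μ ν : Measure H} (U : H → Set H) (hU : ∀ x, U x ∈ nhds x)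
    (hUo : ∀ x, IsOpen (U x))
    (h : ∀ x, ∀ S ⊆ U x, MeasurableSet S → μ S = ν S) : μ = ν := by
  obtain ⟨c, hc⟩ := exists_seq_cover U hU
  have hUm : ∀ i, MeasurableSet (U (c i)) := fun i => (hUo _).measurableSet
  ext S hS
  rw [measure_eq_tsum_disjointed μ _ hUm hc hS, measure_eq_tsum_disjointed ν _ hUm hc hS]
  refine tsum_congr fun i => h (c i) _ ?_ (hS.inter (MeasurableSet.disjointed hUm i))
  exact Set.inter_subset_right.trans (disjointed_subset _ i)

end Coord

end

end DLG

namespace DLG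

set_option linter.unusedSectionVars false

noncomputable section

/-! ### Smooth dependence of derivatives on parameters -/

section Smooth

variable {V₀ V₁ V₂ : Type*} [NormedAddCommGroup V₀] [NormedSpace ℝ V₀]
  [NormedAddCommGroup V₁] [NormedSpace ℝ V₁] [NormedAddCommGroup V₂] [NormedSpace ℝ V₂]
  {H₀ H₁ H₂ : Type*} [TopologicalSpace H₀] [TopologicalSpace H₁] [TopologicalSpace H₂]
  {J : ModelWithCorners ℝ V₀ H₀} {I : ModelWithCorners ℝ V₁ H₁} {I' : ModelWithCorners ℝ V₂ H₂}
  {N M M' : Type*} [TopologicalSpace N] [ChartedSpace H₀ N] [TopologicalSpace M] [ChartedSpace H₁ M]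
  [TopologicalSpace M'] [ChartedSpace H₂ M'] [IsManifold J ∞ N] [IsManifold I ∞ M]
  [IsManifold I' ∞ M']

/-- As `c` and `d` do not move, the coordinate changes of the tangent bundles that enter the general
smoothness statement are identities, and the derivative is a smooth map into one fixed space of
operators. Trivialised derivatives and `adj` have this form, with `d = 1`. -/
theorem contMDiffAt_td {f : N → M → M'} {x₀ : N} {c : M} {d : M'}
    (hf : ContMDiffAt (J.prod I) I' ∞ (Function.uncurry f) (x₀, c)) (hd : ∀ x, f x c = d) :
    ContMDiffAt J 𝓘(ℝ, V₁ →L[ℝ] V₂) ∞ (fun x => td I I' (f x) c) x₀ := by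
  have : IsManifold I 1 M := IsManifold.of_le (n := ∞) (by simp)
  have : IsManifold I' 1 M' := IsManifold.of_le (n := ∞) (by simp)
  have h := ContMDiffAt.mfderiv (m := ∞) (n := ∞) f (fun _ : N => c) hf contMDiffAt_const (by simp)
  suffices heq : (fun x => td I I' (f x) c) = inTangentCoordinates I I' (fun _ : N => c)
      (fun x => f x c) (fun x => mfderiv I I' (f x) c) x₀ by
    rw [heq]; exact h
  funext x
  have hin := inTangentCoordinates_eq (I := I) (I' := I') (fun _ : N => c) (fun x => f x c)
    (fun x => td I I' (f x) c) (x₀ := x₀) (x := x)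
    (mem_chart_source H₁ c) (by rw [hd, hd]; exact mem_chart_source H₂ d)
  refine Eq.trans ?_ hin.symm
  ext v
  rw [ContinuousLinearMap.comp_apply, ContinuousLinearMap.comp_apply]
  have h1 : ∀ v, (tangentBundleCore I M).coordChange (achart H₁ c) (achart H₁ c) c v = v := fun v =>
    (tangentBundleCore I M).coordChange_self (achart H₁ c) c (mem_chart_source H₁ c) v
  have h2 : ∀ v, (tangentBundleCore I' M').coordChange (achart H₂ (f x c)) (achart H₂ (f x₀ c))
      (f x c) v = v := fun v => by
    rw [hd, hd]
    exact (tangentBundleCore I' M').coordChange_self (achart H₂ d) d (mem_chart_source H₂ d) v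
  rw [h1, h2]

end Smooth

section GroupSmooth

variable {V₁ V₂ : Type*} 
  [NormedAddCommGroup V₁] [NormedSpace ℝ V₁] [NormedAddCommGroup V₂] [NormedSpace ℝ V₂]
  {H₁ H₂ : Type*} [TopologicalSpace H₁] [TopologicalSpace H₂]
  {I : ModelWithCorners ℝ V₁ H₁} {I' : ModelWithCorners ℝ V₂ H₂}
  {G₁ G₂ : Type*} [TopologicalSpace G₁] [ChartedSpace H₁ G₁] [Group G₁]
  [TopologicalSpace G₂] [ChartedSpace H₂ G₂] [Group G₂] [LieGroup I ∞ G₁] [LieGroup I' ∞ G₂]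

theorem contMDiff_gd {F : G₁ → G₂} (hF : ContMDiff I I' ∞ F) :
    ContMDiff I 𝓘(ℝ, V₁ →L[ℝ] V₂) ∞ (fun h => gd I I' F h) := fun h =>
  contMDiffAt_td (f := fun h x => (F h)⁻¹ * F (h * x)) (d := 1)
    ((((hF.comp contMDiff_fst).inv).mul (hF.comp (contMDiff_fst.mul contMDiff_snd))).contMDiffAt)
    (by simp)

theorem contMDiff_adj : ContMDiff I 𝓘(ℝ, V₁ →L[ℝ] V₁) ∞ (fun h : G₁ => adj I h) := fun h =>
  contMDiffAt_td (f := fun h x => h * x * h⁻¹) (d := 1)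
    (((contMDiff_fst.mul contMDiff_snd).mul contMDiff_fst.inv).contMDiffAt) (by simp)

end GroupSmooth

theorem contDiff_det {V : Type*} [NormedAddCommGroup V] [NormedSpace ℝ V]
    [FiniteDimensional ℝ V] :
    ContDiff ℝ ∞ (fun L : V →L[ℝ] V => LinearMap.det (L : V →ₗ[ℝ] V)) := by
  let b := Module.finBasis ℝ V
  have h : ∀ L : V →L[ℝ] V, LinearMap.det (L : V →ₗ[ℝ] V) =
      Matrix.det (LinearMap.toMatrix b b (L : V →ₗ[ℝ] V)) := fun L =>
    (LinearMap.det_toMatrix b _).symm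
  simp_rw [h, Matrix.det_apply]
  refine ContDiff.sum fun σ _ => ContDiff.const_smul _ (contDiff_prod fun i _ => ?_)
  let ℓ : (V →L[ℝ] V) →ₗ[ℝ] ℝ :=
    { toFun := fun L => LinearMap.toMatrix b b (L : V →ₗ[ℝ] V) (σ i) i
      map_add' := by intro x y; simp [LinearMap.toMatrix_apply]
      map_smul' := by intro x y; simp [LinearMap.toMatrix_apply] }
  exact (LinearMap.toContinuousLinearMap ℓ).contDiff

theorem continuous_det {V : Type*} [NormedAddCommGroup V] [NormedSpace ℝ V]
    [FiniteDimensional ℝ V] :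
    Continuous (fun L : V →L[ℝ] V => LinearMap.det (L : V →ₗ[ℝ] V)) := contDiff_det.continuous

/-! ### Change of variables for the left-invariant measures -/

section CoordSmooth

variable {n : ℕ} {H : Type*} [Group H] [TopologicalSpace H] [ChartedSpace (E n) H]
  [LieGroup (𝓡 n) ∞ H]

theorem continuousOn_coordDens {e : OpenPartialHomeomorph H (E n)}
    (he : ContMDiffOn (𝓡 n) (𝓡 n) ∞ e.symm e.target) : ContinuousOn (coordDens e) e.target := by
  have key : ContinuousOn (fun y => ltd (𝓡 n) (𝓡 n) e.symm y) e.target := by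
    intro y hy
    have hsm : ∀ z ∈ e.target, ContMDiffAt (𝓡 n) (𝓡 n) ∞ e.symm z := fun z hz =>
      (he z hz).contMDiffAt (e.open_target.mem_nhds hz)
    -- Translating the coordinate by `y` makes the base point 0 and the value 1 for the whole
    -- family.
    have h := contMDiffAt_td (J := 𝓡 n) (I := 𝓡 n) (I' := 𝓡 n) (x₀ := y) (c := (0 : E n))
      (f := fun y v => (e.symm y)⁻¹ * e.symm (y + v)) (d := 1) (by
        have h1 : ContMDiffAt ((𝓡 n).prod (𝓡 n)) (𝓡 n) ∞ (fun p : E n × E n => e.symm p.1) (y, 0) :=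
          ContMDiffAt.comp (y, (0 : E n)) (hsm y hy) contMDiffAt_fst
        have h2 : ContMDiffAt ((𝓡 n).prod (𝓡 n)) (𝓡 n) ∞
            (fun p : E n × E n => e.symm (p.1 + p.2)) (y, 0) := by
          refine ContMDiffAt.comp (y, (0 : E n)) (g := e.symm) (f := fun p : E n × E n => p.1 + p.2)
            (by simpa using hsm y hy) ?_
          exact (contMDiffAt_fst (I := 𝓡 n) (J := 𝓡 n)).add (contMDiffAt_snd (I := 𝓡 n) (J := 𝓡 n))
        exact h1.inv.mul h2) (by simp)
    have htr : ∀ z ∈ e.target, ltd (𝓡 n) (𝓡 n) e.symm z =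
        td (𝓡 n) (𝓡 n) (fun v => (e.symm z)⁻¹ * e.symm (z + v)) 0 := by
      intro z hz
      have hz' : MDifferentiableAt (𝓡 n) (𝓡 n) (fun w => (e.symm z)⁻¹ * e.symm w) z :=
        (mdiff_mul_left _ _).comp z ((hsm z hz).mdifferentiableAt (by simp))
      have hadd : HasFDerivAt (fun v : E n => z + v) (ContinuousLinearMap.id ℝ (E n)) 0 :=
        (hasFDerivAt_id _).const_add z
      rw [td_comp_of_eq (g := fun w => (e.symm z)⁻¹ * e.symm w) (f := fun v : E n => z + v)
        (add_zero z) hz' hadd.hasMFDerivAt.mdifferentiableAt]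
      rw [show td (𝓡 n) (𝓡 n) (fun v : E n => z + v) 0 = ContinuousLinearMap.id ℝ (E n) from
        hadd.hasMFDerivAt.mfderiv]
      rfl
    exact (h.continuousAt.continuousWithinAt (s := e.target)).congr (fun z hz => htr z hz) (htr y hy)
  intro y hy
  exact (continuous_abs.comp continuous_det).continuousAt.comp_continuousWithinAt (key y hy)

theorem contMDiffOn_chartAt_symm' (x : H) :
    ContMDiffOn (𝓡 n) (𝓡 n) ∞ (chartAt (E n) x).symm (chartAt (E n) x).target :=
  contMDiffOn_chart_symm

variable [MeasurableSpace H] [BorelSpace H]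

theorem aemeasurable_coordDens {e : OpenPartialHomeomorph H (E n)}
    (he : ContMDiffOn (𝓡 n) (𝓡 n) ∞ e.symm e.target) :
    AEMeasurable (fun y => ENNReal.ofReal (coordDens e y))
      ((volume : Measure (E n)).restrict e.target) :=
  ((continuousOn_coordDens he).aemeasurable e.open_target.measurableSet).ennreal_ofReal

theorem lintegral_coordMeasure {e : OpenPartialHomeomorph H (E n)}
    (he : ContMDiffOn (𝓡 n) (𝓡 n) ∞ e.symm e.target) {g : H → ENNReal} (hg : Measurable g) :
    ∫⁻ h, g h ∂(coordMeasure e) =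
      ∫⁻ y in e.target, ENNReal.ofReal (coordDens e y) * g (e.symm y) := by
  rw [coordMeasure, lintegral_map' hg.aemeasurable (aemeasurable_symm e _),
    lintegral_withDensity_eq_lintegral_mul₀ (aemeasurable_coordDens he)]
  · rfl
  · exact hg.comp_aemeasurable (e.continuousOn_symm.aemeasurable e.open_target.measurableSet)

variable [SecondCountableTopology H]

theorem setLIntegral_chart (x : H) {g : H → ENNReal} (hg : Measurable g) :
    ∫⁻ h in (chartAt (E n) x).source, g h ∂(refMeasure n H) =
      ∫⁻ y in (chartAt (E n) x).target,
        ENNReal.ofReal (coordDens (chartAt (E n) x) y) * g ((chartAt (E n) x).symm y) := by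
  rw [refMeasure_restrict_eq (isCoord_chartAt x),
    lintegral_coordMeasure (contMDiffOn_chartAt_symm' x) hg]

/-- The coordinate density is continuous, hence bounded on a small ball. Local finiteness makes
continuous functions with compact support square-integrable and, with second countability, permits
Fubini. -/
instance isLocallyFiniteMeasure_refMeasure : IsLocallyFiniteMeasure (refMeasure n H) := by
  refine ⟨fun x => ?_⟩
  set e := chartAt (E n) x
  have hx : e x ∈ e.target := mem_chart_target _ x
  have hc : ContinuousAt (coordDens e) (e x) :=
    (continuousOn_coordDens (contMDiffOn_chartAt_symm' x)).continuousAt (e.open_target.mem_nhds hx)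
  have h1 : ∀ᶠ y in nhds (e x), coordDens e y < coordDens e (e x) + 1 :=
    hc.eventually_lt continuousAt_const (by linarith)
  obtain ⟨r, hr, hball⟩ := Metric.eventually_nhds_iff_ball.mp
    (h1.and (e.open_target.eventually_mem hx))
  have hopen : IsOpen (e.source ∩ e ⁻¹' Metric.ball (e x) r) :=
    e.isOpen_inter_preimage Metric.isOpen_ball
  refine ⟨_, hopen.mem_nhds ⟨mem_chart_source _ x, Metric.mem_ball_self hr⟩, ?_⟩
  rw [refMeasure_apply_chart x hopen.measurableSet Set.inter_subset_left,
    coordMeasure_apply _ hopen.measurableSet]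
  calc _ ≤ ∫⁻ y in Metric.ball (e x) r, ENNReal.ofReal (coordDens e (e x) + 1) := by
        refine (setLIntegral_mono' ?_ ?_).trans (lintegral_mono_set ?_)
        · exact measurableSet_inter_preimage e.continuousOn_symm e.open_target.measurableSet
            hopen.measurableSet
        · rintro y ⟨hy, -, hy2⟩
          rw [Set.mem_preimage, e.right_inv hy] at hy2
          exact ENNReal.ofReal_le_ofReal (hball y hy2).1.le
        · rintro y ⟨hy, -, hy2⟩
          rwa [Set.mem_preimage, e.right_inv hy] at hy2
    _ < ⊤ := by
        rw [setLIntegral_const]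
        exact ENNReal.mul_lt_top ENNReal.ofReal_lt_top measure_ball_lt_top

variable {H' : Type*} [Group H'] [TopologicalSpace H'] [ChartedSpace (E n) H']
  [LieGroup (𝓡 n) ∞ H'] [MeasurableSpace H'] [BorelSpace H'] [SecondCountableTopology H']

theorem measurable_abs_det_gd {F : H → H'} (hF : ContMDiff (𝓡 n) (𝓡 n) ∞ F) :
    Measurable (fun h => ENNReal.ofReal
      |LinearMap.det (gd (𝓡 n) (𝓡 n) F h : E n →ₗ[ℝ] E n)|) :=
  (continuous_abs.comp (continuous_det.comp (contMDiff_gd hF).continuous)).measurable.ennreal_ofReal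

/-- Change of variables under a diffeomorphism of Lie groups. -/
theorem lintegral_refMeasure_diffeo (F : H ≃ₜ H') (hF : ContMDiff (𝓡 n) (𝓡 n) ∞ F)
    (hF' : ContMDiff (𝓡 n) (𝓡 n) ∞ F.symm) {f : H' → ENNReal} (hf : Measurable f) :
    ∫⁻ h, ENNReal.ofReal |LinearMap.det (gd (𝓡 n) (𝓡 n) F h : E n →ₗ[ℝ] E n)| * f (F h)
      ∂(refMeasure n H) = ∫⁻ h, f h ∂(refMeasure n H') := by
  have hJ := measurable_abs_det_gd hF
  suffices h : ((refMeasure n H).withDensity fun h => ENNReal.ofReal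
      |LinearMap.det (gd (𝓡 n) (𝓡 n) F h : E n →ₗ[ℝ] E n)|).map F = refMeasure n H' by
    rw [← h, lintegral_map hf F.continuous.measurable]
    exact (lintegral_withDensity_eq_lintegral_mul _ hJ (hf.comp F.continuous.measurable)).symm
  refine measure_ext_of_nhds (fun x => F.symm ⁻¹' (chartAt (E n) (F.symm x)).source)
    (fun x => F.symm.continuous.continuousAt.preimage_mem_nhds (chart_source_mem_nhds _ _))
    (fun x => (chartAt (E n) (F.symm x)).open_source.preimage F.symm.continuous) ?_
  intro x S hS hSm
  set e := chartAt (E n) (F.symm x) with he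
  -- The coordinates at the image point are the old ones transported by `F`, so `e'.symm = F ∘
  -- e.symm`. Both integrals then run over the same set of coordinates and differ by the Jacobian of
  -- `F`, by `ltd_comp`.
  let e' : OpenPartialHomeomorph H' (E n) := F.symm.transOpenPartialHomeomorph e
  have hec : IsCoord e := isCoord_chartAt _
  have he' : IsCoord e' := by
    constructor
    · intro y hy
      exact ((hec.mdiffAt (x := F.symm y) hy).comp y
        (hF'.mdifferentiable (by simp) y)).mdifferentiableWithinAt
    · intro y hy
      exact ((hF.mdifferentiable (by simp) (e.symm y)).comp y
        (hec.mdiffAt_symm hy)).mdifferentiableWithinAt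
  have hFS : MeasurableSet (F ⁻¹' S) := F.continuous.measurable hSm
  have hsub : F ⁻¹' S ⊆ e.source := fun y hy => by simpa using hS hy
  rw [Measure.map_apply F.continuous.measurable hSm, withDensity_apply _ hFS,
    refMeasure_apply_of_subset he' hSm hS, coordMeasure_apply e' hSm,
    ← Set.inter_eq_self_of_subset_left hsub, ← Measure.restrict_restrict hFS,
    refMeasure_restrict_eq hec, ← lintegral_indicator hFS,
    lintegral_coordMeasure (contMDiffOn_chartAt_symm' _) (hJ.indicator hFS)]
  have hm : MeasurableSet (e'.target ∩ e'.symm ⁻¹' S) :=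
    measurableSet_inter_preimage e'.continuousOn_symm e'.open_target.measurableSet hSm
  have ht : e'.target = e.target := rfl
  rw [Set.inter_comm, ← Measure.restrict_restrict' e'.open_target.measurableSet, ht]
  have hm2 : NullMeasurableSet (e'.symm ⁻¹' S) ((volume : Measure (E n)).restrict e.target) :=
    (e'.continuousOn_symm.aemeasurable e'.open_target.measurableSet).nullMeasurable hSm
  rw [← lintegral_indicator₀ hm2]
  refine setLIntegral_congr_fun e.open_target.measurableSet fun y hy => ?_
  by_cases hyS : F (e.symm y) ∈ S
  · rw [Set.indicator_of_mem (show e.symm y ∈ F ⁻¹' S from hyS),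
      Set.indicator_of_mem (show y ∈ e'.symm ⁻¹' S from hyS),
      ← ENNReal.ofReal_mul (show 0 ≤ coordDens e y from abs_nonneg _)]
    congr 1
    have hc : ltd (𝓡 n) (𝓡 n) e'.symm y = _ :=
      ltd_comp (f := F) (e := e.symm) (hF.mdifferentiable (by simp)) (hec.mdiffAt_symm hy)
    simp only [coordDens]
    rw [← abs_mul, hc, mul_comm]
    congr 1
    exact (LinearMap.det_comp _ _).symm
  · rw [Set.indicator_of_notMem (show e.symm y ∉ F ⁻¹' S from hyS),
      Set.indicator_of_notMem (show y ∉ e'.symm ⁻¹' S from hyS), mul_zero]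

end CoordSmooth

end

end DLG

namespace DLG

set_option linter.unusedSectionVars false

noncomputable section

/-! ### Inverse function theorem and a dimension bound -/

section InverseFunction

variable {V₁ V₂ : Type*} [NormedAddCommGroup V₁] [NormedSpace ℝ V₁] [NormedAddCommGroup V₂]
  [NormedSpace ℝ V₂] [CompleteSpace V₁]
  {H₁ H₂ : Type*} [TopologicalSpace H₁] [TopologicalSpace H₂]
  {I : ModelWithCorners ℝ V₁ H₁} {J : ModelWithCorners ℝ V₂ H₂} [I.Boundaryless] [J.Boundaryless]
  {M N : Type*} [TopologicalSpace M] [ChartedSpace H₁ M]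
  [TopologicalSpace N] [ChartedSpace H₂ N] [IsManifold I ∞ M] [IsManifold J ∞ N]

/-- The inverse of a smooth bijection is smooth at the images of the points at which the
tangent map is invertible. -/
theorem contMDiffAt_inverse {f : M → N} {f' : N → M} (hf : ContMDiff I J ∞ f) (x : M)
    (hl : Function.LeftInverse f' f) (L : V₁ ≃L[ℝ] V₂) (hL : (L : V₁ →L[ℝ] V₂) = td I J f x) :
    ContMDiffAt J I ∞ f' (f x) := by
  have h1M : IsManifold I 1 M := IsManifold.of_le (n := ∞) (by simp)
  have h1N : IsManifold J 1 N := IsManifold.of_le (n := ∞) (by simp)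
  set F := writtenInExtChartAt I J x f with hF
  have hFs : ContDiffAt ℝ ∞ F (extChartAt I x x) := by
    have := (contMDiffAt_iff.mp (hf x)).2
    rw [I.range_eq_univ, contDiffWithinAt_univ] at this
    exact this
  have hd : HasFDerivAt F (L : V₁ →L[ℝ] V₂) (extChartAt I x x) := by
    have : HasFDerivWithinAt F (td I J f x) (Set.range I) (extChartAt I x x) :=
      (hf.mdifferentiable (by simp) x).hasMFDerivAt.2
    rw [I.range_eq_univ, hasFDerivWithinAt_univ] at this
    rw [hL]; exact this
  set e := hFs.toOpenPartialHomeomorph F hd (by simp) with he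
  have heF : (e : V₁ → V₂) = F := hFs.toOpenPartialHomeomorph_coe hd (by simp)
  have hxe : extChartAt I x x ∈ e.source := hFs.mem_toOpenPartialHomeomorph_source hd (by simp)
  have hFx : F (extChartAt I x x) = extChartAt J (f x) (f x) := by
    simp [hF, writtenInExtChartAt]
  have hgs : ContDiffAt ℝ ∞ e.symm (extChartAt J (f x) (f x)) := by
    rw [← hFx]; exact hFs.to_localInverse hd (by simp)
  have hgx : e.symm (extChartAt J (f x) (f x)) = extChartAt I x x := by
    rw [← hFx, ← heF]; exact e.left_inv hxe
  have h1 : ContMDiffAt J 𝓘(ℝ, V₂) ∞ (extChartAt J (f x)) (f x) := contMDiffAt_extChartAt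
  have h2 : ContMDiffAt J 𝓘(ℝ, V₁) ∞ (fun y => e.symm (extChartAt J (f x) y)) (f x) :=
    ContMDiffAt.comp (f x) hgs.contMDiffAt h1
  have h3 : ContMDiffAt 𝓘(ℝ, V₁) I ∞ (extChartAt I x).symm (extChartAt I x x) := by
    have := contMDiffOn_extChartAt_symm (I := I) (n := ∞) x
    exact (this _ (mem_extChartAt_target x)).contMDiffAt
      ((isOpen_extChartAt_target x).mem_nhds (mem_extChartAt_target x))
  have h4 : ContMDiffAt J I ∞
      (fun y => (extChartAt I x).symm (e.symm (extChartAt J (f x) y))) (f x) := by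
    refine ContMDiffAt.comp (f x) (g := (extChartAt I x).symm) ?_ h2
    simp only [hgx]; exact h3
  -- The smooth local inverse supplied by the charts is a right inverse of `f` near `f x`. Since
  -- `f'` is a left inverse of `f`, the two agree there; continuity of `f'` is not needed.
  refine h4.congr_of_eventuallyEq ?_
  have hval : (extChartAt I x).symm (e.symm (extChartAt J (f x) (f x))) = x := by
    rw [hgx, extChartAt_to_inv]
  have c1 : ∀ᶠ y in nhds (f x),
      f ((extChartAt I x).symm (e.symm (extChartAt J (f x) y))) ∈ (extChartAt J (f x)).source := by
    have : ContinuousAt (fun y => f ((extChartAt I x).symm (e.symm (extChartAt J (f x) y)))) (f x) :=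
      ContinuousAt.comp (g := f) hf.continuous.continuousAt h4.continuousAt
    refine this.eventually_mem ?_
    simp only [hval]; exact extChartAt_source_mem_nhds _
  have c2 : ∀ᶠ y in nhds (f x), y ∈ (extChartAt J (f x)).source := extChartAt_source_mem_nhds _
  have c3 : ∀ᶠ y in nhds (f x), extChartAt J (f x) y ∈ e.target := by
    refine h1.continuousAt.eventually_mem (e.open_target.mem_nhds ?_)
    rw [← hFx, ← heF]; exact e.map_source hxe
  filter_upwards [c1, c2, c3] with y y1 y2 y3
  have h5 : F (e.symm (extChartAt J (f x) y)) = extChartAt J (f x) y := by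
    rw [← heF]; exact e.right_inv y3
  have h6 : f ((extChartAt I x).symm (e.symm (extChartAt J (f x) y))) = y :=
    (extChartAt J (f x)).injOn y1 y2 h5
  nth_rewrite 1 [← h6]
  exact hl _

variable [FiniteDimensional ℝ V₁] [FiniteDimensional ℝ V₂] [SecondCountableTopology M]

/-- A chart domain of `N` is covered by countably many images of open pieces of `V₁` under locally
Lipschitz maps, which do not raise Hausdorff dimension. Its image in `V₂` is a nonempty open set, of
dimension `finrank V₂`. -/
theorem finrank_le_of_surjective [Nonempty N] {f : M → N} (hf : ContMDiff I J ∞ f)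
    (hs : Function.Surjective f) : Module.finrank ℝ V₂ ≤ Module.finrank ℝ V₁ := by
  have h1M : IsManifold I 1 M := IsManifold.of_le (n := ∞) (by simp)
  have h1N : IsManifold J 1 N := IsManifold.of_le (n := ∞) (by simp)
  obtain ⟨y₀⟩ := ‹Nonempty N›
  obtain ⟨s, hsc, hsU⟩ := TopologicalSpace.countable_cover_nhds
    (f := fun x : M => (extChartAt I x).source) (fun x => extChartAt_source_mem_nhds x)
  let W : M → Set V₁ := fun x => (extChartAt I x).target ∩
    (extChartAt I x).symm ⁻¹' (f ⁻¹' (extChartAt J y₀).source)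
  let φ : M → V₁ → V₂ := fun x v => extChartAt J y₀ (f ((extChartAt I x).symm v))
  have hcov : (extChartAt J y₀).target ⊆ ⋃ x ∈ s, φ x '' W x := by
    intro z hz
    obtain ⟨p, hp⟩ := hs ((extChartAt J y₀).symm z)
    have hpU : p ∈ ⋃ x ∈ s, (extChartAt I x).source := by rw [hsU]; trivial
    simp only [Set.mem_iUnion] at hpU ⊢
    obtain ⟨x, hxs, hpx⟩ := hpU
    refine ⟨x, hxs, extChartAt I x p, ⟨(extChartAt I x).map_source hpx, ?_⟩, ?_⟩
    · simp only [Set.mem_preimage, (extChartAt I x).left_inv hpx, hp]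
      exact (extChartAt J y₀).map_target hz
    · simp only [φ, (extChartAt I x).left_inv hpx, hp]
      exact (extChartAt J y₀).right_inv hz
  have hdim : ∀ x, dimH (φ x '' W x) ≤ Module.finrank ℝ V₁ := by
    intro x
    have : dimH (φ x '' W x) ≤ dimH (W x) := by
      refine dimH_image_le_of_locally_lipschitzOn fun v hv => ?_
      have hs1 : ContMDiffAt 𝓘(ℝ, V₁) I ∞ (extChartAt I x).symm v :=
        ((contMDiffOn_extChartAt_symm (I := I) (n := ∞) x) v hv.1).contMDiffAt
          ((isOpen_extChartAt_target x).mem_nhds hv.1)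
      have hs2 : ContMDiffAt J 𝓘(ℝ, V₂) ∞ (extChartAt J y₀) (f ((extChartAt I x).symm v)) := by
        have := contMDiffOn_extChartAt (I := J) (n := ∞) (x := y₀)
        rw [← extChartAt_source J] at this
        exact (this _ hv.2).contMDiffAt ((isOpen_extChartAt_source y₀).mem_nhds hv.2)
      have hs3 : ContMDiffAt 𝓘(ℝ, V₁) 𝓘(ℝ, V₂) ∞ (φ x) v :=
        hs2.comp v ((hf _).comp v hs1)
      obtain ⟨C, t, ht, hC⟩ := (hs3.contDiffAt.of_le (m := 1) (by simp)).exists_lipschitzOnWith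
      exact ⟨C, t, mem_nhdsWithin_of_mem_nhds ht, hC⟩
    exact this.trans ((dimH_mono (Set.subset_univ _)).trans (Real.dimH_univ_eq_finrank V₁).le)
  have h3 : dimH (extChartAt J y₀).target = Module.finrank ℝ V₂ :=
    Real.dimH_of_mem_nhds ((isOpen_extChartAt_target y₀).mem_nhds (mem_extChartAt_target y₀))
  have h4 : dimH (extChartAt J y₀).target ≤ Module.finrank ℝ V₁ := by
    refine (dimH_mono hcov).trans ?_
    rw [dimH_bUnion hsc]
    exact iSup₂_le fun x _ => hdim x
  rw [h3] at h4
  exact_mod_cast h4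

end InverseFunction

/-! ### Integral curves of left-invariant fields -/

section OneParameter

theorem three_le_infty : minSmoothness ℝ 3 ≤ (∞ : WithTop ℕ∞) := by
  rw [minSmoothness_of_isRCLikeNormedField]
  exact ENat.LEInfty.out

variable {n k m : ℕ} {G : Type*} [Group G] [TopologicalSpace G] [ChartedSpace (E n) G]
  [LieGroup (𝓡 n) ∞ G]

theorem td_mul_left_map {H : Type*} [Group H] [TopologicalSpace H] [ChartedSpace (E k) H]
    [LieGroup (𝓡 k) ∞ H] (ι : H →* G) (hι : ContMDiff (𝓡 k) (𝓡 n) ∞ ι) (h : H) :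
    td (𝓡 k) (𝓡 n) ι h ∘L td (𝓡 k) (𝓡 k) (fun x => h * x) 1 =
      td (𝓡 n) (𝓡 n) (fun x => ι h * x) 1 ∘L td (𝓡 k) (𝓡 n) ι 1 := by
  have hd := hι.mdifferentiable (by simp)
  rw [← td_comp_of_eq (g := ι) (f := fun x => h * x) (mul_one h) (hd h) (mdiff_mul_left h 1),
    ← td_comp_of_eq (g := fun x => ι h * x) (f := ι) (map_one ι) (mdiff_mul_left _ 1) (hd 1)]
  simp only [map_mul]

/-- A homomorphism carries the left-invariant field of `X` to that of its tangent image, hence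
integral curves to integral curves. A curve defined near time 0 suffices below, so the exponential
map is avoided. -/
theorem exists_integralCurve_map {H : Type*} [Group H] [TopologicalSpace H] [ChartedSpace (E k) H]
    [LieGroup (𝓡 k) ∞ H] (ι : H →* G) (hι : ContMDiff (𝓡 k) (𝓡 n) ∞ ι) (X : E k) :
    ∃ γ : ℝ → H, γ 0 = 1 ∧ IsMIntegralCurveAt (I := 𝓡 n) (fun t => ι (γ t))
      (mulInvariantVectorField (I := 𝓡 n) (G := G)
        (td (𝓡 k) (𝓡 n) ι 1 X : E n)) 0 := by
  have : LieGroup (𝓡 k) (minSmoothness ℝ 3) H := LieGroup.of_le (n := ∞) three_le_infty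
  have h1 : IsManifold (𝓡 k) 1 H := IsManifold.of_le (n := ∞) (by simp)
  obtain ⟨γ, h0, hγ⟩ := exists_isMIntegralCurveAt_of_contMDiffAt_boundaryless (I := 𝓡 k) (M := H)
    (t₀ := 0) (v := mulInvariantVectorField (I := 𝓡 k) (G := H) (X : E k)) (x₀ := 1)
    ((contMDiffAt_mulInvariantVectorField (I := 𝓡 k) (G := H) (X : E k)).of_le (by simp))
  refine ⟨γ, h0, ?_⟩
  filter_upwards [hγ] with t ht
  have hd := (hι.mdifferentiable (by simp) (γ t)).hasMFDerivAt
  have := hd.comp t ht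
  refine HasMFDerivAt.congr_mfderiv this (ContinuousLinearMap.ext fun (r : ℝ) => ?_)
  have h2 : td (𝓡 k) (𝓡 n) ι (γ t) (td (𝓡 k) (𝓡 k) (fun x => γ t * x) 1 X) =
      td (𝓡 n) (𝓡 n) (fun x => ι (γ t) * x) 1 (td (𝓡 k) (𝓡 n) ι 1 X) :=
    congrArg (fun L => L X) (td_mul_left_map ι hι (γ t))
  show td (𝓡 k) (𝓡 n) ι (γ t) ((r : ℝ) • td (𝓡 k) (𝓡 k) (fun x => γ t * x) 1 X) =
    (r : ℝ) • td (𝓡 n) (𝓡 n) (fun x => ι (γ t) * x) 1 (td (𝓡 k) (𝓡 n) ι 1 X)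
  rw [map_smul, h2]

end OneParameter

end

end DLG

namespace DLG

set_option linter.unusedSectionVars false

noncomputable section

instance secondCountableTopology_subgroup {G : Type*} [Group G] [TopologicalSpace G]
    [SecondCountableTopology G] (A : Subgroup G) : SecondCountableTopology A :=
  TopologicalSpace.Subtype.secondCountableTopology (A : Set G)

instance borelSpace_subgroup {G : Type*} [Group G] [TopologicalSpace G] [MeasurableSpace G]
    [BorelSpace G] (A : Subgroup G) : BorelSpace A :=
  Subtype.borelSpace (A : Set G)

/-! ### Algebra of the two factorisations -/

section Factorisation

variable {n k m : ℕ} {G : Type*} [Group G] [TopologicalSpace G] [ChartedSpace (E n) G]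
  {A B : Subgroup G} [ChartedSpace (E k) A] [ChartedSpace (E m) B]

namespace IsDoubleLieGroup

variable (h : IsDoubleLieGroup n k m A B)
include h

theorem eq_aL_mul_bR (g : G) : (aL A B g : G) * (bR A B g : G) = g := by
  obtain ⟨a, ha, b, hb, hg⟩ := h.exists_mul g
  exact (Classical.epsilon_spec (p := fun p : A × B => g = (p.1 : G) * (p.2 : G))
    ⟨(⟨a, ha⟩, ⟨b, hb⟩), hg⟩).symm

theorem eq_bL_mul_aR (g : G) : (bL A B g : G) * (aR A B g : G) = g := by
  obtain ⟨a, ha, b, hb, hg⟩ := h.exists_mul g⁻¹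
  refine (Classical.epsilon_spec (p := fun p : A × B => g = (p.2 : G) * (p.1 : G))
      ⟨(⟨a⁻¹, A.inv_mem ha⟩, ⟨b⁻¹, B.inv_mem hb⟩), ?_⟩).symm
  show g = b⁻¹ * a⁻¹
  rw [← mul_inv_rev, ← hg, inv_inv]

theorem eq_of_mul_eq {a a' : A} {b b' : B} (hab : (a : G) * b = a' * b') : a = a' ∧ b = b' := by
  have h1 : (a' : G)⁻¹ * a = b' * (b : G)⁻¹ := by
    rw [eq_mul_inv_iff_mul_eq, mul_assoc, hab, inv_mul_cancel_left]
  have h2 : (a' : G)⁻¹ * a ∈ A ⊓ B :=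
    ⟨A.mul_mem (A.inv_mem a'.2) a.2, h1 ▸ B.mul_mem b'.2 (B.inv_mem b.2)⟩
  rw [h.inf_eq_bot, Subgroup.mem_bot] at h2
  have h3 : a = a' := Subtype.ext (inv_mul_eq_one.mp h2).symm
  subst h3
  exact ⟨rfl, Subtype.ext (mul_left_cancel hab)⟩

theorem eq_of_mul_eq' {a a' : A} {b b' : B} (hab : (b : G) * a = b' * a') : a = a' ∧ b = b' := by
  have h1 : ((a⁻¹ : A) : G) * (b⁻¹ : B) = (a'⁻¹ : A) * (b'⁻¹ : B) := by
    simpa [mul_inv_rev] using congrArg (fun x => x⁻¹) hab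
  obtain ⟨h2, h3⟩ := h.eq_of_mul_eq h1
  exact ⟨inv_injective h2, inv_injective h3⟩

theorem aL_mul (a : A) (b : B) : aL A B ((a : G) * b) = a :=
  (h.eq_of_mul_eq (h.eq_aL_mul_bR _)).1

theorem bR_mul (a : A) (b : B) : bR A B ((a : G) * b) = b :=
  (h.eq_of_mul_eq (h.eq_aL_mul_bR _)).2

theorem aR_mul (b : B) (a : A) : aR A B ((b : G) * a) = a :=
  (h.eq_of_mul_eq' (h.eq_bL_mul_aR _)).1

theorem bL_mul (b : B) (a : A) : bL A B ((b : G) * a) = b :=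
  (h.eq_of_mul_eq' (h.eq_bL_mul_aR _)).2

theorem aL_mul_left (a : A) (g : G) : aL A B ((a : G) * g) = a * aL A B g := by
  nth_rewrite 1 [← h.eq_aL_mul_bR g]
  rw [← mul_assoc, ← Subgroup.coe_mul, h.aL_mul]

theorem bR_mul_left (a : A) (g : G) : bR A B ((a : G) * g) = bR A B g := by
  nth_rewrite 1 [← h.eq_aL_mul_bR g]
  rw [← mul_assoc, ← Subgroup.coe_mul, h.bR_mul]

theorem aL_mul_right (g : G) (b : B) : aL A B (g * b) = aL A B g := by
  nth_rewrite 1 [← h.eq_aL_mul_bR g]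
  rw [mul_assoc, ← Subgroup.coe_mul, h.aL_mul]

theorem bR_mul_right (g : G) (b : B) : bR A B (g * b) = bR A B g * b := by
  nth_rewrite 1 [← h.eq_aL_mul_bR g]
  rw [mul_assoc, ← Subgroup.coe_mul, h.bR_mul]

theorem bL_mul_left (b : B) (g : G) : bL A B ((b : G) * g) = b * bL A B g := by
  nth_rewrite 1 [← h.eq_bL_mul_aR g]
  rw [← mul_assoc, ← Subgroup.coe_mul, h.bL_mul]

theorem aR_mul_left (b : B) (g : G) : aR A B ((b : G) * g) = aR A B g := by
  nth_rewrite 1 [← h.eq_bL_mul_aR g]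
  rw [← mul_assoc, ← Subgroup.coe_mul, h.aR_mul]

theorem bL_mul_right (g : G) (a : A) : bL A B (g * a) = bL A B g := by
  nth_rewrite 1 [← h.eq_bL_mul_aR g]
  rw [mul_assoc, ← Subgroup.coe_mul, h.bL_mul]

theorem aR_mul_right (g : G) (a : A) : aR A B (g * a) = aR A B g * a := by
  nth_rewrite 1 [← h.eq_bL_mul_aR g]
  rw [mul_assoc, ← Subgroup.coe_mul, h.aR_mul]

theorem aL_one : aL A B 1 = 1 := by simpa using h.aL_mul 1 1
theorem bR_one : bR A B 1 = 1 := by simpa using h.bR_mul 1 1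
theorem aR_one : aR A B 1 = 1 := by simpa using h.aR_mul 1 1
theorem bL_one : bL A B 1 = 1 := by simpa using h.bL_mul 1 1

theorem aL_coe (a : A) : aL A B (a : G) = a := by simpa using h.aL_mul a 1
theorem bR_coe (b : B) : bR A B (b : G) = b := by simpa using h.bR_mul 1 b
theorem aL_coe_right (b : B) : aL A B (b : G) = 1 := by simpa using h.aL_mul 1 b
theorem bR_coe_left (a : A) : bR A B (a : G) = 1 := by simpa using h.bR_mul a 1

/-- Inversion exchanges the factorisations g = ab and g = ba, so smoothness of `aR` and `bL` follows
from that of `aL` and `bR`. -/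
theorem aR_eq (g : G) : aR A B g = (aL A B g⁻¹)⁻¹ := by
  have h1 : (bL A B g : G) * aR A B g =
      (((bR A B g⁻¹)⁻¹ : B) : G) * (((aL A B g⁻¹)⁻¹ : A) : G) := by
    rw [h.eq_bL_mul_aR, InvMemClass.coe_inv, InvMemClass.coe_inv, ← mul_inv_rev, h.eq_aL_mul_bR,
      inv_inv]
  exact (h.eq_of_mul_eq' (b' := (bR A B g⁻¹)⁻¹) (a' := (aL A B g⁻¹)⁻¹) h1).1

theorem bL_eq (g : G) : bL A B g = (bR A B g⁻¹)⁻¹ := by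
  have h1 : (bL A B g : G) * aR A B g =
      (((bR A B g⁻¹)⁻¹ : B) : G) * (((aL A B g⁻¹)⁻¹ : A) : G) := by
    rw [h.eq_bL_mul_aR, InvMemClass.coe_inv, InvMemClass.coe_inv, ← mul_inv_rev, h.eq_aL_mul_bR,
      inv_inv]
  exact (h.eq_of_mul_eq' (b' := (bR A B g⁻¹)⁻¹) (a' := (aL A B g⁻¹)⁻¹) h1).2

end IsDoubleLieGroup

end Factorisation

/-! ### The decomposition of the Lie algebra and smoothness of the factors -/

section Smooth

variable {n k m : ℕ} {G : Type*} [Group G] [TopologicalSpace G] [ChartedSpace (E n) G]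
  [LieGroup (𝓡 n) ∞ G] 
  {A B : Subgroup G} [ChartedSpace (E k) A] [LieGroup (𝓡 k) ∞ A]
  [ChartedSpace (E m) B] [LieGroup (𝓡 m) ∞ B]

/-- The tangent map at the identity of the inclusion of a Lie subgroup. -/
def incl (n l : ℕ) {G : Type*} [Group G] [TopologicalSpace G] [ChartedSpace (E n) G]
    (S : Subgroup G) [ChartedSpace (E l) S] : E l →L[ℝ] E n :=
  td (𝓡 l) (𝓡 n) (Subtype.val : S → G) 1

/-- The projection onto `𝔞` along `𝔟`. -/
def projA (n k : ℕ) {G : Type*} [Group G] [TopologicalSpace G] [ChartedSpace (E n) G]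
    (A B : Subgroup G) [ChartedSpace (E k) A] : E n →L[ℝ] E k := td (𝓡 n) (𝓡 k) (aL A B) 1

/-- The projection onto `𝔟` along `𝔞`. -/
def projB (n m : ℕ) {G : Type*} [Group G] [TopologicalSpace G] [ChartedSpace (E n) G]
    (A B : Subgroup G) [ChartedSpace (E m) B] : E n →L[ℝ] E m := td (𝓡 n) (𝓡 m) (bR A B) 1

namespace IsDoubleLieGroup

variable (h : IsDoubleLieGroup n k m A B)
include h

theorem mdiff_left : MDifferentiable (𝓡 k) (𝓡 n) (Subtype.val : A → G) :=
  h.smooth_left.mdifferentiable (by simp)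

theorem mdiff_right : MDifferentiable (𝓡 m) (𝓡 n) (Subtype.val : B → G) :=
  h.smooth_right.mdifferentiable (by simp)

/-- A common tangent vector `Z` has two integral curves through 1, one inside `A` and one inside
`B`. By uniqueness they coincide near time 0, so they lie in `A ⊓ B` and are constant; their
velocity `Z` vanishes. -/
theorem incl_eq_incl {X : E k} {Y : E m} (hXY : incl n k A X = incl n m B Y) : X = 0 ∧ Y = 0 := by
  have : LieGroup (𝓡 n) (minSmoothness ℝ 3) G := LieGroup.of_le (n := ∞) three_le_infty
  have h1 : IsManifold (𝓡 n) 1 G := IsManifold.of_le (n := ∞) (by simp)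
  obtain ⟨γ, γ0, hγ⟩ := exists_integralCurve_map (G := G) A.subtype h.smooth_left X
  obtain ⟨β, β0, hβ⟩ := exists_integralCurve_map (G := G) B.subtype h.smooth_right Y
  set Z : E n := incl n k A X with hZ
  have hγ' : IsMIntegralCurveAt (I := 𝓡 n) (fun t => (γ t : G))
    (mulInvariantVectorField (I := 𝓡 n) (G := G) Z) 0 := hγ
  have hβ' : IsMIntegralCurveAt (I := 𝓡 n) (fun t => (β t : G))
    (mulInvariantVectorField (I := 𝓡 n) (G := G) Z) 0 := by rw [hXY]; exact hβ
  have heq := isMIntegralCurveAt_eventuallyEq_of_contMDiffAt_boundaryless (I := 𝓡 n) (M := G)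
    ((contMDiffAt_mulInvariantVectorField (I := 𝓡 n) (G := G) Z).of_le (by simp)) hγ' hβ'
    (by simp [γ0, β0])
  have hone : (fun t => (γ t : G)) =ᶠ[nhds 0] fun _ => 1 := by
    filter_upwards [heq] with t ht
    have h2 : (γ t : G) ∈ A ⊓ B := ⟨(γ t).2, by
      have : (γ t : G) = β t := ht
      rw [this]; exact (β t).2⟩
    rwa [h.inf_eq_bot, Subgroup.mem_bot] at h2
  have hd := hγ'.hasMFDerivAt.mfderiv
  have h0 : td 𝓘(ℝ, ℝ) (𝓡 n) (fun t => (γ t : G)) 0 = 0 := by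
    rw [td_congr hone, td_const]
  have hZ0 : Z = 0 := by
    have h3 : td 𝓘(ℝ, ℝ) (𝓡 n) (fun t => (γ t : G)) 0 (1 : ℝ) =
        (1 : ℝ) • td (𝓡 n) (𝓡 n) (fun x => (γ 0 : G) * x) 1 Z :=
      congrArg (fun L : ℝ →L[ℝ] E n => L 1) hd
    rw [h0] at h3
    simpa [γ0, td_id] using h3.symm
  have hA : incl n k A X = incl n k A 0 := by rw [map_zero]; exact hZ0
  have hB : incl n m B Y = incl n m B 0 := by rw [map_zero]; exact hXY.symm.trans hZ0
  exact ⟨h.immersion_left 1 hA, h.immersion_right 1 hB⟩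

/-- The multiplication map `A × B → G`. -/
theorem contMDiff_mulAB : ContMDiff ((𝓡 k).prod (𝓡 m)) (𝓡 n) ∞
    (fun p : A × B => (p.1 : G) * (p.2 : G)) :=
  (h.smooth_left.comp contMDiff_fst).mul (h.smooth_right.comp contMDiff_snd)

theorem td_mulAB_one (v : E k × E m) : td ((𝓡 k).prod (𝓡 m)) (𝓡 n)
    (fun p : A × B => (p.1 : G) * (p.2 : G)) 1 v = incl n k A v.1 + incl n m B v.2 := by
  rw [td_prod_apply (h.contMDiff_mulAB.mdifferentiable (by simp) 1)]
  simp only [Prod.fst_one, Prod.snd_one, OneMemClass.coe_one, mul_one, one_mul]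
  rfl

variable [SecondCountableTopology G]

/-- The sum map on 𝔞 × 𝔟 is injective by `incl_eq_incl`. It is onto because the smooth surjection `A
× B → G` bounds the dimension of `G` by that of `A × B`. -/
theorem exists_sumEquiv : ∃ L : (E k × E m) ≃L[ℝ] E n, (L : (E k × E m) →L[ℝ] E n) =
    td ((𝓡 k).prod (𝓡 m)) (𝓡 n) (fun p : A × B => (p.1 : G) * (p.2 : G)) 1 := by
  set T := td ((𝓡 k).prod (𝓡 m)) (𝓡 n) (fun p : A × B => (p.1 : G) * (p.2 : G)) 1 with hT
  have hinj : Function.Injective T := by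
    rw [injective_iff_map_eq_zero]
    rintro ⟨X, Y⟩ hXY
    rw [hT, h.td_mulAB_one] at hXY
    have h2 : incl n k A X = incl n m B (-Y) := by
      rw [map_neg]; exact eq_neg_of_add_eq_zero_left hXY
    obtain ⟨h3, h4⟩ := h.incl_eq_incl h2
    simp only [neg_eq_zero] at h4
    simp [h3, h4]
  have hle : Module.finrank ℝ (E n) ≤ Module.finrank ℝ (E k × E m) :=
    finrank_le_of_surjective h.contMDiff_mulAB fun g => by
      obtain ⟨a, ha, b, hb, hg⟩ := h.exists_mul g
      exact ⟨(⟨a, ha⟩, ⟨b, hb⟩), hg.symm⟩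
  have hfr : Module.finrank ℝ (E k × E m) = Module.finrank ℝ (E n) :=
    le_antisymm (LinearMap.finrank_le_finrank_of_injective (f := (T : (E k × E m) →ₗ[ℝ] E n)) hinj) hle
  refine ⟨(LinearEquiv.ofInjectiveOfFinrankEq (T : (E k × E m) →ₗ[ℝ] E n) hinj
    hfr).toContinuousLinearEquiv, ?_⟩
  exact ContinuousLinearMap.ext fun v => rfl

theorem dim_eq : m + k = n := by
  obtain ⟨L, -⟩ := h.exists_sumEquiv
  have := L.toLinearEquiv.finrank_eq
  simpa [add_comm] using this

/-- The inverse function theorem gives smoothness at 1. The translation `x ↦ a_L(g)⁻¹ x b_R(g)⁻¹`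
moves `g` to 1 and changes the two factors only by fixed elements of `A` and `B`, so smoothness
spreads to every `g`. -/
theorem contMDiff_fac : ContMDiff (𝓡 n) ((𝓡 k).prod (𝓡 m)) ∞ (fun g => (aL A B g, bR A B g)) := by
  obtain ⟨L, hL⟩ := h.exists_sumEquiv
  have h1 := contMDiffAt_inverse (f' := fun g => (aL A B g, bR A B g)) h.contMDiff_mulAB 1
    (fun p => Prod.ext (h.aL_mul p.1 p.2) (h.bR_mul p.1 p.2)) L hL
  intro g
  have h2 : ContMDiffAt (𝓡 n) (𝓡 n) ∞
      (fun x : G => (aL A B g : G)⁻¹ * x * (bR A B g : G)⁻¹) g :=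
    ((contMDiff_mul_right (I := 𝓡 n) (n := ∞) (a := (bR A B g : G)⁻¹)).comp
      (contMDiff_mul_left (I := 𝓡 n) (n := ∞) (a := (aL A B g : G)⁻¹))) g
  have h3 : (aL A B g : G)⁻¹ * g * (bR A B g : G)⁻¹ =
      (fun p : A × B => (p.1 : G) * (p.2 : G)) 1 := by
    nth_rewrite 2 [← h.eq_aL_mul_bR g]
    simp
  have h4 : ContMDiffAt (𝓡 n) ((𝓡 k).prod (𝓡 m)) ∞ (fun x : G =>
      (aL A B ((aL A B g : G)⁻¹ * x * (bR A B g : G)⁻¹),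
        bR A B ((aL A B g : G)⁻¹ * x * (bR A B g : G)⁻¹))) g :=
    ContMDiffAt.comp g (g := fun g => (aL A B g, bR A B g)) (by rw [h3]; exact h1) h2
  have h5 : (fun x => (aL A B x, bR A B x)) = fun x : G =>
      (aL A B g * aL A B ((aL A B g : G)⁻¹ * x * (bR A B g : G)⁻¹),
        bR A B ((aL A B g : G)⁻¹ * x * (bR A B g : G)⁻¹) * bR A B g) := by
    funext x
    have e1 : aL A B ((aL A B g : G)⁻¹ * x * (bR A B g : G)⁻¹) = (aL A B g)⁻¹ * aL A B x := by
      have := h.aL_mul_right ((aL A B g : G)⁻¹ * x) (bR A B g)⁻¹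
      rw [InvMemClass.coe_inv] at this
      rw [this]
      exact h.aL_mul_left (aL A B g)⁻¹ x
    have e2 : bR A B ((aL A B g : G)⁻¹ * x * (bR A B g : G)⁻¹) = bR A B x * (bR A B g)⁻¹ := by
      have := h.bR_mul_right ((aL A B g : G)⁻¹ * x) (bR A B g)⁻¹
      rw [InvMemClass.coe_inv] at this
      rw [this]
      congr 1
      exact h.bR_mul_left (aL A B g)⁻¹ x
    rw [e1, e2]
    simp
  rw [h5]
  exact ContMDiffAt.prodMk (contMDiffAt_const.mul h4.fst) (h4.snd.mul contMDiffAt_const)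

theorem contMDiff_aL : ContMDiff (𝓡 n) (𝓡 k) ∞ (aL A B) := h.contMDiff_fac.fst
theorem contMDiff_bR : ContMDiff (𝓡 n) (𝓡 m) ∞ (bR A B) := h.contMDiff_fac.snd

theorem contMDiff_aR : ContMDiff (𝓡 n) (𝓡 k) ∞ (aR A B) := by
  rw [show aR A B = fun g => (aL A B g⁻¹)⁻¹ from funext h.aR_eq]
  exact (h.contMDiff_aL.comp (contMDiff_inv (𝓡 n) ∞)).inv

theorem contMDiff_bL : ContMDiff (𝓡 n) (𝓡 m) ∞ (bL A B) := by
  rw [show bL A B = fun g => (bR A B g⁻¹)⁻¹ from funext h.bL_eq]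
  exact (h.contMDiff_bR.comp (contMDiff_inv (𝓡 n) ∞)).inv

theorem mdiff_aL : MDifferentiable (𝓡 n) (𝓡 k) (aL A B) := h.contMDiff_aL.mdifferentiable (by simp)
theorem mdiff_aR : MDifferentiable (𝓡 n) (𝓡 k) (aR A B) := h.contMDiff_aR.mdifferentiable (by simp)
theorem mdiff_bL : MDifferentiable (𝓡 n) (𝓡 m) (bL A B) := h.contMDiff_bL.mdifferentiable (by simp)
theorem mdiff_bR : MDifferentiable (𝓡 n) (𝓡 m) (bR A B) := h.contMDiff_bR.mdifferentiable (by simp)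

theorem projA_comp_inclA : projA n k A B ∘L incl n k A = ContinuousLinearMap.id ℝ (E k) := by
  rw [projA, incl, ← td_comp_of_eq (f := (Subtype.val : A → G)) (OneMemClass.coe_one A) (h.mdiff_aL 1)
    (h.mdiff_left 1)]
  simp only [h.aL_coe, td_id]

theorem projA_comp_inclB : projA n k A B ∘L incl n m B = 0 := by
  rw [projA, incl, ← td_comp_of_eq (f := (Subtype.val : B → G)) (OneMemClass.coe_one B) (h.mdiff_aL 1)
    (h.mdiff_right 1)]
  simp only [h.aL_coe_right, td_const]

theorem projB_comp_inclB : projB n m A B ∘L incl n m B = ContinuousLinearMap.id ℝ (E m) := by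
  rw [projB, incl, ← td_comp_of_eq (f := (Subtype.val : B → G)) (OneMemClass.coe_one B) (h.mdiff_bR 1)
    (h.mdiff_right 1)]
  simp only [h.bR_coe, td_id]

theorem projB_comp_inclA : projB n m A B ∘L incl n k A = 0 := by
  rw [projB, incl, ← td_comp_of_eq (f := (Subtype.val : A → G)) (OneMemClass.coe_one A) (h.mdiff_bR 1)
    (h.mdiff_left 1)]
  simp only [h.bR_coe_left, td_const]

theorem incl_proj_add : incl n k A ∘L projA n k A B + incl n m B ∘L projB n m A B =
    ContinuousLinearMap.id ℝ (E n) := by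
  have h1 : MDifferentiableAt (𝓡 n) (𝓡 n) (fun g => (aL A B g : G)) 1 :=
    (h.mdiff_left _).comp 1 (h.mdiff_aL 1)
  have h2 : MDifferentiableAt (𝓡 n) (𝓡 n) (fun g => (bR A B g : G)) 1 :=
    (h.mdiff_right _).comp 1 (h.mdiff_bR 1)
  have h3 := td_mul_of_one h1 h2 (by simp [h.aL_one]) (by simp [h.bR_one])
  simp only [h.eq_aL_mul_bR, td_id] at h3
  rw [h3, td_comp_of_eq (g := (Subtype.val : A → G)) h.aL_one (h.mdiff_left 1) (h.mdiff_aL 1),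
    td_comp_of_eq (g := (Subtype.val : B → G)) h.bR_one (h.mdiff_right 1) (h.mdiff_bR 1)]
  rfl

/-- To first order at the identity the order of the factors is irrelevant: differentiating b_L a_R =
id there and projecting gives the same two projections as for a_L b_R = id. -/
theorem td_aR_one_td_bL_one : td (𝓡 n) (𝓡 k) (aR A B) 1 = projA n k A B ∧
    td (𝓡 n) (𝓡 m) (bL A B) 1 = projB n m A B := by
  have h1 : MDifferentiableAt (𝓡 n) (𝓡 n) (fun g => (aR A B g : G)) 1 :=
    (h.mdiff_left _).comp 1 (h.mdiff_aR 1)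
  have h2 : MDifferentiableAt (𝓡 n) (𝓡 n) (fun g => (bL A B g : G)) 1 :=
    (h.mdiff_right _).comp 1 (h.mdiff_bL 1)
  have h3 := td_mul_of_one h2 h1 (by simp [h.bL_one]) (by simp [h.aR_one])
  simp only [h.eq_bL_mul_aR, td_id] at h3
  rw [td_comp_of_eq (g := (Subtype.val : A → G)) h.aR_one (h.mdiff_left 1) (h.mdiff_aR 1),
    td_comp_of_eq (g := (Subtype.val : B → G)) h.bL_one (h.mdiff_right 1) (h.mdiff_bL 1)] at h3
  have e1 := h.projA_comp_inclA
  have e2 := h.projA_comp_inclB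
  have e3 := h.projB_comp_inclA
  have e4 := h.projB_comp_inclB
  constructor
  · have := congrArg (fun L => projA n k A B ∘L L) h3
    simp only [ContinuousLinearMap.comp_add, ← ContinuousLinearMap.comp_assoc] at this
    change projA n k A B ∘L _ = (projA n k A B ∘L incl n m B) ∘L _ +
      (projA n k A B ∘L incl n k A) ∘L _ at this
    rw [e1, e2] at this
    simpa using this.symm
  · have := congrArg (fun L => projB n m A B ∘L L) h3
    simp only [ContinuousLinearMap.comp_add, ← ContinuousLinearMap.comp_assoc] at this
    change projB n m A B ∘L _ = (projB n m A B ∘L incl n m B) ∘L _ +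
      (projB n m A B ∘L incl n k A) ∘L _ at this
    rw [e3, e4] at this
    simpa using this.symm

end IsDoubleLieGroup

end Smooth

end

end DLG

namespace DLG

set_option linter.unusedSectionVars false

noncomputable section

/-! ### Absolute determinants -/

section AbsDet

variable {V : Type*} [NormedAddCommGroup V] [NormedSpace ℝ V]

/-- The absolute value of the determinant. -/
def adet (L : V →L[ℝ] V) : ℝ := |LinearMap.det (L : V →ₗ[ℝ] V)|

theorem adet_nonneg (L : V →L[ℝ] V) : 0 ≤ adet L := abs_nonneg _

theorem adet_comp (L M : V →L[ℝ] V) : adet (L ∘L M) = adet L * adet M := by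
  rw [adet, adet, adet, ← abs_mul, ← LinearMap.det_comp]
  rfl

theorem adet_id : adet (ContinuousLinearMap.id ℝ V) = 1 := by
  rw [adet, ContinuousLinearMap.coe_id, LinearMap.det_id, abs_one]

theorem adet_neg (L : V →L[ℝ] V) : adet (-L) = adet L := by
  have : adet (-ContinuousLinearMap.id ℝ V) = 1 := by
    have h := adet_comp (-ContinuousLinearMap.id ℝ V) (-ContinuousLinearMap.id ℝ V)
    have h1 : (-ContinuousLinearMap.id ℝ V) ∘L (-ContinuousLinearMap.id ℝ V) =
        ContinuousLinearMap.id ℝ V := by ext; simp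
    rw [h1, adet_id] at h
    nlinarith [adet_nonneg (-ContinuousLinearMap.id ℝ V)]
  have h2 : -L = (-ContinuousLinearMap.id ℝ V) ∘L L := by ext; simp
  rw [h2, adet_comp, this, one_mul]

theorem adet_mul_eq_one {L M : V →L[ℝ] V} (h : L ∘L M = ContinuousLinearMap.id ℝ V) :
    adet L * adet M = 1 := by
  rw [← adet_comp, h, adet_id]

theorem adet_pos_of_comp {L M : V →L[ℝ] V} (h : L ∘L M = ContinuousLinearMap.id ℝ V) :
    0 < adet L ∧ 0 < adet M := by
  have h1 := adet_mul_eq_one h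
  have h2 := adet_nonneg L
  have h3 := adet_nonneg M
  constructor
  · rcases h2.lt_or_eq with h4 | h4
    · exact h4
    · rw [← h4, zero_mul] at h1; norm_num at h1
  · rcases h3.lt_or_eq with h4 | h4
    · exact h4
    · rw [← h4, mul_zero] at h1; norm_num at h1

end AbsDet

theorem abs_frameDet_map {n : ℕ} (L : E n →L[ℝ] E n) (u : Fin n → E n) :
    |frameDet (fun i => L (u i))| = adet L * |frameDet u| := by
  rw [adet, ← abs_mul, ← frameDet_map]; rfl

theorem asFin_comp (n : ℕ) {ι V W : Type*} [Fintype ι] [Zero V] [Zero W] (f : V → W) (h0 : f 0 = 0)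
    (u : ι → V) : asFin n (fun i => f (u i)) = fun i => f (asFin n u i) := by
  classical
  unfold asFin
  split
  · rfl
  · funext i; simp [h0]

/-! ### Block determinants for 𝔤 = 𝔟 ⊕ 𝔞 -/

section Blocks

variable {n k m : ℕ} {G : Type*} [Group G] [TopologicalSpace G] [ChartedSpace (E n) G]
  [LieGroup (𝓡 n) ∞ G]
  (A B : Subgroup G) [ChartedSpace (E k) A] [LieGroup (𝓡 k) ∞ A]
  [ChartedSpace (E m) B] [LieGroup (𝓡 m) ∞ B]

/-- The frame of `T_e G` made of the bases of `T_e B` and `T_e A`. -/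
def baseFrame (n k m : ℕ) {G : Type*} [Group G] [TopologicalSpace G] [ChartedSpace (E n) G]
    (A B : Subgroup G) [ChartedSpace (E k) A] [ChartedSpace (E m) B] : Fin m ⊕ Fin k → E n :=
  Sum.elim (fun i => incl n m B (stdVec m i)) (fun j => incl n k A (stdVec k j))

/-- The absolute determinant of the frame of `T_e G` made of the bases of `T_e B` and `T_e A`. -/
def baseDet (n k m : ℕ) {G : Type*} [Group G] [TopologicalSpace G] [ChartedSpace (E n) G]
    (A B : Subgroup G) [ChartedSpace (E k) A] [ChartedSpace (E m) B] : ℝ :=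
  |frameDet (asFin n (baseFrame n k m A B))|

variable {A B} [SecondCountableTopology G]

namespace IsDoubleLieGroup

variable (h : IsDoubleLieGroup n k m A B)
include h

theorem projA_inclA (v : E k) : projA n k A B (incl n k A v) = v :=
  congrArg (fun L => L v) h.projA_comp_inclA
theorem projA_inclB (v : E m) : projA n k A B (incl n m B v) = 0 :=
  congrArg (fun L => L v) h.projA_comp_inclB
theorem projB_inclB (v : E m) : projB n m A B (incl n m B v) = v :=
  congrArg (fun L => L v) h.projB_comp_inclB
theorem projB_inclA (v : E k) : projB n m A B (incl n k A v) = 0 :=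
  congrArg (fun L => L v) h.projB_comp_inclA
theorem incl_proj (v : E n) : incl n k A (projA n k A B v) + incl n m B (projB n m A B v) = v :=
  congrArg (fun L => L v) h.incl_proj_add

/-- The isomorphism `𝔟 ⊕ 𝔞 ≃ 𝔤`. -/
def sumEquiv : (E m × E k) ≃ₗ[ℝ] E n where
  toFun p := incl n m B p.1 + incl n k A p.2
  invFun v := (projB n m A B v, projA n k A B v)
  map_add' p q := by simp only [Prod.fst_add, Prod.snd_add, map_add]; abel
  map_smul' c p := by simp
  left_inv p := by
    simp [h.projA_inclA, h.projA_inclB, h.projB_inclA, h.projB_inclB]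
  right_inv v := by
    exact (add_comm _ _).trans (h.incl_proj v)

/-- The basis of `𝔤` made of the bases of `𝔟` and `𝔞`. -/
def sumBasis : Module.Basis (Fin m ⊕ Fin k) ℝ (E n) :=
  ((EuclideanSpace.basisFun (Fin m) ℝ).toBasis.prod
    (EuclideanSpace.basisFun (Fin k) ℝ).toBasis).map h.sumEquiv

theorem sumBasis_inl (i : Fin m) : h.sumBasis (Sum.inl i) = incl n m B (stdVec m i) := by
  rw [sumBasis, Module.Basis.map_apply, Module.Basis.prod_apply, stdVec_eq]
  simp [sumEquiv]

theorem sumBasis_inr (i : Fin k) : h.sumBasis (Sum.inr i) = incl n k A (stdVec k i) := by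
  rw [sumBasis, Module.Basis.map_apply, Module.Basis.prod_apply, stdVec_eq]
  simp [sumEquiv]

theorem sumBasis_repr_inl (v : E n) (i : Fin m) :
    h.sumBasis.repr v (Sum.inl i) =
      (EuclideanSpace.basisFun (Fin m) ℝ).toBasis.repr (projB n m A B v) i := by
  simp [sumBasis, sumEquiv]

theorem sumBasis_repr_inr (v : E n) (i : Fin k) :
    h.sumBasis.repr v (Sum.inr i) =
      (EuclideanSpace.basisFun (Fin k) ℝ).toBasis.repr (projA n k A B v) i := by
  simp [sumBasis, sumEquiv]

theorem toMatrix_sumBasis (L : E n →L[ℝ] E n) :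
    LinearMap.toMatrix h.sumBasis h.sumBasis (L : E n →ₗ[ℝ] E n) = Matrix.fromBlocks
      (LinearMap.toMatrix (EuclideanSpace.basisFun (Fin m) ℝ).toBasis
        (EuclideanSpace.basisFun (Fin m) ℝ).toBasis
        ((projB n m A B ∘L L ∘L incl n m B : E m →L[ℝ] E m) : E m →ₗ[ℝ] E m))
      (LinearMap.toMatrix (EuclideanSpace.basisFun (Fin k) ℝ).toBasis
        (EuclideanSpace.basisFun (Fin m) ℝ).toBasis
        ((projB n m A B ∘L L ∘L incl n k A : E k →L[ℝ] E m) : E k →ₗ[ℝ] E m))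
      (LinearMap.toMatrix (EuclideanSpace.basisFun (Fin m) ℝ).toBasis
        (EuclideanSpace.basisFun (Fin k) ℝ).toBasis
        ((projA n k A B ∘L L ∘L incl n m B : E m →L[ℝ] E k) : E m →ₗ[ℝ] E k))
      (LinearMap.toMatrix (EuclideanSpace.basisFun (Fin k) ℝ).toBasis
        (EuclideanSpace.basisFun (Fin k) ℝ).toBasis
        ((projA n k A B ∘L L ∘L incl n k A : E k →L[ℝ] E k) : E k →ₗ[ℝ] E k)) := by
  ext i j
  rcases i with i | i <;> rcases j with j | j <;>
  simp only [LinearMap.toMatrix_apply, Matrix.fromBlocks_apply₁₁, Matrix.fromBlocks_apply₁₂,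
    Matrix.fromBlocks_apply₂₁, Matrix.fromBlocks_apply₂₂, h.sumBasis_inl, h.sumBasis_inr,
    h.sumBasis_repr_inl, h.sumBasis_repr_inr, stdVec_eq] <;> rfl

/-- The hypothesis says that `L` preserves 𝔟, so its block matrix is triangular. This lemma and its
counterpart `adet_of_upper`, for operators preserving 𝔞, evaluate most of the frame determinants
below. -/
theorem adet_of_lower {L : E n →L[ℝ] E n} (hL : projA n k A B ∘L L ∘L incl n m B = 0) :
    adet L = adet (projA n k A B ∘L L ∘L incl n k A) * adet (projB n m A B ∘L L ∘L incl n m B) := by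
  have h1 := h.toMatrix_sumBasis L
  rw [hL, ContinuousLinearMap.toLinearMap_zero, map_zero] at h1
  rw [adet, ← LinearMap.det_toMatrix h.sumBasis, h1, Matrix.det_fromBlocks_zero₂₁,
    LinearMap.det_toMatrix, LinearMap.det_toMatrix, abs_mul, mul_comm]
  rfl

theorem adet_of_upper {L : E n →L[ℝ] E n} (hL : projB n m A B ∘L L ∘L incl n k A = 0) :
    adet L = adet (projA n k A B ∘L L ∘L incl n k A) * adet (projB n m A B ∘L L ∘L incl n m B) := by
  have h1 := h.toMatrix_sumBasis L
  rw [hL, ContinuousLinearMap.toLinearMap_zero, map_zero] at h1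
  rw [adet, ← LinearMap.det_toMatrix h.sumBasis, h1, Matrix.det_fromBlocks_zero₁₂,
    LinearMap.det_toMatrix, LinearMap.det_toMatrix, abs_mul, mul_comm]
  rfl

theorem card_sum : Fintype.card (Fin m ⊕ Fin k) = n := by
  rw [Fintype.card_sum, Fintype.card_fin, Fintype.card_fin, h.dim_eq]

theorem asFin_eq {V : Type*} [Zero V] (u : Fin m ⊕ Fin k → V) :
    asFin n u = u ∘ (Fintype.equivFinOfCardEq h.card_sum).symm := by
  classical
  rw [asFin, dif_pos]

theorem baseDet_pos : 0 < baseDet n k m A B := by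
  rw [baseDet, abs_pos]
  have h1 : asFin n (baseFrame n k m A B) =
      h.sumBasis.reindex (Fintype.equivFinOfCardEq h.card_sum) := by
    funext i
    rw [h.asFin_eq, Module.Basis.reindex_apply, Function.comp_apply]
    rcases (Fintype.equivFinOfCardEq h.card_sum).symm i with j | j
    · rw [h.sumBasis_inl]; rfl
    · rw [h.sumBasis_inr]; rfl
  rw [h1]
  have h2 := (EuclideanSpace.basisFun (Fin n) ℝ).toBasis.isUnit_det
    (h.sumBasis.reindex (Fintype.equivFinOfCardEq h.card_sum))
  rw [Module.Basis.det_apply, ← Matrix.det_transpose] at h2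
  exact h2.ne_zero

/-- The absolute determinant of a frame given by linear maps on `𝔟` and `𝔞`. -/
theorem abs_frameDet_sum (L₁ : E m →L[ℝ] E n) (L₂ : E k →L[ℝ] E n) :
    |frameDet (asFin n (Sum.elim (fun i => L₁ (stdVec m i)) (fun j => L₂ (stdVec k j))))| =
      baseDet n k m A B * adet (L₁ ∘L projB n m A B + L₂ ∘L projA n k A B) := by
  have h1 : Sum.elim (fun i => L₁ (stdVec m i)) (fun j => L₂ (stdVec k j)) =
      fun i => (L₁ ∘L projB n m A B + L₂ ∘L projA n k A B) (baseFrame n k m A B i) := by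
    funext i
    rcases i with i | i
    · simp [baseFrame, h.projB_inclB, h.projA_inclB]
    · simp [baseFrame, h.projB_inclA, h.projA_inclA]
  rw [h1, asFin_comp n _ (map_zero _), abs_frameDet_map, mul_comm]
  rfl

end IsDoubleLieGroup

end Blocks

/-! ### The weights `modG`, `modA`, `modB` and the cocycle `Q` -/

section Characters

variable {n k m : ℕ} {G : Type*} [Group G] [TopologicalSpace G] [ChartedSpace (E n) G]
  [LieGroup (𝓡 n) ∞ G]
  {A B : Subgroup G} [ChartedSpace (E k) A] [LieGroup (𝓡 k) ∞ A]
  [ChartedSpace (E m) B] [LieGroup (𝓡 m) ∞ B]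

/-- `|det Ad(g)|`. -/
def modG (n : ℕ) {G : Type*} [Group G] [TopologicalSpace G] [ChartedSpace (E n) G] (g : G) : ℝ :=
  adet (adj (𝓡 n) g)

/-- The absolute determinant of the `𝔞`-block of `Ad(g)`. -/
def modA (n k : ℕ) {G : Type*} [Group G] [TopologicalSpace G] [ChartedSpace (E n) G]
    (A B : Subgroup G) [ChartedSpace (E k) A] (g : G) : ℝ :=
  adet (projA n k A B ∘L adj (𝓡 n) g ∘L incl n k A)

/-- The absolute determinant of the `𝔟`-block of `Ad(g)`. -/
def modB (n m : ℕ) {G : Type*} [Group G] [TopologicalSpace G] [ChartedSpace (E n) G]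
    (A B : Subgroup G) [ChartedSpace (E m) B] (g : G) : ℝ :=
  adet (projB n m A B ∘L adj (𝓡 n) g ∘L incl n m B)

theorem modG_mul (g g' : G) : modG n (g * g') = modG n g * modG n g' := by
  rw [modG, adj_mul, adet_comp]; rfl

theorem modG_one : modG n (1 : G) = 1 := by rw [modG, adj_one, adet_id]

theorem modG_inv_mul (g : G) : modG n g⁻¹ * modG n g = 1 := by
  rw [← modG_mul, inv_mul_cancel, modG_one]

theorem modG_pos (g : G) : 0 < modG n g := (adet_pos_of_comp (adj_inv_comp g)).2

theorem modG_inv (g : G) : modG n g⁻¹ = (modG n g)⁻¹ :=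
  eq_inv_of_mul_eq_one_left (modG_inv_mul g)

variable [SecondCountableTopology G]

namespace IsDoubleLieGroup

variable (h : IsDoubleLieGroup n k m A B)
include h

theorem adj_comp_inclA (a : A) : adj (𝓡 n) (a : G) ∘L incl n k A =
    incl n k A ∘L adj (𝓡 k) a := by
  rw [incl, ← td_conj_comp (h.mdiff_left 1) (OneMemClass.coe_one A),
    adj, ← td_comp_of_eq (g := (Subtype.val : A → G)) (y := 1) (by simp) (h.mdiff_left 1)
      (mdiff_conj a 1)]
  rfl

theorem adj_comp_inclB (b : B) : adj (𝓡 n) (b : G) ∘L incl n m B =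
    incl n m B ∘L adj (𝓡 m) b := by
  rw [incl, ← td_conj_comp (h.mdiff_right 1) (OneMemClass.coe_one B),
    adj, ← td_comp_of_eq (g := (Subtype.val : B → G)) (y := 1) (by simp) (h.mdiff_right 1)
      (mdiff_conj b 1)]
  rfl

theorem projB_adj_inclA (a : A) (v : E k) :
    projB n m A B (adj (𝓡 n) (a : G) (incl n k A v)) = 0 := by
  have := congrArg (fun L => L v) (h.adj_comp_inclA a)
  simp only [ContinuousLinearMap.comp_apply] at this
  rw [this, h.projB_inclA]

theorem projA_adj_inclB (b : B) (v : E m) :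
    projA n k A B (adj (𝓡 n) (b : G) (incl n m B v)) = 0 := by
  have := congrArg (fun L => L v) (h.adj_comp_inclB b)
  simp only [ContinuousLinearMap.comp_apply] at this
  rw [this, h.projA_inclB]

theorem modA_coe (a : A) : modA n k A B (a : G) = modG k a := by
  rw [modA, h.adj_comp_inclA, ← ContinuousLinearMap.comp_assoc, h.projA_comp_inclA,
    ContinuousLinearMap.id_comp]
  rfl

theorem modB_coe (b : B) : modB n m A B (b : G) = modG m b := by
  rw [modB, h.adj_comp_inclB, ← ContinuousLinearMap.comp_assoc, h.projB_comp_inclB,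
    ContinuousLinearMap.id_comp]
  rfl

theorem modG_coe_left (a : A) : modG n (a : G) = modA n k A B (a : G) * modB n m A B (a : G) :=
  h.adet_of_upper (by ext1 v; exact h.projB_adj_inclA a v)

theorem modG_coe_right (b : B) : modG n (b : G) = modA n k A B (b : G) * modB n m A B (b : G) :=
  h.adet_of_lower (by ext1 v; exact h.projA_adj_inclB b v)

/-- `Ad b` preserves 𝔟, so the 𝔟-component of `Ad g X` does not contribute to the 𝔞-component of `Ad
(b g) X`. Likewise the 𝔞-block is multiplicative under `A` on the right, and the 𝔟-block under `A`
on the left and `B` on the right. -/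
theorem modA_mul_left (b : B) (g : G) :
    modA n k A B ((b : G) * g) = modA n k A B (b : G) * modA n k A B g := by
  rw [modA, modA, modA, ← adet_comp]
  congr 1
  ext1 v
  simp only [adj_mul, ContinuousLinearMap.comp_apply]
  nth_rewrite 1 [← h.incl_proj (adj (𝓡 n) g (incl n k A v))]
  rw [map_add, map_add, h.projA_adj_inclB, add_zero]

theorem modA_mul_right (g : G) (a : A) :
    modA n k A B (g * (a : G)) = modA n k A B g * modA n k A B (a : G) := by
  rw [modA, modA, modA, ← adet_comp]
  congr 1
  ext1 v
  simp only [adj_mul, ContinuousLinearMap.comp_apply]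
  nth_rewrite 1 [← h.incl_proj (adj (𝓡 n) (a : G) (incl n k A v))]
  rw [h.projB_adj_inclA, map_zero, add_zero]

theorem modB_mul_left (a : A) (g : G) :
    modB n m A B ((a : G) * g) = modB n m A B (a : G) * modB n m A B g := by
  rw [modB, modB, modB, ← adet_comp]
  congr 1
  ext1 v
  simp only [adj_mul, ContinuousLinearMap.comp_apply]
  nth_rewrite 1 [← h.incl_proj (adj (𝓡 n) g (incl n m B v))]
  rw [map_add, map_add, h.projB_adj_inclA, zero_add]

theorem modB_mul_right (g : G) (b : B) :
    modB n m A B (g * (b : G)) = modB n m A B g * modB n m A B (b : G) := by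
  rw [modB, modB, modB, ← adet_comp]
  congr 1
  ext1 v
  simp only [adj_mul, ContinuousLinearMap.comp_apply]
  nth_rewrite 1 [← h.incl_proj (adj (𝓡 n) (b : G) (incl n m B v))]
  rw [h.projA_adj_inclB, map_zero, zero_add]

theorem modA_eq_fac (g : G) :
    modA n k A B g = modA n k A B (bL A B g : G) * modA n k A B (aR A B g : G) := by
  rw [← h.modA_mul_right, h.eq_bL_mul_aR]

theorem modB_eq_fac (g : G) :
    modB n m A B g = modB n m A B (aL A B g : G) * modB n m A B (bR A B g : G) := by
  rw [← h.modB_mul_right, h.eq_aL_mul_bR]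

theorem modA_left_pos (a : A) : 0 < modA n k A B (a : G) := by
  rw [h.modA_coe]; exact modG_pos a

theorem modB_right_pos (b : B) : 0 < modB n m A B (b : G) := by
  rw [h.modB_coe]; exact modG_pos b

/-- `Ad b` is invertible and triangular, so neither diagonal block can be singular. Positivity of
`modA` and `modB` on all of `G` follows from their multiplicativity along a factorisation. -/
theorem modA_right_pos (b : B) : 0 < modA n k A B (b : G) := by
  have h1 := h.modG_coe_right b
  have h2 := modG_pos (n := n) (b : G)
  rw [h1] at h2
  exact (mul_pos_iff_of_pos_right (h.modB_right_pos b)).mp h2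

theorem modB_left_pos (a : A) : 0 < modB n m A B (a : G) := by
  have h1 := h.modG_coe_left a
  have h2 := modG_pos (n := n) (a : G)
  rw [h1, mul_comm] at h2
  exact (mul_pos_iff_of_pos_right (h.modA_left_pos a)).mp h2

theorem modA_pos (g : G) : 0 < modA n k A B g := by
  rw [h.modA_eq_fac]; exact mul_pos (h.modA_right_pos _) (h.modA_left_pos _)

theorem modB_pos (g : G) : 0 < modB n m A B g := by
  rw [h.modB_eq_fac]; exact mul_pos (h.modB_left_pos _) (h.modB_right_pos _)

/-- Complementary minors of inverse operators. -/
theorem modA_eq (g : G) : modA n k A B g = modG n g * modB n m A B g⁻¹ := by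
  -- The operator equal to the identity on 𝔞 and to `Ad g⁻¹` on 𝔟 is triangular with determinant
  -- `modB g⁻¹`. Composed with `Ad g` it becomes `Ad g` on 𝔞 and the identity on 𝔟, triangular with
  -- determinant `modA g`.
  have h1 : adj (𝓡 n) g ∘L (incl n k A ∘L projA n k A B +
      adj (𝓡 n) g⁻¹ ∘L incl n m B ∘L projB n m A B) =
      adj (𝓡 n) g ∘L incl n k A ∘L projA n k A B + incl n m B ∘L projB n m A B := by
    have h2 : ∀ v, adj (𝓡 n) g (adj (𝓡 n) g⁻¹ v) = v := fun v =>
      congrArg (fun L => L v) (adj_comp_inv g)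
    ext1 v
    simp [h2]
  have h2 := congrArg adet h1
  rw [adet_comp, h.adet_of_upper (L := incl n k A ∘L projA n k A B +
      adj (𝓡 n) g⁻¹ ∘L incl n m B ∘L projB n m A B), h.adet_of_lower (L :=
      adj (𝓡 n) g ∘L incl n k A ∘L projA n k A B + incl n m B ∘L projB n m A B)] at h2
  · have e1 : projA n k A B ∘L (incl n k A ∘L projA n k A B +
        adj (𝓡 n) g⁻¹ ∘L incl n m B ∘L projB n m A B) ∘L incl n k A =
        ContinuousLinearMap.id ℝ (E k) := by
      ext1 v; simp [h.projA_inclA, h.projB_inclA]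
    have e2 : projB n m A B ∘L (incl n k A ∘L projA n k A B +
        adj (𝓡 n) g⁻¹ ∘L incl n m B ∘L projB n m A B) ∘L incl n m B =
        projB n m A B ∘L adj (𝓡 n) g⁻¹ ∘L incl n m B := by
      ext1 v; simp [h.projA_inclB, h.projB_inclB]
    have e3 : projA n k A B ∘L (adj (𝓡 n) g ∘L incl n k A ∘L projA n k A B +
        incl n m B ∘L projB n m A B) ∘L incl n k A =
        projA n k A B ∘L adj (𝓡 n) g ∘L incl n k A := by
      ext1 v; simp [h.projA_inclA, h.projB_inclA]
    have e4 : projB n m A B ∘L (adj (𝓡 n) g ∘L incl n k A ∘L projA n k A B +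
        incl n m B ∘L projB n m A B) ∘L incl n m B = ContinuousLinearMap.id ℝ (E m) := by
      ext1 v; simp [h.projA_inclB, h.projB_inclB]
    rw [e1, e2, e3, e4, adet_id, adet_id, one_mul, mul_one] at h2
    exact h2.symm
  · ext1 v; simp [h.projA_inclB, h.projB_inclB]
  · ext1 v; simp [h.projA_inclA, h.projB_inclA]

theorem modB_eq (g : G) : modB n m A B g = modG n g * modA n k A B g⁻¹ := by
  rw [h.modA_eq, inv_inv, ← mul_assoc, ← modG_mul, mul_inv_cancel, modG_one, one_mul]

theorem isCompl_lieSub : IsCompl (lieSub n k A) (lieSub n m B) := by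
  constructor
  · rw [Submodule.disjoint_def]
    rintro x ⟨X, hX⟩ ⟨Y, hY⟩
    have hX' : incl n k A X = x := hX
    have hY' : incl n m B Y = x := hY
    rw [← hX', (h.incl_eq_incl (hX'.trans hY'.symm)).1, map_zero]
  · rw [codisjoint_iff, eq_top_iff]
    intro x _
    rw [← h.incl_proj x]
    exact Submodule.add_mem_sup ⟨_, rfl⟩ ⟨_, rfl⟩

/-- Conjugation by the isomorphism of `E k` with the subspace 𝔞 turns the block of the definition of
`Q` into an operator on the model space. -/
theorem det_blockA (T : E n →L[ℝ] E n) :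
    LinearMap.det (block n (lieSub n k A) (lieSub n m B) (T : E n →ₗ[ℝ] E n)) =
      LinearMap.det ((projA n k A B ∘L T ∘L incl n k A : E k →L[ℝ] E k) : E k →ₗ[ℝ] E k) := by
  have hinj : Function.Injective (tlin k n (Subtype.val : A → G) 1) :=
    Function.LeftInverse.injective (g := projA n k A B) h.projA_inclA
  let e : E k ≃ₗ[ℝ] lieSub n k A := LinearEquiv.ofInjective _ hinj
  rw [block, dif_pos h.isCompl_lieSub, ← LinearMap.det_conj _ e]
  congr 1
  refine LinearMap.ext fun v => ?_
  obtain ⟨X, rfl⟩ := e.surjective v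
  apply Subtype.ext
  have hX : ((e X : lieSub n k A) : E n) = incl n k A X := rfl
  have he : ∀ Z : E n, Submodule.projectionOnto _ _ h.isCompl_lieSub Z = e (projA n k A B Z) := by
    intro Z
    have h1 : Z = ((e (projA n k A B Z) : lieSub n k A) : E n) +
        ((⟨incl n m B (projB n m A B Z), ⟨_, rfl⟩⟩ : lieSub n m B) : E n) := (h.incl_proj Z).symm
    nth_rewrite 1 [h1]
    rw [map_add, Submodule.projectionOnto_apply_left, Submodule.projectionOnto_apply_right, add_zero]
  simp [he, hX]

theorem det_blockB (T : E n →L[ℝ] E n) :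
    LinearMap.det (block n (lieSub n m B) (lieSub n k A) (T : E n →ₗ[ℝ] E n)) =
      LinearMap.det ((projB n m A B ∘L T ∘L incl n m B : E m →L[ℝ] E m) : E m →ₗ[ℝ] E m) := by
  have hinj : Function.Injective (tlin m n (Subtype.val : B → G) 1) :=
    Function.LeftInverse.injective (g := projB n m A B) h.projB_inclB
  let e : E m ≃ₗ[ℝ] lieSub n m B := LinearEquiv.ofInjective _ hinj
  rw [block, dif_pos h.isCompl_lieSub.symm, ← LinearMap.det_conj _ e]
  congr 1
  refine LinearMap.ext fun v => ?_
  obtain ⟨X, rfl⟩ := e.surjective v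
  apply Subtype.ext
  have hX : ((e X : lieSub n m B) : E n) = incl n m B X := rfl
  have he : ∀ Z : E n, Submodule.projectionOnto _ _ h.isCompl_lieSub.symm Z =
      e (projB n m A B Z) := by
    intro Z
    have h1 : Z = ((⟨incl n k A (projA n k A B Z), ⟨_, rfl⟩⟩ : lieSub n k A) : E n) +
      ((e (projB n m A B Z) : lieSub n m B) : E n) := (h.incl_proj Z).symm
    nth_rewrite 1 [h1]
    rw [map_add, Submodule.projectionOnto_apply_left, Submodule.projectionOnto_apply_right, zero_add]
  simp [he, hX]

theorem abs_Q (g : G) : |Q n k m A B g| = modG n g / (modA n k A B g * modB n m A B g) := by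
  have h1 : Ad n g = (adj (𝓡 n) g : E n →ₗ[ℝ] E n) := rfl
  rw [Q, h1, h.det_blockA, h.det_blockB, abs_div, abs_mul]
  rfl

theorem abs_Q_pos (g : G) : 0 < |Q n k m A B g| := by
  rw [h.abs_Q]
  exact div_pos (modG_pos g) (mul_pos (h.modA_pos g) (h.modB_pos g))

end IsDoubleLieGroup

end Characters

end

end DLG

namespace DLG

set_option linter.unusedSectionVars false

noncomputable section

/-! ### The density Φ_g in left-invariant frames -/

section Evaluation

variable {n k m : ℕ} {G : Type*} [Group G] [TopologicalSpace G] [ChartedSpace (E n) G]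
  [LieGroup (𝓡 n) ∞ G]
  {A B : Subgroup G} [ChartedSpace (E k) A] [LieGroup (𝓡 k) ∞ A]
  [ChartedSpace (E m) B] [LieGroup (𝓡 m) ∞ B]

/-- Homogeneity of degree one half. -/
def IsHomogeneous (φ : FrameField n G) : Prop :=
  ∀ (g : G) (M : Matrix (Fin n) (Fin n) ℝ) (u : Fin n → TangentSpace (𝓡 n) g),
    φ g (fun j => ∑ i, M i j • u i) = ((|M.det| ^ (1 / 2 : ℝ) : ℝ) : ℂ) * φ g u

theorem IsHomogeneous.eval {φ : FrameField n G} (hφ : IsHomogeneous φ) (g : G) (x : Fin n → E n) :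
    φ g (fun i => (td (𝓡 n) (𝓡 n) (fun y => g * y) 1 (x i) : E n)) =
      ((|frameDet x| ^ (1 / 2 : ℝ) : ℝ) : ℂ) * coeff n φ g := by
  have h1 := hφ g (Matrix.of fun i j => x j i) (leftFrame n g)
  have h2 : (Matrix.of fun i j => x j i).det = frameDet x := by
    rw [frameDet, ← Matrix.det_transpose]; rfl
  rw [h2] at h1
  rw [coeff, ← h1]
  congr 1
  funext j
  have h3 : x j = ∑ i, x j i • stdVec n i := by
    have := (EuclideanSpace.basisFun (Fin n) ℝ).sum_repr (x j)
    simpa [stdVec] using this.symm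
  have h4 : td (𝓡 n) (𝓡 n) (fun y => g * y) 1 (x j) =
      ∑ i, x j i • td (𝓡 n) (𝓡 n) (fun y => g * y) 1 (stdVec n i) := by
    nth_rewrite 1 [h3]
    rw [map_sum]
    simp only [map_smul]
  exact h4

theorem td_eq_left {V : Type*} [NormedAddCommGroup V] [NormedSpace ℝ V] {H₀ : Type*}
    [TopologicalSpace H₀] {I : ModelWithCorners ℝ V H₀} {M : Type*} [TopologicalSpace M]
    [ChartedSpace H₀ M] {f : M → G} {x : M} (hf : MDifferentiableAt I (𝓡 n) f x) {g : G}
    (hg : f x = g) : td I (𝓡 n) f x =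
      td (𝓡 n) (𝓡 n) (fun y => g * y) 1 ∘L td I (𝓡 n) (fun y => g⁻¹ * f y) x := by
  subst hg
  rw [← td_comp_of_eq (g := fun y => f x * y) (f := fun y => (f x)⁻¹ * f y) (inv_mul_cancel _)
    (mdiff_mul_left _ _) ((mdiff_mul_left _ _).comp x hf)]
  simp only [mul_inv_cancel_left]

variable [SecondCountableTopology G] (h : IsDoubleLieGroup n k m A B)
include h

theorem IsDoubleLieGroup.sum_frame_eq {f₁ : B → G} {f₂ : A → G} {g : G}
    (hf₁ : MDifferentiableAt (𝓡 m) (𝓡 n) f₁ 1) (hf₂ : MDifferentiableAt (𝓡 k) (𝓡 n) f₂ 1)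
    (h₁ : f₁ 1 = g) (h₂ : f₂ 1 = g) :
    asFin n (Sum.elim (fun i => (td (𝓡 m) (𝓡 n) f₁ 1 (stdVec m i) : E n))
        (fun j => (td (𝓡 k) (𝓡 n) f₂ 1 (stdVec k j) : E n))) = fun i =>
      td (𝓡 n) (𝓡 n) (fun y => g * y) 1 (asFin n (Sum.elim
        (fun i => td (𝓡 m) (𝓡 n) (fun s => g⁻¹ * f₁ s) 1 (stdVec m i))
        (fun j => td (𝓡 k) (𝓡 n) (fun s => g⁻¹ * f₂ s) 1 (stdVec k j))) i) := by
  rw [← asFin_comp n _ (map_zero _)]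
  congr 1
  funext i
  rcases i with i | i
  · exact congrArg (fun L => L (stdVec m i)) (td_eq_left hf₁ h₁)
  · exact congrArg (fun L => L (stdVec k i)) (td_eq_left hf₂ h₂)

/-- The value of a half-density on a frame given by a map on `B` and a map on `A`. -/
theorem IsDoubleLieGroup.eval_sum {φ : FrameField n G} (hφ : IsHomogeneous φ) {f₁ : B → G}
    {f₂ : A → G} {g : G} (hf₁ : MDifferentiableAt (𝓡 m) (𝓡 n) f₁ 1)
    (hf₂ : MDifferentiableAt (𝓡 k) (𝓡 n) f₂ 1) (h₁ : f₁ 1 = g) (h₂ : f₂ 1 = g)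
    {T₁ : E m →L[ℝ] E n} {T₂ : E k →L[ℝ] E n}
    (hT₁ : td (𝓡 m) (𝓡 n) (fun s => g⁻¹ * f₁ s) 1 = T₁)
    (hT₂ : td (𝓡 k) (𝓡 n) (fun s => g⁻¹ * f₂ s) 1 = T₂) :
    φ g (asFin n (Sum.elim (fun i => (td (𝓡 m) (𝓡 n) f₁ 1 (stdVec m i) : E n))
        (fun j => (td (𝓡 k) (𝓡 n) f₂ 1 (stdVec k j) : E n)))) =
      (((baseDet n k m A B * adet (T₁ ∘L projB n m A B + T₂ ∘L projA n k A B)) ^ (1 / 2 : ℝ) : ℝ) : ℂ)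
        * coeff n φ g := by
  have hs := h.sum_frame_eq hf₁ hf₂ h₁ h₂
  rw [hT₁, hT₂] at hs
  refine (congrArg (φ g) hs).trans ?_
  rw [← h.abs_frameDet_sum]
  exact hφ.eval g _

/-- The first point of the fibre is g₁ = a⁻¹ b_L(ag), so s_B(g₁) = b_L(ag) a_R(ag) a_R(g)⁻¹ = a g
a_R(g)⁻¹ = a b_L(g). This is the point at which φ enters Φ̂(φ,ψ)(g). -/
theorem IsDoubleLieGroup.sB_fibre (a : A) (g : G) :
    sB A B (g * (aR A B ((a : G) * g) : G)⁻¹) = a * bL A B g := by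
  have h1 : g * (aR A B ((a : G) * g) : G)⁻¹ = ((a⁻¹ : A) : G) * (bL A B ((a : G) * g) : G) := by
    rw [mul_inv_eq_iff_eq_mul, mul_assoc, h.eq_bL_mul_aR]; simp
  have h2 : aR A B (g * (aR A B ((a : G) * g) : G)⁻¹) = aR A B g * (aR A B ((a : G) * g))⁻¹ := by
    rw [← h.aR_mul_right]; rfl
  rw [sB, h2, h1, h.bR_mul]
  have h3 := h.eq_bL_mul_aR ((a : G) * g)
  have h4 := h.eq_bL_mul_aR g
  simp only [Subgroup.coe_mul, InvMemClass.coe_inv, mul_inv_rev, inv_inv]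
  rw [← mul_assoc, h3, mul_assoc]
  nth_rewrite 1 [← h4]
  rw [mul_inv_cancel_right]

/-- Since sg = a_L(g) (a_L(g)⁻¹ s a_L(g)) b_R(g), along a right fibre the factor `bR` moves by `bR`
of a conjugate of `s`; its derivative is thus the 𝔟-block of `Ad (a_L(g)⁻¹)`. -/
theorem IsDoubleLieGroup.bR_mul_eq (s : B) (g : G) :
    bR A B ((s : G) * g) = bR A B ((aL A B g : G)⁻¹ * s * ((aL A B g : G)⁻¹)⁻¹) * bR A B g := by
  rw [← h.bR_mul_right, inv_inv, mul_assoc _ _ (bR A B g : G), h.eq_aL_mul_bR, mul_assoc]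
  have := h.bR_mul_left (aL A B g)⁻¹ ((s : G) * g)
  rw [InvMemClass.coe_inv] at this
  exact this.symm

theorem IsDoubleLieGroup.bL_mul_eq (g : G) (s : B) :
    bL A B (g * s) = bL A B g * bL A B ((aR A B g : G) * s * (aR A B g : G)⁻¹) := by
  rw [← h.bL_mul_left, ← mul_assoc, ← mul_assoc, h.eq_bL_mul_aR]
  have := h.bL_mul_right (g * s) (aR A B g)⁻¹
  rw [InvMemClass.coe_inv] at this
  exact this.symm

theorem IsDoubleLieGroup.mdiff_sB : MDifferentiable (𝓡 n) (𝓡 n) (sB A B) :=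
  mdiff_mul_mul (h.mdiff_right.comp h.mdiff_bR) (mdiff_inv_fun (h.mdiff_left.comp h.mdiff_aR))

theorem IsDoubleLieGroup.mdiff_sA : MDifferentiable (𝓡 n) (𝓡 n) (sA A B) :=
  mdiff_mul_mul (h.mdiff_left.comp h.mdiff_aR) (mdiff_inv_fun (h.mdiff_right.comp h.mdiff_bR))

theorem IsDoubleLieGroup.td_bR_conj (c : G) :
    td (𝓡 m) (𝓡 n) (fun s : B => (bR A B (c * (s : G) * c⁻¹) : G)) 1 =
      incl n m B ∘L projB n m A B ∘L adj (𝓡 n) c ∘L incl n m B := by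
  have h1 : MDifferentiable (𝓡 m) (𝓡 n) (fun s : B => c * (s : G) * c⁻¹) :=
    (mdiff_conj c).comp h.mdiff_right
  rw [td_comp_of_eq (g := (Subtype.val : B → G)) (f := fun s : B => bR A B (c * (s : G) * c⁻¹))
      (y := 1) (by simp [h.bR_one]) (h.mdiff_right 1) ((h.mdiff_bR.comp h1) 1),
    td_comp_of_eq (g := bR A B) (f := fun s : B => c * (s : G) * c⁻¹) (y := 1) (by simp)
      (h.mdiff_bR 1) (h1 1),
    td_conj_comp (h.mdiff_right 1) (OneMemClass.coe_one B)]
  rfl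

theorem IsDoubleLieGroup.td_bL_conj (c : G) :
    td (𝓡 m) (𝓡 m) (fun s : B => bL A B (c * (s : G) * c⁻¹)) 1 =
      projB n m A B ∘L adj (𝓡 n) c ∘L incl n m B := by
  have h1 : MDifferentiable (𝓡 m) (𝓡 n) (fun s : B => c * (s : G) * c⁻¹) :=
    (mdiff_conj c).comp h.mdiff_right
  rw [td_comp_of_eq (g := bL A B) (y := 1) (by simp) (h.mdiff_bL 1) (h1 1),
    td_conj_comp (h.mdiff_right 1) (OneMemClass.coe_one B), h.td_aR_one_td_bL_one.2]
  rfl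

/-- Read at `a g` by left translation, the vectors are Y on 𝔟 and `Ad g⁻¹ X` on 𝔞. The frame is
triangular and only the 𝔞-block of `Ad g⁻¹` counts. -/
theorem IsDoubleLieGroup.eval_second {ψ : FrameField n G} (hψ : IsHomogeneous ψ) (g : G) (a : A) :
    ψ (deltaParam A B g a).2
      (asFin n (Sum.elim
        (fun i => (tmap n n (fun x : G => (a : G) * x) g (lFrame n m B g i) : E n))
        (fun i => (tmap k n (fun a' : A => (deltaParam A B g a').2) a (leftFrame k a i) : E n)))) =
      (((baseDet n k m A B * modA n k A B g⁻¹) ^ (1 / 2 : ℝ) : ℝ) : ℂ) * coeff n ψ ((a : G) * g) := by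
  set f₁ : B → G := fun s => (a : G) * (g * s) with hf₁
  set f₂ : A → G := fun x => ((a * x : A) : G) * g with hf₂
  have d0 : MDifferentiable (𝓡 m) (𝓡 n) (fun s : B => g * (s : G)) :=
    (mdiff_mul_left g).comp h.mdiff_right
  have d1 : MDifferentiable (𝓡 m) (𝓡 n) f₁ := (mdiff_mul_left (a : G)).comp d0
  have d3 : MDifferentiable (𝓡 k) (𝓡 n) (fun x : A => (x : G) * g) :=
    (mdiff_mul_right g).comp h.mdiff_left
  have d2 : MDifferentiable (𝓡 k) (𝓡 n) f₂ := d3.comp (mdiff_mul_left a)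
  have e1 : ∀ i, (tmap n n (fun x : G => (a : G) * x) g (lFrame n m B g i) : E n) =
      td (𝓡 m) (𝓡 n) f₁ 1 (stdVec m i) := fun i => by
    rw [td_comp_of_eq (g := fun x : G => (a : G) * x) (f := fun s : B => g * (s : G)) (y := g)
      (by simp) (mdiff_mul_left _ _) (d0 1)]
    rfl
  have e2 : ∀ i, (tmap k n (fun a' : A => (deltaParam A B g a').2) a (leftFrame k a i) : E n) =
      td (𝓡 k) (𝓡 n) f₂ 1 (stdVec k i) := fun i => by
    rw [td_comp_of_eq (g := fun x : A => (x : G) * g) (f := fun x : A => a * x) (y := a)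
      (by simp) (d3 a) (mdiff_mul_left a 1)]
    rfl
  have t1 : td (𝓡 m) (𝓡 n) (fun s => ((a : G) * g)⁻¹ * f₁ s) 1 = incl n m B := by
    have : (fun s => ((a : G) * g)⁻¹ * f₁ s) = (Subtype.val : B → G) := by
      funext s; simp only [hf₁]; group
    rw [this]; rfl
  have t2 : td (𝓡 k) (𝓡 n) (fun s => ((a : G) * g)⁻¹ * f₂ s) 1 = adj (𝓡 n) g⁻¹ ∘L incl n k A := by
    have : (fun s => ((a : G) * g)⁻¹ * f₂ s) = fun s : A => g⁻¹ * (s : G) * (g⁻¹)⁻¹ := by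
      funext s; simp only [hf₂, Subgroup.coe_mul]; group
    rw [this, td_conj_comp (h.mdiff_left 1) (OneMemClass.coe_one A)]; rfl
  simp only [e1, e2]
  have key := h.eval_sum hψ (g := (a : G) * g) (d1 1) (d2 1) (by simp [hf₁]) (by simp [hf₂]) t1 t2
  refine key.trans ?_
  congr 4
  rw [h.adet_of_lower]
  · have x1 : projA n k A B ∘L (incl n m B ∘L projB n m A B +
        (adj (𝓡 n) g⁻¹ ∘L incl n k A) ∘L projA n k A B) ∘L incl n k A =
        projA n k A B ∘L adj (𝓡 n) g⁻¹ ∘L incl n k A := by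
      ext1 v; simp [h.projA_inclA, h.projB_inclA]
    have x2 : projB n m A B ∘L (incl n m B ∘L projB n m A B +
        (adj (𝓡 n) g⁻¹ ∘L incl n k A) ∘L projA n k A B) ∘L incl n m B =
        ContinuousLinearMap.id ℝ (E m) := by
      ext1 v; simp [h.projA_inclB, h.projB_inclB]
    rw [x1, x2, adet_id, mul_one]; rfl
  · ext1 v; simp [h.projA_inclB, h.projB_inclB]

/-- After the push-forward by s_B the vectors at a b_L(g) are `Ad (b_L(g)⁻¹) X` on 𝔞 and `Ad ((a
b_L(g))⁻¹) P_B Ad a Y` on 𝔟. -/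
theorem IsDoubleLieGroup.eval_first {φ : FrameField n G} (hφ : IsHomogeneous φ) (g : G) (a : A) :
    conjPushB n A B φ (deltaParam A B g a).1
      (asFin n (Sum.elim
        (fun i => (tmap n n (fun x : G => x * (aR A B (a * g) : G)⁻¹) g (rFrame n m B g i) : E n))
        (fun i => (tmap k n (fun a' : A => (deltaParam A B g a').1) a (leftFrame k a i) : E n)))) =
      (((baseDet n k m A B * modG n (bL A B g : G)⁻¹) ^ (1 / 2 : ℝ) : ℝ) : ℂ) *
        starRingEnd ℂ (coeff n φ ((a : G) * bL A B g)) := by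
  set c : G := (aR A B ((a : G) * g) : G)⁻¹ with hc
  set f₁ : B → G := fun s => sB A B ((s : G) * g * c) with hf₁
  set f₂ : A → G := fun x => sB A B (g * (aR A B (((a * x : A) : G) * g) : G)⁻¹) with hf₂
  have d0 : MDifferentiable (𝓡 m) (𝓡 n) (fun s : B => (s : G) * g) :=
    (mdiff_mul_right g).comp h.mdiff_right
  have d0' : MDifferentiable (𝓡 m) (𝓡 n) (fun s : B => (s : G) * g * c) :=
    (mdiff_mul_right c).comp d0
  have d1 : MDifferentiable (𝓡 m) (𝓡 n) f₁ := h.mdiff_sB.comp d0'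
  have d3 : MDifferentiable (𝓡 k) (𝓡 n) (fun x : A => g * (aR A B ((x : G) * g) : G)⁻¹) :=
    (mdiff_mul_left g).comp (mdiff_inv_fun (h.mdiff_left.comp (h.mdiff_aR.comp
      ((mdiff_mul_right g).comp h.mdiff_left))))
  have d3' : MDifferentiable (𝓡 k) (𝓡 n)
      (fun x : A => g * (aR A B (((a * x : A) : G) * g) : G)⁻¹) := d3.comp (mdiff_mul_left a)
  have d2 : MDifferentiable (𝓡 k) (𝓡 n) f₂ := h.mdiff_sB.comp d3'
  have e1 : ∀ i, tlin n n (sB A B) (g * c)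
      (tmap n n (fun x : G => x * c) g (rFrame n m B g i) : E n) =
      td (𝓡 m) (𝓡 n) f₁ 1 (stdVec m i) := fun i => by
    rw [td_comp_of_eq (g := sB A B) (f := fun s : B => (s : G) * g * c) (y := g * c)
      (by simp) (h.mdiff_sB _) (d0' 1),
      td_comp_of_eq (g := fun x : G => x * c) (f := fun s : B => (s : G) * g) (y := g)
      (by simp) (mdiff_mul_right _ _) (d0 1)]
    rfl
  have e2 : ∀ i, tlin n n (sB A B) (g * c)
      (tmap k n (fun a' : A => (deltaParam A B g a').1) a (leftFrame k a i) : E n) =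
      td (𝓡 k) (𝓡 n) f₂ 1 (stdVec k i) := fun i => by
    rw [td_comp_of_eq (g := sB A B) (f := fun x : A => g * (aR A B (((a * x : A) : G) * g) : G)⁻¹)
      (y := g * c) (by simp [hc]) (h.mdiff_sB _) (d3' 1),
      td_comp_of_eq (g := fun x : A => g * (aR A B ((x : G) * g) : G)⁻¹) (f := fun x : A => a * x)
      (y := a) (by simp) (d3 a) (mdiff_mul_left a 1)]
    rfl
  have hp : sB A B (g * c) = a * bL A B g := h.sB_fibre a g
  have t2 : td (𝓡 k) (𝓡 n) (fun s => ((a : G) * bL A B g)⁻¹ * f₂ s) 1 =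
      adj (𝓡 n) (bL A B g : G)⁻¹ ∘L incl n k A := by
    have : (fun s => ((a : G) * bL A B g)⁻¹ * f₂ s) =
        fun s : A => (bL A B g : G)⁻¹ * (s : G) * ((bL A B g : G)⁻¹)⁻¹ := by
      funext s
      have h1 : f₂ s = ((a * s : A) : G) * bL A B g := h.sB_fibre (a * s) g
      rw [h1, Subgroup.coe_mul]; group
    rw [this, td_conj_comp (h.mdiff_left 1) (OneMemClass.coe_one A)]; rfl
  have haL : aL A B (g * c) = a⁻¹ := by
    have h1 : g * c = ((a⁻¹ : A) : G) * (bL A B ((a : G) * g) : G) := by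
      rw [hc, mul_inv_eq_iff_eq_mul, mul_assoc, h.eq_bL_mul_aR]; simp
    rw [h1, h.aL_mul]
  have t1 : td (𝓡 m) (𝓡 n) (fun s => ((a : G) * bL A B g)⁻¹ * f₁ s) 1 =
      adj (𝓡 n) ((a : G) * bL A B g)⁻¹ ∘L
        (incl n m B ∘L projB n m A B ∘L adj (𝓡 n) (a : G) ∘L incl n m B) := by
    have : (fun s => ((a : G) * bL A B g)⁻¹ * f₁ s) =
        fun s : B => ((a : G) * bL A B g)⁻¹ * (bR A B ((a : G) * s * (a : G)⁻¹) : G) *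
          (((a : G) * bL A B g)⁻¹)⁻¹ := by
      funext s
      rw [← hp, mul_assoc _ _ ((sB A B (g * c))⁻¹)⁻¹, inv_inv]
      congr 1
      simp only [hf₁, sB]
      rw [mul_assoc (s : G), h.bR_mul_eq, h.aR_mul_left, haL]
      simp [mul_assoc]
    have d : MDifferentiable (𝓡 m) (𝓡 n)
        (fun s : B => (bR A B ((a : G) * s * (a : G)⁻¹) : G)) :=
      h.mdiff_right.comp (h.mdiff_bR.comp ((mdiff_conj (a : G)).comp h.mdiff_right))
    rw [this, td_conj_comp (d 1) (by simp [h.bR_one]), h.td_bR_conj]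
  have key := h.eval_sum hφ (g := (a : G) * bL A B g) (d1 1) (d2 1)
    (by simp only [hf₁, OneMemClass.coe_one, one_mul]; exact hp)
    (by simp only [hf₂, mul_one]; exact h.sB_fibre a g) t1 t2
  have hframe : (fun i => tlin n n (sB A B) (g * c) (asFin n (Sum.elim
        (fun i => (tmap n n (fun x : G => x * c) g (rFrame n m B g i) : E n))
        (fun i => (tmap k n (fun a' : A => (deltaParam A B g a').1) a (leftFrame k a i) : E n))) i)) =
      asFin n (Sum.elim (fun i => td (𝓡 m) (𝓡 n) f₁ 1 (stdVec m i))
        (fun j => td (𝓡 k) (𝓡 n) f₂ 1 (stdVec k j))) := by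
    rw [← asFin_comp n _ (map_zero _)]
    congr 1
    funext i
    rcases i with i | i
    · exact e1 i
    · exact e2 i
  have key2 : conjPushB n A B φ (deltaParam A B g a).1
      (asFin n (Sum.elim
        (fun i => (tmap n n (fun x : G => x * (aR A B (a * g) : G)⁻¹) g (rFrame n m B g i) : E n))
        (fun i => (tmap k n (fun a' : A => (deltaParam A B g a').1) a (leftFrame k a i) : E n)))) =
      starRingEnd ℂ (φ (sB A B (g * c)) (fun i => tlin n n (sB A B) (g * c) (asFin n (Sum.elim
        (fun i => (tmap n n (fun x : G => x * c) g (rFrame n m B g i) : E n))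
        (fun i => (tmap k n (fun a' : A => (deltaParam A B g a').1) a
          (leftFrame k a i) : E n))) i))) := rfl
  rw [key2, hframe, hp]
  refine (congrArg (starRingEnd ℂ) key).trans ?_
  rw [map_mul, Complex.conj_ofReal]
  congr 4
  -- Take out the factor `Ad (b_L(g)⁻¹)`, which gives the whole answer. What remains is the identity
  -- on 𝔞 and `Ad a⁻¹ P_B Ad a` on 𝔟; modulo 𝔞 the latter is also the identity, because `Ad a⁻¹`
  -- preserves 𝔞. So the remaining determinant is 1.
  have hL : (adj (𝓡 n) ((a : G) * bL A B g)⁻¹ ∘L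
        (incl n m B ∘L projB n m A B ∘L adj (𝓡 n) (a : G) ∘L incl n m B)) ∘L projB n m A B +
      (adj (𝓡 n) (bL A B g : G)⁻¹ ∘L incl n k A) ∘L projA n k A B =
      adj (𝓡 n) (bL A B g : G)⁻¹ ∘L (adj (𝓡 n) (a : G)⁻¹ ∘L
        incl n m B ∘L projB n m A B ∘L adj (𝓡 n) (a : G) ∘L incl n m B ∘L projB n m A B +
        incl n k A ∘L projA n k A B) := by
    rw [mul_inv_rev, adj_mul]
    ext1 v; simp
  rw [hL, adet_comp, h.adet_of_upper (L := adj (𝓡 n) (a : G)⁻¹ ∘L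
        incl n m B ∘L projB n m A B ∘L adj (𝓡 n) (a : G) ∘L incl n m B ∘L projB n m A B +
        incl n k A ∘L projA n k A B)]
  · have hinv : ∀ v, adj (𝓡 n) (a : G)⁻¹ (adj (𝓡 n) (a : G) v) = v := fun v =>
      congrArg (fun L => L v) (adj_inv_comp (a : G))
    have hz : ∀ v, projB n m A B (adj (𝓡 n) (a : G)⁻¹ (incl n k A v)) = 0 := fun v => by
      have := h.projB_adj_inclA a⁻¹ v
      rwa [InvMemClass.coe_inv] at this
    have x1 : projA n k A B ∘L (adj (𝓡 n) (a : G)⁻¹ ∘L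
        incl n m B ∘L projB n m A B ∘L adj (𝓡 n) (a : G) ∘L incl n m B ∘L projB n m A B +
        incl n k A ∘L projA n k A B) ∘L incl n k A = ContinuousLinearMap.id ℝ (E k) := by
      ext1 v; simp [h.projA_inclA, h.projB_inclA]
    have x2 : projB n m A B ∘L (adj (𝓡 n) (a : G)⁻¹ ∘L
        incl n m B ∘L projB n m A B ∘L adj (𝓡 n) (a : G) ∘L incl n m B ∘L projB n m A B +
        incl n k A ∘L projA n k A B) ∘L incl n m B = ContinuousLinearMap.id ℝ (E m) := by
      ext1 v
      have h3 := h.incl_proj (adj (𝓡 n) (a : G) (incl n m B v))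
      have h4 := congrArg (fun x => projB n m A B (adj (𝓡 n) (a : G)⁻¹ x)) h3
      simp only [map_add, hz, zero_add, hinv, h.projB_inclB] at h4
      simp [h.projA_inclB, h.projB_inclB, h4]
    rw [x1, x2, adet_id, adet_id, mul_one, mul_one]; rfl
  · ext1 v; simp [h.projA_inclA, h.projB_inclA]

/-- The function `a ↦ Φ_g(conj (s_B φ), ψ)` in terms of the coefficients of `φ` and `ψ`. -/
theorem IsDoubleLieGroup.PhiDensity_eval {φ ψ : FrameField n G} (hφ : IsHomogeneous φ)
    (hψ : IsHomogeneous ψ) (g : G) (a : A) :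
    PhiDensity n k m A B (conjPushB n A B φ) ψ g (lFrame n m B g) (rFrame n m B g) a
      (leftFrame k a) =
      (((baseDet n k m A B * modG n (bL A B g : G)⁻¹) ^ (1 / 2 : ℝ) : ℝ) : ℂ) *
        (((baseDet n k m A B * modA n k A B g⁻¹) ^ (1 / 2 : ℝ) : ℝ) : ℂ) *
        (starRingEnd ℂ (coeff n φ ((a : G) * bL A B g)) * coeff n ψ ((a : G) * g)) := by
  rw [PhiDensity, h.eval_first hφ, h.eval_second hψ]
  ring

end Evaluation

end

end DLG

namespace DLG

set_option linter.unusedSectionVars false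

noncomputable section

/-! ### Homogeneity of half-densities and bidensities -/

section Homogeneity

variable {n k m : ℕ} {G : Type*} [Group G] [TopologicalSpace G] [ChartedSpace (E n) G]
  {A B : Subgroup G} [ChartedSpace (E k) A] [ChartedSpace (E m) B]

theorem eq_sum_stdVec {l : ℕ} (x : E l) : x = ∑ i, x i • stdVec l i := by
  have := (EuclideanSpace.basisFun (Fin l) ℝ).sum_repr x
  simpa [stdVec] using this.symm

theorem map_eq_sum {l : ℕ} {V : Type*} [AddCommGroup V] [Module ℝ V] (L : E l →ₗ[ℝ] V) (x : E l) :
    L x = ∑ i, x i • L (stdVec l i) := by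
  nth_rewrite 1 [eq_sum_stdVec x]
  rw [map_sum]
  simp only [map_smul]

theorem map_sum_smul {ι V W : Type*} [Fintype ι] [AddCommGroup V] [Module ℝ V] [AddCommGroup W]
    [Module ℝ W] (L : V →ₗ[ℝ] W) (c : ι → ℝ) (u : ι → V) :
    L (∑ i, c i • u i) = ∑ i, c i • L (u i) := by
  rw [map_sum]
  simp only [map_smul]

theorem IsHomogeneous.asFin_sum {φ : FrameField n G} (hφ : IsHomogeneous φ) {ι : Type*} [Fintype ι]
    [DecidableEq ι] (hι : Fintype.card ι = n) (g : G) (M : Matrix ι ι ℝ) (u : ι → E n) :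
    φ g (asFin n (fun j => ∑ i, M i j • u i)) =
      ((|M.det| ^ (1 / 2 : ℝ) : ℝ) : ℂ) * φ g (asFin n u) := by
  set e := (Fintype.equivFinOfCardEq hι).symm with he
  have h1 : asFin n (fun j => ∑ i, M i j • u i) =
      fun j => ∑ i, M.submatrix e e i j • asFin n u i := by
    funext j
    simp only [asFin, dif_pos hι, Function.comp, Matrix.submatrix_apply]
    exact (Equiv.sum_comp e (fun i => M i (e j) • u i)).symm
  have h2 := hφ g (M.submatrix e e) (asFin n u)
  rw [Matrix.det_submatrix_equiv_self] at h2
  exact (congrArg (φ g) h1).trans h2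

theorem IsHomogeneous.conjPushB {φ : FrameField n G} (hφ : IsHomogeneous φ) :
    IsHomogeneous (conjPushB n A B φ) := by
  intro g M u
  have h1 : (fun j => tlin n n (sB A B) g (∑ i, M i j • (u i : E n) : E n)) =
      fun j => ∑ i, M i j • tlin n n (sB A B) g (u i) :=
    funext fun j => map_sum_smul (tlin n n (sB A B) g) (fun i => M i j) u
  have h2 := hφ (sB A B g) M (fun i => tlin n n (sB A B) g (u i))
  refine (congrArg (starRingEnd ℂ) ((congrArg (φ (sB A B g)) h1).trans h2)).trans ?_
  rw [map_mul, Complex.conj_ofReal]; rfl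

/-- Homogeneity of degree one half in both arguments. -/
structure IsBihomogeneous (Ω : BiField n m B) : Prop where
  left : ∀ (g : G) (M : Matrix (Fin m) (Fin m) ℝ) (v : Fin m → Tl n m B g)
    (w : Fin m → Tr n m B g),
    Ω g (fun j => ∑ i, M i j • v i) w = ((|M.det| ^ (1 / 2 : ℝ) : ℝ) : ℂ) * Ω g v w
  right : ∀ (g : G) (M : Matrix (Fin m) (Fin m) ℝ) (v : Fin m → Tl n m B g)
    (w : Fin m → Tr n m B g),
    Ω g v (fun j => ∑ i, M i j • w i) = ((|M.det| ^ (1 / 2 : ℝ) : ℝ) : ℂ) * Ω g v w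

theorem IsBidensity.isBihomogeneous {Ω : BiField n m B} (hΩ : IsBidensity n m B Ω) :
    IsBihomogeneous Ω := ⟨hΩ.homogeneous_left, hΩ.homogeneous_right⟩

theorem det_of_frame {l : ℕ} (X : Fin l → E l) :
    (Matrix.of fun i j => X j i).det = frameDet X := by
  rw [frameDet, ← Matrix.det_transpose]; rfl

theorem IsBihomogeneous.app_sub {Ω : BiField n m B} (hΩ : IsBihomogeneous Ω) (g : G)
    (X Y : Fin m → E m) :
    Ω.app g (fun i => subLeft n m B g (X i)) (fun i => subRight n m B g (Y i)) =
      (((|frameDet X| * |frameDet Y|) ^ (1 / 2 : ℝ) : ℝ) : ℂ) *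
        Ω g (lFrame n m B g) (rFrame n m B g) := by
  have hX : ∀ i, (⟨subLeft n m B g (X i), LinearMap.mem_range_self _ _⟩ : Tl n m B g) =
      ∑ j, (Matrix.of fun i j => X j i) j i • lFrame n m B g j := fun i => by
    apply Subtype.ext
    rw [AddSubmonoidClass.coe_finsetSum]
    exact map_eq_sum (subLeft n m B g) (X i)
  have hY : ∀ i, (⟨subRight n m B g (Y i), LinearMap.mem_range_self _ _⟩ : Tr n m B g) =
      ∑ j, (Matrix.of fun i j => Y j i) j i • rFrame n m B g j := fun i => by
    apply Subtype.ext
    rw [AddSubmonoidClass.coe_finsetSum]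
    exact map_eq_sum (subRight n m B g) (Y i)
  have h0 : (∀ i, subLeft n m B g (X i) ∈ Tl n m B g) ∧
      ∀ i, subRight n m B g (Y i) ∈ Tr n m B g :=
    ⟨fun i => LinearMap.mem_range_self _ _, fun i => LinearMap.mem_range_self _ _⟩
  -- The frames lie in the fibres by construction, so the default value 0 of `BiField.app` plays no
  -- role.
  rw [BiField.app, dif_pos h0]
  have e1 : (fun i => (⟨subLeft n m B g (X i), h0.1 i⟩ : Tl n m B g)) =
      fun i => ∑ j, (Matrix.of fun i j => X j i) j i • lFrame n m B g j := funext hX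
  have e2 : (fun i => (⟨subRight n m B g (Y i), h0.2 i⟩ : Tr n m B g)) =
      fun i => ∑ j, (Matrix.of fun i j => Y j i) j i • rFrame n m B g j := funext hY
  rw [e1, e2, hΩ.left, hΩ.right, det_of_frame, det_of_frame,
    Real.mul_rpow (abs_nonneg _) (abs_nonneg _)]
  push_cast
  ring

theorem Tl.exists_frame {g : G} (v : Fin m → Tl n m B g) :
    ∃ X : Fin m → E m, ∀ i, ((v i : TangentSpace (𝓡 n) g)) = subLeft n m B g (X i) := by
  choose X hX using fun i => (v i).2
  exact ⟨X, fun i => (hX i).symm⟩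

theorem Tr.exists_frame {g : G} (w : Fin m → Tr n m B g) :
    ∃ Y : Fin m → E m, ∀ i, ((w i : TangentSpace (𝓡 n) g)) = subRight n m B g (Y i) := by
  choose Y hY using fun i => (w i).2
  exact ⟨Y, fun i => (hY i).symm⟩

end Homogeneity

end

end DLG

namespace DLG

set_option linter.unusedSectionVars false

noncomputable section

/-! ### Invariance properties of integrals -/

section Integrals

variable {n : ℕ} {H : Type*} [Group H] [TopologicalSpace H] [ChartedSpace (E n) H]
  [LieGroup (𝓡 n) ∞ H] [MeasurableSpace H] [BorelSpace H] [SecondCountableTopology H]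
  {H' : Type*} [Group H'] [TopologicalSpace H'] [ChartedSpace (E n) H']
  [LieGroup (𝓡 n) ∞ H'] [MeasurableSpace H'] [BorelSpace H'] [SecondCountableTopology H']

theorem map_refMeasure_diffeo (F : H ≃ₜ H') (hF : ContMDiff (𝓡 n) (𝓡 n) ∞ F)
    (hF' : ContMDiff (𝓡 n) (𝓡 n) ∞ F.symm) :
    ((refMeasure n H).withDensity fun h => ENNReal.ofReal (adet (gd (𝓡 n) (𝓡 n) F h))).map F =
      refMeasure n H' := by
  ext S hS
  have h1 := lintegral_refMeasure_diffeo F hF hF' (f := S.indicator 1)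
    (measurable_one.indicator hS)
  rw [lintegral_indicator_one hS] at h1
  rw [← h1, Measure.map_apply F.continuous.measurable hS,
    withDensity_apply _ (F.continuous.measurable hS),
    ← lintegral_indicator (F.continuous.measurable hS)]
  refine lintegral_congr fun x => ?_
  by_cases hx : F x ∈ S
  · rw [Set.indicator_of_mem (show x ∈ F ⁻¹' S from hx), Set.indicator_of_mem hx, Pi.one_apply,
      mul_one]
    rfl
  · rw [Set.indicator_of_notMem (show x ∉ F ⁻¹' S from hx), Set.indicator_of_notMem hx, mul_zero]

theorem integral_refMeasure_diffeo (F : H ≃ₜ H') (hF : ContMDiff (𝓡 n) (𝓡 n) ∞ F)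
    (hF' : ContMDiff (𝓡 n) (𝓡 n) ∞ F.symm) (f : H' → ℂ) :
    ∫ h, ((adet (gd (𝓡 n) (𝓡 n) F h) : ℝ) : ℂ) * f (F h) ∂(refMeasure n H) =
      ∫ h, f h ∂(refMeasure n H') := by
  rw [← map_refMeasure_diffeo F hF hF']
  have h1 := integral_map_equiv (μ := (refMeasure n H).withDensity fun h =>
    ENNReal.ofReal (adet (gd (𝓡 n) (𝓡 n) F h))) F.toMeasurableEquiv f
  refine Eq.trans ?_ h1.symm
  have h2 : Measurable fun h => ENNReal.ofReal (adet (gd (𝓡 n) (𝓡 n) F h)) :=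
    measurable_abs_det_gd hF
  rw [integral_withDensity_eq_integral_toReal_smul h2
    (Filter.Eventually.of_forall fun _ => ENNReal.ofReal_lt_top)]
  refine integral_congr_ae (Filter.Eventually.of_forall fun x => ?_)
  simp only [ENNReal.toReal_ofReal (adet_nonneg _), Complex.real_smul]
  rfl

/-- The trivialised derivative of right translation by `c` is `Ad c⁻¹` at every point, which
produces the modular function. -/
theorem integral_refMeasure_mul_right (c : H) (f : H → ℂ) :
    ∫ h, f (h * c) ∂(refMeasure n H) = ((modG n c : ℝ) : ℂ) * ∫ h, f h ∂(refMeasure n H) := by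
  have h1 := integral_refMeasure_diffeo
    ({ toEquiv := Equiv.mulRight c,
       continuous_toFun := (contMDiff_mul_right (I := 𝓡 n) (n := ∞) (a := c)).continuous
       continuous_invFun := (contMDiff_mul_right (I := 𝓡 n) (n := ∞) (a := c⁻¹)).continuous } :
      H ≃ₜ H) (contMDiff_mul_right (I := 𝓡 n) (n := ∞) (a := c))
    (contMDiff_mul_right (I := 𝓡 n) (n := ∞) (a := c⁻¹)) f
  have h2 : ∀ h : H, adet (gd (𝓡 n) (𝓡 n) (fun x => x * c) h) = modG n c⁻¹ := fun h => by
    rw [gd_mul_right]; rfl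
  have h3 : ∫ h, ((modG n c⁻¹ : ℝ) : ℂ) * f (h * c) ∂(refMeasure n H) =
      ∫ h, f h ∂(refMeasure n H) :=
    (integral_congr_ae (Filter.Eventually.of_forall fun x => by
      simp only [← h2 x]; rfl)).trans h1
  rw [integral_const_mul] at h3
  rw [← h3, ← mul_assoc, ← Complex.ofReal_mul, mul_comm (modG n c), modG_inv_mul,
    Complex.ofReal_one, one_mul]

end Integrals

/-! ### The coefficient of Φ̂ -/

section PhiHomogeneity

variable {n k m : ℕ} {G : Type*} [Group G] [TopologicalSpace G] [ChartedSpace (E n) G]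
  [LieGroup (𝓡 n) ∞ G]
  {A B : Subgroup G} [ChartedSpace (E k) A] [LieGroup (𝓡 k) ∞ A]
  [ChartedSpace (E m) B] [LieGroup (𝓡 m) ∞ B] [SecondCountableTopology G]
  (h : IsDoubleLieGroup n k m A B)
include h

/-- Extending `M` by the identity on the remaining `k` vectors does not change its determinant. -/
theorem IsDoubleLieGroup.eval_sum_smul {φ : FrameField n G} (hφ : IsHomogeneous φ) (g : G)
    (M : Matrix (Fin m) (Fin m) ℝ) (L : E n →ₗ[ℝ] E n) (v : Fin m → E n) (f : Fin k → E n) :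
    φ g (asFin n (Sum.elim (fun j => L (∑ i, M i j • v i)) f)) =
      ((|M.det| ^ (1 / 2 : ℝ) : ℝ) : ℂ) * φ g (asFin n (Sum.elim (fun j => L (v j)) f)) := by
  have h1 : Sum.elim (fun j => L (∑ i, M i j • v i)) f =
      fun j => ∑ i, Matrix.fromBlocks M 0 0 (1 : Matrix (Fin k) (Fin k) ℝ) i j •
        Sum.elim (fun j => L (v j)) f i := by
    funext j
    rcases j with j | j
    · rw [Sum.elim_inl, map_sum_smul L (fun i => M i j) v]
      simp
    · simp [Matrix.one_apply]
  have h2 := hφ.asFin_sum h.card_sum g (Matrix.fromBlocks M 0 0 (1 : Matrix (Fin k) (Fin k) ℝ))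
    (Sum.elim (fun j => L (v j)) f)
  rw [Matrix.det_fromBlocks_zero₂₁, Matrix.det_one, mul_one] at h2
  exact (congrArg (fun u => φ g (asFin n u)) h1).trans h2

theorem IsDoubleLieGroup.PhiDensity_smul_left {φ ψ : FrameField n G}
    (hψ : IsHomogeneous ψ) (g : G) (M : Matrix (Fin m) (Fin m) ℝ) (v : Fin m → Tl n m B g)
    (w : Fin m → Tr n m B g) (a : A) (u : Fin k → TangentSpace (𝓡 k) a) :
    PhiDensity n k m A B φ ψ g (fun j => ∑ i, M i j • v i) w a u =
      ((|M.det| ^ (1 / 2 : ℝ) : ℝ) : ℂ) * PhiDensity n k m A B φ ψ g v w a u := by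
  have h1 := h.eval_sum_smul hψ (deltaParam A B g a).2 M (tlin n n (fun x : G => (a : G) * x) g)
    (fun i => (v i : TangentSpace (𝓡 n) g))
    (fun i => (tmap k n (fun a' : A => (deltaParam A B g a').2) a (u i) : E n))
  have h2 : ∀ j, ((∑ i, M i j • v i : Tl n m B g) : TangentSpace (𝓡 n) g) =
      ∑ i, M i j • (v i : TangentSpace (𝓡 n) g) := fun j => by
    rw [AddSubmonoidClass.coe_finsetSum]; rfl
  unfold PhiDensity
  simp only [h2]
  refine (congrArg (fun z => _ * z) h1).trans ?_
  rw [mul_left_comm]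
  rfl

theorem IsDoubleLieGroup.PhiDensity_smul_right {φ ψ : FrameField n G}
    (hφ : IsHomogeneous φ) (g : G) (M : Matrix (Fin m) (Fin m) ℝ) (v : Fin m → Tl n m B g)
    (w : Fin m → Tr n m B g) (a : A) (u : Fin k → TangentSpace (𝓡 k) a) :
    PhiDensity n k m A B φ ψ g v (fun j => ∑ i, M i j • w i) a u =
      ((|M.det| ^ (1 / 2 : ℝ) : ℝ) : ℂ) * PhiDensity n k m A B φ ψ g v w a u := by
  have h1 := h.eval_sum_smul hφ (deltaParam A B g a).1 M
    (tlin n n (fun x : G => x * (aR A B (a * g) : G)⁻¹) g)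
    (fun i => (w i : TangentSpace (𝓡 n) g))
    (fun i => (tmap k n (fun a' : A => (deltaParam A B g a').1) a (u i) : E n))
  have h2 : ∀ j, ((∑ i, M i j • w i : Tr n m B g) : TangentSpace (𝓡 n) g) =
      ∑ i, M i j • (w i : TangentSpace (𝓡 n) g) := fun j => by
    rw [AddSubmonoidClass.coe_finsetSum]; rfl
  unfold PhiDensity
  simp only [h2]
  refine (congrArg (fun z => z * _) h1).trans ?_
  rw [mul_assoc]
  rfl

variable [MeasurableSpace G]

theorem IsDoubleLieGroup.isBihomogeneous_PhiHat {φ ψ : FrameField n G} (hφ : IsHomogeneous φ)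
    (hψ : IsHomogeneous ψ) : IsBihomogeneous (PhiHat n k m A B φ ψ) := by
  constructor
  · intro g M v w
    simp only [PhiHat, Phi, densityIntegral]
    refine (congrArg (fun z => _ * z) ((integral_congr_ae (Filter.Eventually.of_forall fun a =>
      h.PhiDensity_smul_left hψ g M v w a _)).trans (integral_const_mul _ _))).trans ?_
    exact mul_left_comm _ _ _
  · intro g M v w
    simp only [PhiHat, Phi, densityIntegral]
    refine (congrArg (fun z => _ * z) ((integral_congr_ae (Filter.Eventually.of_forall fun a =>
      h.PhiDensity_smul_right hφ.conjPushB g M v w a _)).trans (integral_const_mul _ _))).trans ?_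
    exact mul_left_comm _ _ _

/-- The integral `∫_A conj (f₁ (a b_L(g))) f₂ (a g) da`. -/
def corr (k : ℕ) {G : Type*} [Group G] [TopologicalSpace G] (A B : Subgroup G)
    [ChartedSpace (E k) A] [MeasurableSpace G] (f₁ f₂ : G → ℂ) (g : G) : ℂ :=
  ∫ a : A, starRingEnd ℂ (f₁ ((a : G) * bL A B g)) * f₂ ((a : G) * g) ∂(refMeasure k A)

/-- The coefficient of `Φ̂(φ, ψ)`. -/
theorem IsDoubleLieGroup.PhiHat_coeff {φ ψ : FrameField n G} (hφ : IsHomogeneous φ)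
    (hψ : IsHomogeneous ψ) (g : G) :
    PhiHat n k m A B φ ψ g (lFrame n m B g) (rFrame n m B g) =
      (((baseDet n k m A B ^ 2 / (modA n k A B g * modG n (bL A B g : G))) ^ (1 / 2 : ℝ) : ℝ) : ℂ) *
        corr k A B (coeff n φ) (coeff n ψ) g := by
  have h1 : (fun a : A => PhiDensity n k m A B (conjPushB n A B φ) ψ g (lFrame n m B g)
      (rFrame n m B g) a (leftFrame k a)) = _ := funext fun a => h.PhiDensity_eval hφ hψ g a
  rw [PhiHat, Phi, densityIntegral, h1, integral_const_mul, corr, ← mul_assoc]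
  congr 1
  have p1 := h.baseDet_pos
  have p2 := modG_pos (n := n) g
  have p3 := h.modA_pos g
  have p4 := h.modB_pos g
  have p5 := modG_pos (n := n) (bL A B g : G)
  have p6 := h.modA_pos g⁻¹
  have p7 := modG_pos (n := n) (bL A B g : G)⁻¹
  rw [← Complex.ofReal_mul, ← Complex.ofReal_mul, ← Real.mul_rpow (by positivity) (by positivity),
    ← Real.mul_rpow (by positivity) (by positivity)]
  congr 2
  -- The complementary minor formula makes the weight `modA g⁻¹` coming from ψ cancel the factor
  -- `modG g / modB g` of `|Q g|`.
  rw [h.abs_Q, h.modB_eq, modG_inv]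
  field_simp

end PhiHomogeneity

end

end DLG

namespace DLG

set_option linter.unusedSectionVars false

noncomputable section

/-! ### The involution, the coinverse and the identity for κ -/

section Involutions

variable {n k m : ℕ} {G : Type*} [Group G] [TopologicalSpace G] [ChartedSpace (E n) G]
  [LieGroup (𝓡 n) ∞ G]
  {A B : Subgroup G} [ChartedSpace (E k) A] [LieGroup (𝓡 k) ∞ A]
  [ChartedSpace (E m) B] [LieGroup (𝓡 m) ∞ B] [SecondCountableTopology G]
  (h : IsDoubleLieGroup n k m A B)
include h

theorem IsDoubleLieGroup.mdiff_left_fibre (g : G) :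
    MDifferentiable (𝓡 m) (𝓡 n) (fun s : B => g * (s : G)) :=
  (mdiff_mul_left g).comp h.mdiff_right

theorem IsDoubleLieGroup.mdiff_right_fibre (g : G) :
    MDifferentiable (𝓡 m) (𝓡 n) (fun s : B => (s : G) * g) :=
  (mdiff_mul_right g).comp h.mdiff_right

/-- The derivative of a map of `G` which restricts to a map `s ↦ g' * f s` on a left fibre. -/
theorem IsDoubleLieGroup.td_subLeft {F : G → G} (hF : MDifferentiable (𝓡 n) (𝓡 n) F) (g : G)
    (X : E m) : td (𝓡 n) (𝓡 n) F g (subLeft n m B g X) =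
      td (𝓡 m) (𝓡 n) (fun s : B => F (g * s)) 1 X := by
  rw [td_comp_of_eq (g := F) (f := fun s : B => g * (s : G)) (y := g) (by simp) (hF g)
    (h.mdiff_left_fibre g 1)]
  rfl

theorem IsDoubleLieGroup.td_subRight {F : G → G} (hF : MDifferentiable (𝓡 n) (𝓡 n) F) (g : G)
    (X : E m) : td (𝓡 n) (𝓡 n) F g (subRight n m B g X) =
      td (𝓡 m) (𝓡 n) (fun s : B => F ((s : G) * g)) 1 X := by
  rw [td_comp_of_eq (g := F) (f := fun s : B => (s : G) * g) (y := g) (by simp) (hF g)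
    (h.mdiff_right_fibre g 1)]
  rfl

theorem IsDoubleLieGroup.td_mul_left_map (g : G) {f : B → B} (hf : MDifferentiable (𝓡 m) (𝓡 m) f)
    (hf1 : f 1 = 1) (X : E m) : td (𝓡 m) (𝓡 n) (fun s : B => g * (f s : G)) 1 X =
      subLeft n m B g (td (𝓡 m) (𝓡 m) f 1 X) := by
  rw [td_comp_of_eq (g := fun s : B => g * (s : G)) (f := f) (y := 1) hf1
    (h.mdiff_left_fibre g 1) (hf 1)]
  rfl

theorem IsDoubleLieGroup.td_mul_right_map (g : G) {f : B → B} (hf : MDifferentiable (𝓡 m) (𝓡 m) f)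
    (hf1 : f 1 = 1) (X : E m) : td (𝓡 m) (𝓡 n) (fun s : B => (f s : G) * g) 1 X =
      subRight n m B g (td (𝓡 m) (𝓡 m) f 1 X) := by
  rw [td_comp_of_eq (g := fun s : B => (s : G) * g) (f := f) (y := 1) hf1
    (h.mdiff_right_fibre g 1) (hf 1)]
  rfl

/-- The `𝔟`-block of `Ad(c)`. -/
def adB (n m : ℕ) {G : Type*} [Group G] [TopologicalSpace G] [ChartedSpace (E n) G]
    (A B : Subgroup G) [ChartedSpace (E m) B] (c : G) : E m →L[ℝ] E m :=
  projB n m A B ∘L adj (𝓡 n) c ∘L incl n m B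

omit h in
theorem adet_adB (c : G) : adet (adB n m A B c) = modB n m A B c := rfl

theorem IsDoubleLieGroup.mdiff_bL_conj (c : G) :
    MDifferentiable (𝓡 m) (𝓡 m) (fun s : B => bL A B (c * (s : G) * c⁻¹)) :=
  h.mdiff_bL.comp ((mdiff_conj c).comp h.mdiff_right)

theorem IsDoubleLieGroup.mdiff_bR_conj (c : G) :
    MDifferentiable (𝓡 m) (𝓡 m) (fun s : B => bR A B (c * (s : G) * c⁻¹)) :=
  h.mdiff_bR.comp ((mdiff_conj c).comp h.mdiff_right)

theorem IsDoubleLieGroup.td_bR_conj' (c : G) :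
    td (𝓡 m) (𝓡 m) (fun s : B => bR A B (c * (s : G) * c⁻¹)) 1 = adB n m A B c := by
  have h1 : MDifferentiable (𝓡 m) (𝓡 n) (fun s : B => c * (s : G) * c⁻¹) :=
    (mdiff_conj c).comp h.mdiff_right
  rw [td_comp_of_eq (g := bR A B) (f := fun s : B => c * (s : G) * c⁻¹) (y := 1) (by simp)
      (h.mdiff_bR 1) (h1 1),
    td_conj_comp (h.mdiff_right 1) (OneMemClass.coe_one B)]
  rfl

theorem IsDoubleLieGroup.sA_eq (g : G) : sA A B g = (bL A B g : G)⁻¹ * aL A B g := by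
  rw [sA, mul_inv_eq_iff_eq_mul, mul_assoc, h.eq_aL_mul_bR, eq_inv_mul_iff_mul_eq, h.eq_bL_mul_aR]

/-- The groupoid inverse maps left fibres to right fibres. In this form its derivative along a left
fibre is visibly minus the 𝔟-block of `Ad (a_R(g))`; `sA_mul_left` does the same for right fibres,
with `Ad (a_L(g)⁻¹)`. -/
theorem IsDoubleLieGroup.sA_mul_right (g : G) (s : B) :
    sA A B (g * s) = (((bL A B ((aR A B g : G) * s * (aR A B g : G)⁻¹))⁻¹ : B) : G) * sA A B g := by
  rw [h.sA_eq, h.sA_eq, h.aL_mul_right, h.bL_mul_eq]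
  simp [mul_assoc]

theorem IsDoubleLieGroup.sA_mul_left (s : B) (g : G) :
    sA A B ((s : G) * g) = sA A B g *
      (((bR A B ((aL A B g : G)⁻¹ * s * ((aL A B g : G)⁻¹)⁻¹))⁻¹ : B) : G) := by
  rw [sA, sA, h.aR_mul_left, h.bR_mul_eq]
  simp [mul_assoc]

theorem IsDoubleLieGroup.td_sA_subLeft (g : G) (X : E m) :
    td (𝓡 n) (𝓡 n) (sA A B) g (subLeft n m B g X) =
      subRight n m B (sA A B g) ((-adB n m A B (aR A B g : G)) X) := by
  rw [h.td_subLeft h.mdiff_sA]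
  simp only [h.sA_mul_right]
  rw [h.td_mul_right_map _ (mdiff_inv_fun (h.mdiff_bL_conj _)) (by simp [h.bL_one]),
    td_inv_of_one (h.mdiff_bL_conj _) (by simp [h.bL_one]), h.td_bL_conj]
  rfl

theorem IsDoubleLieGroup.td_sA_subRight (g : G) (X : E m) :
    td (𝓡 n) (𝓡 n) (sA A B) g (subRight n m B g X) =
      subLeft n m B (sA A B g) ((-adB n m A B (aL A B g : G)⁻¹) X) := by
  rw [h.td_subRight h.mdiff_sA]
  simp only [h.sA_mul_left]
  rw [h.td_mul_left_map _ (mdiff_inv_fun (h.mdiff_bR_conj _)) (by simp [h.bR_one]),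
    td_inv_of_one (h.mdiff_bR_conj _) (by simp [h.bR_one]), h.td_bR_conj']

theorem IsDoubleLieGroup.td_inv_subLeft (g : G) (X : E m) :
    td (𝓡 n) (𝓡 n) (fun x : G => x⁻¹) g (subLeft n m B g X) =
      subRight n m B g⁻¹ ((-ContinuousLinearMap.id ℝ (E m)) X) := by
  rw [h.td_subLeft mdiff_inv]
  have h1 : (fun s : B => (g * (s : G))⁻¹) = fun s : B => ((s⁻¹ : B) : G) * g⁻¹ := by
    funext s; simp
  rw [h1, h.td_mul_right_map _ mdiff_inv inv_one, td_inv_of_one (f := fun s : B => s)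
    (mdifferentiable_id) rfl, td_id]

theorem IsDoubleLieGroup.td_inv_subRight (g : G) (X : E m) :
    td (𝓡 n) (𝓡 n) (fun x : G => x⁻¹) g (subRight n m B g X) =
      subLeft n m B g⁻¹ ((-ContinuousLinearMap.id ℝ (E m)) X) := by
  rw [h.td_subRight mdiff_inv]
  have h1 : (fun s : B => ((s : G) * g)⁻¹) = fun s : B => g⁻¹ * ((s⁻¹ : B) : G) := by
    funext s; simp
  rw [h1, h.td_mul_left_map _ mdiff_inv inv_one, td_inv_of_one (f := fun s : B => s)
    (mdifferentiable_id) rfl, td_id]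

theorem IsDoubleLieGroup.bistar_eval {Ω : BiField n m B} (hΩ : IsBihomogeneous Ω) (g : G)
    (v : Fin m → Tl n m B g) (w : Fin m → Tr n m B g) {X Y : Fin m → E m}
    (hX : ∀ i, (v i : TangentSpace (𝓡 n) g) = subLeft n m B g (X i))
    (hY : ∀ i, (w i : TangentSpace (𝓡 n) g) = subRight n m B g (Y i)) :
    bistar n m A B Ω g v w =
      (((modB n m A B (aL A B g : G)⁻¹ * |frameDet Y| * (modB n m A B (aR A B g : G) *
        |frameDet X|)) ^ (1 / 2 : ℝ) : ℝ) : ℂ) *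
        starRingEnd ℂ (Ω (sA A B g) (lFrame n m B (sA A B g)) (rFrame n m B (sA A B g))) := by
  have h1 : (fun i => (tmap n n (sA A B) g (w i) : TangentSpace (𝓡 n) (sA A B g))) =
      fun i => subLeft n m B (sA A B g) ((-adB n m A B (aL A B g : G)⁻¹) (Y i)) := funext fun i =>
    (congrArg (fun x => td (𝓡 n) (𝓡 n) (sA A B) g x) (hY i)).trans (h.td_sA_subRight g (Y i))
  have h2 : (fun i => (tmap n n (sA A B) g (v i) : TangentSpace (𝓡 n) (sA A B g))) =
      fun i => subRight n m B (sA A B g) ((-adB n m A B (aR A B g : G)) (X i)) := funext fun i =>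
    (congrArg (fun x => td (𝓡 n) (𝓡 n) (sA A B) g x) (hX i)).trans (h.td_sA_subLeft g (X i))
  rw [bistar, h1, h2, hΩ.app_sub, map_mul, Complex.conj_ofReal, abs_frameDet_map,
    abs_frameDet_map, adet_neg, adet_neg]
  rfl

theorem IsDoubleLieGroup.biR_eval {Ω : BiField n m B} (hΩ : IsBihomogeneous Ω) (g : G)
    (v : Fin m → Tl n m B g) (w : Fin m → Tr n m B g) {X Y : Fin m → E m}
    (hX : ∀ i, (v i : TangentSpace (𝓡 n) g) = subLeft n m B g (X i))
    (hY : ∀ i, (w i : TangentSpace (𝓡 n) g) = subRight n m B g (Y i)) :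
    biR n m B Ω g v w = (((|frameDet Y| * |frameDet X|) ^ (1 / 2 : ℝ) : ℝ) : ℂ) *
        Ω g⁻¹ (lFrame n m B g⁻¹) (rFrame n m B g⁻¹) := by
  have h1 : (fun i => (tmap n n (fun x : G => x⁻¹) g (w i) : TangentSpace (𝓡 n) g⁻¹)) =
      fun i => subLeft n m B g⁻¹ ((-ContinuousLinearMap.id ℝ (E m)) (Y i)) := funext fun i =>
    (congrArg (fun x => td (𝓡 n) (𝓡 n) (fun x : G => x⁻¹) g x) (hY i)).trans
      (h.td_inv_subRight g (Y i))
  have h2 : (fun i => (tmap n n (fun x : G => x⁻¹) g (v i) : TangentSpace (𝓡 n) g⁻¹)) =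
      fun i => subRight n m B g⁻¹ ((-ContinuousLinearMap.id ℝ (E m)) (X i)) := funext fun i =>
    (congrArg (fun x => td (𝓡 n) (𝓡 n) (fun x : G => x⁻¹) g x) (hX i)).trans
      (h.td_inv_subLeft g (X i))
  rw [biR, h1, h2, hΩ.app_sub, abs_frameDet_map, abs_frameDet_map, adet_neg, adet_id, one_mul,
    one_mul]

omit h in
theorem IsBihomogeneous.tau {Ω : BiField n m B} (hΩ : IsBihomogeneous Ω) (z : ℂ) :
    IsBihomogeneous (tau n k m A B z Ω) :=
  ⟨fun g M v w => by
    simp only [DLG.tau]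
    exact (congrArg (fun x => _ * x) (hΩ.left g M v w)).trans (mul_left_comm _ _ _),
   fun g M v w => by
    simp only [DLG.tau]
    exact (congrArg (fun x => _ * x) (hΩ.right g M v w)).trans (mul_left_comm _ _ _)⟩

omit h in
-- Since `I * (I / 2) = -1 / 2`, this scaling removes the factor `|Q|^{1/2}` built into Φ̂.
theorem tau_half (Ω : BiField n m B) (g : G)
    (v : Fin m → Tl n m B g) (w : Fin m → Tr n m B g) :
    tau n k m A B (Complex.I / 2) Ω g v w =
      (((|Q n k m A B g|) ^ (-(1 / 2) : ℝ) : ℝ) : ℂ) * Ω g v w := by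
  rw [tau, Complex.ofReal_cpow (abs_nonneg _)]
  congr 2
  rw [mul_div_assoc', Complex.I_mul_I]
  push_cast
  ring

variable [MeasurableSpace G] [BorelSpace G]

/-- Substitute a ↦ a a_R(g). As b_L(g⁻¹) = b_R(g)⁻¹, the argument of `f₁` becomes a s_A(g) and that
of `f₂` becomes a b_L(g)⁻¹ = a b_L(s_A(g)); the roles of the two functions are exchanged, at the
cost of the modular factor of `A`. -/
theorem IsDoubleLieGroup.corr_symm (f₁ f₂ : G → ℂ) (g : G) :
    corr k A B f₁ f₂ g⁻¹ * ((modA n k A B (aR A B g : G) : ℝ) : ℂ) =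
      starRingEnd ℂ (corr k A B f₂ f₁ (sA A B g)) := by
  have h1 := integral_refMeasure_mul_right (n := k) (aR A B g)
    (fun a : A => starRingEnd ℂ (f₁ ((a : G) * bL A B g⁻¹)) * f₂ ((a : G) * g⁻¹))
  rw [h.modA_coe, mul_comm, corr, ← h1, corr, ← integral_conj]
  refine integral_congr_ae (Filter.Eventually.of_forall fun a => ?_)
  have e1 : bL A B g⁻¹ = (bR A B g)⁻¹ := by rw [h.bL_eq, inv_inv]
  have e2 : bL A B (sA A B g) = (bL A B g)⁻¹ := by
    rw [h.sA_eq, ← InvMemClass.coe_inv, h.bL_mul]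
  have e3 : ((a * aR A B g : A) : G) * g⁻¹ = (a : G) * ((bL A B g)⁻¹ : B) := by
    rw [Subgroup.coe_mul, InvMemClass.coe_inv, mul_inv_eq_iff_eq_mul, mul_assoc, mul_right_inj,
      eq_inv_mul_iff_mul_eq, h.eq_bL_mul_aR]
  simp only
  rw [e1, e2, e3, map_mul, Complex.conj_conj, mul_comm, Subgroup.coe_mul, sA, ← mul_assoc,
    InvMemClass.coe_inv, InvMemClass.coe_inv]

/-- On any pair of frames both sides are a positive weight times the same correlation integral, by
`corr_symm`. What remains is the equality `key` of weights. -/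
theorem IsDoubleLieGroup.kappa_PhiHat {φ ψ : FrameField n G} (hφ : IsHomogeneous φ)
    (hψ : IsHomogeneous ψ) : kappa n k m A B (PhiHat n k m A B φ ψ) =
      bistar n m A B (PhiHat n k m A B ψ φ) := by
  have b1 := h.isBihomogeneous_PhiHat hφ hψ
  have b2 := h.isBihomogeneous_PhiHat hψ hφ
  funext g v w
  obtain ⟨X, hX⟩ := Tl.exists_frame v
  obtain ⟨Y, hY⟩ := Tr.exists_frame w
  rw [kappa, h.biR_eval (b1.tau _) g v w hX hY, h.bistar_eval b2 g v w hX hY, tau_half,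
    h.PhiHat_coeff hφ hψ, h.PhiHat_coeff hψ hφ, map_mul, Complex.conj_ofReal, ← h.corr_symm]
  have key : (|frameDet Y| * |frameDet X|) ^ (1 / 2 : ℝ) * (|Q n k m A B g⁻¹| ^ (-(1 / 2) : ℝ) *
      (baseDet n k m A B ^ 2 / (modA n k A B g⁻¹ * modG n (bL A B g⁻¹ : G))) ^ (1 / 2 : ℝ)) =
      (modB n m A B (aL A B g : G)⁻¹ * |frameDet Y| * (modB n m A B (aR A B g : G) *
        |frameDet X|)) ^ (1 / 2 : ℝ) * ((baseDet n k m A B ^ 2 / (modA n k A B (sA A B g) *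
          modG n (bL A B (sA A B g) : G))) ^ (1 / 2 : ℝ) * modA n k A B (aR A B g : G)) := by
    have p0 := h.abs_Q_pos g⁻¹
    have p1 := h.baseDet_pos
    have p2 := h.modA_pos
    have p3 := h.modB_pos
    have p4 := fun x : G => modG_pos (n := n) x
    have q1 := p2 g
    -- The factor from the substitution stands outside the roots; writing it as the root of its
    -- square reduces `key` to a rational identity in values of `modA`, `modB` and `modG`.
    have hsq : modA n k A B (aR A B g : G) = (modA n k A B (aR A B g : G) ^ 2) ^ (1 / 2 : ℝ) := by
      rw [← Real.sqrt_eq_rpow, Real.sqrt_sq (p2 _).le]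
    rw [hsq, Real.rpow_neg p0.le, ← Real.inv_rpow p0.le]
    have r1 := p2 g⁻¹
    have r2 := p4 (bL A B g⁻¹ : G)
    have r3 := p3 (aL A B g : G)⁻¹
    have r4 := p3 (aR A B g : G)
    have r5 := p2 (sA A B g)
    have r6 := p4 (bL A B (sA A B g) : G)
    have r7 := p2 (aR A B g : G)
    rw [← Real.mul_rpow (by positivity) (by positivity),
      ← Real.mul_rpow (by positivity) (by positivity),
      ← Real.mul_rpow (by positivity) (by positivity),
      ← Real.mul_rpow (by positivity) (by positivity)]
    congr 1
    have e1 : bL A B g⁻¹ = (bR A B g)⁻¹ := by rw [h.bL_eq, inv_inv]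
    have e2 : bL A B (sA A B g) = (bL A B g)⁻¹ := by
      rw [h.sA_eq, ← InvMemClass.coe_inv, h.bL_mul]
    have e3 : modB n m A B (aL A B g : G)⁻¹ = (modB n m A B (aL A B g : G))⁻¹ := by
      rw [← InvMemClass.coe_inv]
      refine eq_inv_of_mul_eq_one_left ?_
      rw [← h.modB_mul_left, InvMemClass.coe_inv, inv_mul_cancel, h.modB_eq, inv_one, modG_one,
        one_mul, ← OneMemClass.coe_one A, h.modA_coe, modG_one]
    have e4 : modA n k A B (sA A B g) = modA n k A B (aL A B g : G) / modA n k A B (bL A B g : G) := by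
      rw [eq_div_iff (p2 _).ne', mul_comm, ← h.modA_mul_left, h.sA_eq, mul_inv_cancel_left]
    -- Passing to `g⁻¹` exchanges the two minors up to factors `modG`, so `|Q|` is invariant under
    -- inversion.
    have e5 : |Q n k m A B g⁻¹| = |Q n k m A B g| := by
      rw [h.abs_Q, h.abs_Q, h.modA_eq g, h.modB_eq g, h.modA_eq g⁻¹, inv_inv, modG_inv]
      have := p4 g
      have := p3 g
      have := p3 g⁻¹
      have := p2 g⁻¹
      field_simp
    have m1 := h.modG_coe_left (aL A B g)
    have m2 := h.modG_coe_right (bR A B g)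
    have m3 := h.modG_coe_left (aR A B g)
    have m4 := h.modG_coe_right (bL A B g)
    have m5 : modG n g = modG n (aL A B g : G) * modG n (bR A B g : G) := by
      rw [← modG_mul, h.eq_aL_mul_bR]
    have m6 : modG n g = modG n (bL A B g : G) * modG n (aR A B g : G) := by
      rw [← modG_mul, h.eq_bL_mul_aR]
    have m7 := h.modA_eq_fac g
    have m8 := h.modB_eq_fac g
    have m9 : modA n k A B g⁻¹ = modB n m A B g / modG n g := by
      rw [h.modB_eq g, mul_div_cancel_left₀ _ (p4 g).ne']
    rw [e1, e2, e3, e4, e5, m9, InvMemClass.coe_inv, InvMemClass.coe_inv, modG_inv, modG_inv,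
      h.abs_Q, m7, m8, m5, m4, m1, m2]
    have s1 := p2 (aL A B g : G)
    have s2 := p2 (bL A B g : G)
    have s3 := p2 (bR A B g : G)
    have s4 := p3 (aL A B g : G)
    have s5 := p3 (bL A B g : G)
    have s6 := p3 (bR A B g : G)
    -- The only relation left: `modG g` computed from g = a_L b_R and from g = b_L a_R.
    have m10 : modA n k A B (aL A B g : G) * modB n m A B (aL A B g : G) *
      (modA n k A B (bR A B g : G) * modB n m A B (bR A B g : G)) =
      modA n k A B (bL A B g : G) * modB n m A B (bL A B g : G) *
      (modA n k A B (aR A B g : G) * modB n m A B (aR A B g : G)) := by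
      rw [← m1, ← m2, ← m3, ← m4, ← m5, ← m6]
    field_simp
    linear_combination |frameDet Y| * |frameDet X| * m10
  have key' := congrArg (fun x : ℝ => (x : ℂ)) key
  push_cast only [Complex.ofReal_mul] at key'
  linear_combination corr k A B (coeff n φ) (coeff n ψ) g⁻¹ * key'

end Involutions

end

end DLG

namespace DLG

set_option linter.unusedSectionVars false

noncomputable section

/-! ### The identity representation in coefficients -/

section IdentityRepresentation

variable {n k m : ℕ} {G : Type*} [Group G] [TopologicalSpace G] [ChartedSpace (E n) G]
  [LieGroup (𝓡 n) ∞ G]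
  {A B : Subgroup G} [ChartedSpace (E k) A] [LieGroup (𝓡 k) ∞ A]
  [ChartedSpace (E m) B] [LieGroup (𝓡 m) ∞ B] [SecondCountableTopology G]
  (h : IsDoubleLieGroup n k m A B)
include h

theorem IsDoubleLieGroup.mA_sA (x z : G) : mA A B (sA A B x) z = (bL A B x : G)⁻¹ * z := by
  rw [mA, h.sA_eq, ← InvMemClass.coe_inv, h.bL_mul]

/-- For x = zb and y = s_A(x) z this says z y⁻¹ = x in the groupoid. Right translation by y⁻¹ hence
carries the frame (Y_i z) of the right fibre at z to the frame (Y_i x) at x. -/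
theorem IsDoubleLieGroup.bL_mul_sA (z : G) (b : B) :
    (bL A B z : G) * sA A B ((bL A B (z * b) : G)⁻¹ * z) = z * b := by
  have h1 : (bL A B (z * b) : G)⁻¹ * z = (aR A B (z * b) : G) * ((b⁻¹ : B) : G) := by
    rw [inv_mul_eq_iff_eq_mul, ← mul_assoc, h.eq_bL_mul_aR]; simp
  rw [h.sA_eq, ← InvMemClass.coe_inv (bL A B (z * b)), h.bL_mul_left, InvMemClass.coe_inv, h1,
    h.aL_mul, Subgroup.coe_mul, InvMemClass.coe_inv, mul_inv_rev, inv_inv, mul_assoc (_)⁻¹,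
    mul_inv_cancel_left, h.eq_bL_mul_aR]

theorem IsDoubleLieGroup.mdiff_mA (w : G) : MDifferentiable (𝓡 n) (𝓡 n) (fun z => mA A B z w) :=
  (mdiff_mul_right w).comp (h.mdiff_right.comp h.mdiff_bL)

/-- All frames are fixed ones except the one in the argument of Ψ. With c = a_R(zb), its vectors
read at y by left translation are `-Ad y⁻¹ P_B Ad c Y` on 𝔟 and X on 𝔞, a triangular frame. -/
theorem IsDoubleLieGroup.piDensity_eval {Ω : BiField n m B} (hΩ : IsBihomogeneous Ω)
    {Ψ : FrameField n G} (hΨ : IsHomogeneous Ψ) (z : G) (b : B) :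
    piDensity n k m A B Ω Ψ z b (leftFrame m b) =
      Ω (z * b) (lFrame n m B (z * b)) (rFrame n m B (z * b)) *
        ((((baseDet n k m A B * modB n m A B z⁻¹ * (modB n m A B (bL A B (z * b) : G) *
          modB n m A B (aR A B (z * b) : G))) ^ (1 / 2 : ℝ) : ℝ) : ℂ) *
        coeff n Ψ ((bL A B (z * b) : G)⁻¹ * z)) := by
  set y : G := (bL A B (z * b) : G)⁻¹ * z with hy
  set c : G := (aR A B (z * b) : G) with hc
  have hy' : mA A B (sA A B (z * b)) z = y := h.mA_sA _ _
  have v_eq : (fun i => (tmap m n (fun b' : B => z * (b' : G)) b (leftFrame m b i) : E n)) =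
      fun i => subLeft n m B (z * b) (stdVec m i) := by
    funext i
    have h1 : (fun s : B => z * (b : G) * (s : G)) = fun s : B => z * ((b * s : B) : G) := by
      funext s; simp [mul_assoc]
    have h2 : td (𝓡 m) (𝓡 n) (fun s : B => z * (b : G) * (s : G)) 1 (stdVec m i) =
        td (𝓡 m) (𝓡 n) (fun b' : B => z * (b' : G)) b
          (td (𝓡 m) (𝓡 m) (fun s : B => b * s) 1 (stdVec m i)) := by
      rw [h1, td_comp_of_eq (g := fun s : B => z * (s : G)) (f := fun s : B => b * s) (y := b)
        (by simp) (h.mdiff_left_fibre z b) (mdiff_mul_left b 1)]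
      rfl
    exact h2.symm
  have ry_eq : (fun i => (tmap n n (fun z' : G => mA A B z' (sA A B y)) z
      (rFrame n m B z i) : E n)) = fun i => subRight n m B (z * b) (stdVec m i) := by
    funext i
    have h1 := h.td_subRight (h.mdiff_mA (sA A B y)) z (stdVec m i)
    have h2 : (fun s : B => mA A B ((s : G) * z) (sA A B y)) = fun s : B => (s : G) * (z * b) := by
      funext s
      rw [mA, h.bL_mul_left, Subgroup.coe_mul, mul_assoc, h.bL_mul_sA]
    rw [h2] at h1
    exact h1
  have vz_eq : (fun i => (tmap n n (fun x' : G => mA A B (sA A B x') z) (z * b)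
      (subLeft n m B (z * b) (stdVec m i)) : E n)) = fun i => td (𝓡 m) (𝓡 n)
        (fun s : B => (((bL A B (c * (s : G) * c⁻¹))⁻¹ : B) : G) * y) 1 (stdVec m i) := by
    funext i
    have h1 := h.td_subLeft (F := fun x' : G => mA A B (sA A B x') z)
      ((h.mdiff_mA z).comp h.mdiff_sA) (z * b) (stdVec m i)
    have h2 : (fun s : B => mA A B (sA A B (z * b * s)) z) =
        fun s : B => (((bL A B (c * (s : G) * c⁻¹))⁻¹ : B) : G) * y := by
      funext s
      rw [h.mA_sA, h.bL_mul_eq, hy]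
      simp [mul_assoc, hc]
    rw [h2] at h1
    exact h1
  have d1 : MDifferentiable (𝓡 m) (𝓡 n)
      (fun s : B => (((bL A B (c * (s : G) * c⁻¹))⁻¹ : B) : G)) :=
    h.mdiff_right.comp (mdiff_inv_fun (h.mdiff_bL_conj c))
  have d1' : MDifferentiable (𝓡 m) (𝓡 n)
      (fun s : B => (((bL A B (c * (s : G) * c⁻¹))⁻¹ : B) : G) * y) := (mdiff_mul_right y).comp d1
  have d2 : MDifferentiable (𝓡 k) (𝓡 n) (fun a : A => y * (a : G)) :=
    (mdiff_mul_left y).comp h.mdiff_left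
  have t1 : td (𝓡 m) (𝓡 n) (fun s : B => y⁻¹ * ((((bL A B (c * (s : G) * c⁻¹))⁻¹ : B) : G) * y)) 1 =
      adj (𝓡 n) y⁻¹ ∘L incl n m B ∘L (-adB n m A B c) := by
    have h1 : (fun s : B => y⁻¹ * ((((bL A B (c * (s : G) * c⁻¹))⁻¹ : B) : G) * y)) =
        fun s : B => y⁻¹ * (((bL A B (c * (s : G) * c⁻¹))⁻¹ : B) : G) * (y⁻¹)⁻¹ := by
      funext s; rw [inv_inv, ← mul_assoc]
    rw [h1, td_conj_comp (d1 1) (by simp [h.bL_one]),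
      td_comp_of_eq (g := (Subtype.val : B → G)) (f := fun s : B => (bL A B (c * (s : G) * c⁻¹))⁻¹)
        (y := 1) (by simp [h.bL_one]) (h.mdiff_right 1) (mdiff_inv_fun (h.mdiff_bL_conj c) 1),
      td_inv_of_one (h.mdiff_bL_conj _) (by simp [h.bL_one]), h.td_bL_conj]
    rfl
  have t2 : td (𝓡 k) (𝓡 n) (fun a : A => y⁻¹ * (y * (a : G))) 1 = incl n k A := by
    simp only [inv_mul_cancel_left]; rfl
  have key := h.eval_sum hΨ (d1' 1) (d2 1) (by simp [h.bL_one]) (by simp) t1 t2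
  -- Here y⁻¹ = z⁻¹ b_L(zb), and `modB` is multiplicative under `B` on the right.
  have hdet : adet ((adj (𝓡 n) y⁻¹ ∘L incl n m B ∘L (-adB n m A B c)) ∘L projB n m A B +
      incl n k A ∘L projA n k A B) =
      modB n m A B z⁻¹ * (modB n m A B (bL A B (z * b) : G) * modB n m A B c) := by
    rw [h.adet_of_upper]
    · have x1 : projA n k A B ∘L ((adj (𝓡 n) y⁻¹ ∘L incl n m B ∘L (-adB n m A B c)) ∘L
          projB n m A B + incl n k A ∘L projA n k A B) ∘L incl n k A =
          ContinuousLinearMap.id ℝ (E k) := by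
        ext1 v; simp [h.projA_inclA, h.projB_inclA]
      have x2 : projB n m A B ∘L ((adj (𝓡 n) y⁻¹ ∘L incl n m B ∘L (-adB n m A B c)) ∘L
          projB n m A B + incl n k A ∘L projA n k A B) ∘L incl n m B =
          adB n m A B y⁻¹ ∘L (-adB n m A B c) := by
        ext1 v; simp [h.projA_inclB, h.projB_inclB, adB]
      rw [x1, x2, adet_id, one_mul, adet_comp, adet_neg, adet_adB, adet_adB, ← mul_assoc, hy,
        mul_inv_rev, inv_inv, h.modB_mul_right]
    · ext1 v; simp [h.projA_inclA, h.projB_inclA]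
  rw [hdet, ← mul_assoc] at key
  have happ := hΩ.app_sub (z * (b : G)) (stdVec m) (stdVec m)
  rw [frameDet_stdVec, abs_one, one_mul, Real.one_rpow, Complex.ofReal_one, one_mul] at happ
  have step : piDensity n k m A B Ω Ψ z b (leftFrame m b) =
      Ω.app (z * b) (fun i => (tmap m n (fun b' : B => z * (b' : G)) b (leftFrame m b i) : E n))
        (fun i => (tmap n n (fun z' : G => mA A B z' (sA A B (mA A B (sA A B (z * b)) z))) z
          (rFrame n m B z i) : E n)) *
      Ψ (mA A B (sA A B (z * b)) z) (asFin n (Sum.elim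
        (fun i => (tmap n n (fun x' : G => mA A B (sA A B x') z) (z * b)
          ((fun i => (tmap m n (fun b' : B => z * (b' : G)) b (leftFrame m b i) : E n)) i) : E n))
        (fun j => (subLeft n k A (mA A B (sA A B (z * b)) z) (stdVec k j) : E n)))) := rfl
  rw [step, hy', v_eq, ry_eq]
  refine (congrArg₂ (fun p q => p * q) happ ?_)
  refine Eq.trans ?_ key
  exact congrArg (fun q => Ψ y (asFin n (Sum.elim q
    (fun j => (subLeft n k A y (stdVec k j) : E n))))) vz_eq

theorem IsDoubleLieGroup.abs_frameDet_adaptedFrame (z : G) :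
    |frameDet (fun i => (adaptedFrame n k m A B z i : E n))| =
      adet (td (𝓡 n) (𝓡 n) (fun y : G => z * y) 1) *
        (baseDet n k m A B * modB n m A B z⁻¹) := by
  have d2 : MDifferentiable (𝓡 k) (𝓡 n) (fun a : A => z * (a : G)) :=
    (mdiff_mul_left z).comp h.mdiff_left
  have h1 := h.sum_frame_eq (g := z) (h.mdiff_right_fibre z 1) (d2 1) (by simp) (by simp)
  have t1 : td (𝓡 m) (𝓡 n) (fun s : B => z⁻¹ * ((s : G) * z)) 1 =
      adj (𝓡 n) z⁻¹ ∘L incl n m B := by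
    have : (fun s : B => z⁻¹ * ((s : G) * z)) = fun s : B => z⁻¹ * (s : G) * (z⁻¹)⁻¹ := by
      funext s; rw [inv_inv, mul_assoc]
    rw [this, td_conj_comp (h.mdiff_right 1) (OneMemClass.coe_one B)]
    rfl
  have t2 : td (𝓡 k) (𝓡 n) (fun a : A => z⁻¹ * (z * (a : G))) 1 = incl n k A := by
    simp only [inv_mul_cancel_left]; rfl
  rw [t1, t2] at h1
  have h2 : (fun i => (adaptedFrame n k m A B z i : E n)) = _ := h1
  rw [h2, abs_frameDet_map]
  congr 1
  rw [h.abs_frameDet_sum, h.adet_of_upper]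
  · have x1 : projA n k A B ∘L ((adj (𝓡 n) z⁻¹ ∘L incl n m B) ∘L
        projB n m A B + incl n k A ∘L projA n k A B) ∘L incl n k A =
        ContinuousLinearMap.id ℝ (E k) := by
      ext1 v; simp [h.projA_inclA, h.projB_inclA]
    have x2 : projB n m A B ∘L ((adj (𝓡 n) z⁻¹ ∘L incl n m B) ∘L
        projB n m A B + incl n k A ∘L projA n k A B) ∘L incl n m B = adB n m A B z⁻¹ := by
      ext1 v; simp [h.projA_inclB, h.projB_inclB, adB]
    rw [x1, x2, adet_id, one_mul, adet_adB]
  · ext1 v; simp [h.projA_inclA, h.projB_inclA]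

omit h in
theorem abs_frameDet_leftFrame (z : G) :
    |frameDet (fun i => (leftFrame n z i : E n))| = adet (td (𝓡 n) (𝓡 n) (fun y : G => z * y) 1) := by
  have h1 := abs_frameDet_map (td (𝓡 n) (𝓡 n) (fun y : G => z * y) 1) (stdVec n)
  rw [frameDet_stdVec, abs_one, mul_one] at h1
  exact h1

variable [MeasurableSpace G] [BorelSpace G]

/-- The coefficient of `π_id(Ω) Ψ`. -/
theorem IsDoubleLieGroup.piId_coeff {Ω : BiField n m B} (hΩ : IsBihomogeneous Ω)
    {Ψ : FrameField n G} (hΨ : IsHomogeneous Ψ) (z : G) :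
    coeff n (piId n k m A B Ω Ψ) z =
      ∫ b : B, Ω (z * b) (lFrame n m B (z * b)) (rFrame n m B (z * b)) *
        ((((modB n m A B (bL A B (z * b) : G) *
          modB n m A B (aR A B (z * b) : G)) ^ (1 / 2 : ℝ) : ℝ) : ℂ) *
        coeff n Ψ ((bL A B (z * b) : G)⁻¹ * z)) ∂(refMeasure m B) := by
  have hJ : 0 < adet (td (𝓡 n) (𝓡 n) (fun y : G => z * y) 1) :=
    (adet_pos_of_comp (td_mul_left_inverse z)).2
  have hD := h.baseDet_pos
  have hz := h.modB_pos z⁻¹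
  rw [coeff, piId, ofFrame, densityIntegral, ← integral_const_mul]
  refine integral_congr_ae (Filter.Eventually.of_forall fun b => ?_)
  refine (congrArg (fun x => _ * x) (h.piDensity_eval hΩ hΨ z b)).trans ?_
  -- Passing from the adapted frame at z to the left-invariant one cancels the factor `baseDet *
  -- modB z⁻¹` of the integrand.
  have h1 : |frameDet (fun i => (leftFrame n z i : E n))| /
      |frameDet (fun i => (adaptedFrame n k m A B z i : E n))| =
      (baseDet n k m A B * modB n m A B z⁻¹)⁻¹ := by
    rw [abs_frameDet_leftFrame, h.abs_frameDet_adaptedFrame]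
    field_simp
  rw [h1]
  have p1 := h.modB_pos (bL A B (z * b) : G)
  have p2 := h.modB_pos (aR A B (z * b) : G)
  rw [Real.mul_rpow (x := baseDet n k m A B * modB n m A B z⁻¹) (by positivity) (by positivity),
    Complex.ofReal_mul, Real.inv_rpow (by positivity)]
  have h2 : (((baseDet n k m A B * modB n m A B z⁻¹) ^ (1 / 2 : ℝ) : ℝ) : ℂ) ≠ 0 :=
    Complex.ofReal_ne_zero.mpr (Real.rpow_pos_of_pos (by positivity) _).ne'
  rw [Complex.ofReal_inv]
  field_simp

end IdentityRepresentation

end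

end DLG

namespace DLG

set_option linter.unusedSectionVars false

noncomputable section

/-! ### Block triangular operators on a product -/

section BlockTriangular

variable {l l' : ℕ}

theorem toMatrix_prodBasis (L : E l × E l' →L[ℝ] E l × E l') :
    LinearMap.toMatrix ((EuclideanSpace.basisFun (Fin l) ℝ).toBasis.prod
        (EuclideanSpace.basisFun (Fin l') ℝ).toBasis)
      ((EuclideanSpace.basisFun (Fin l) ℝ).toBasis.prod
        (EuclideanSpace.basisFun (Fin l') ℝ).toBasis) (L : E l × E l' →ₗ[ℝ] E l × E l') =
    Matrix.fromBlocks
      (LinearMap.toMatrix (EuclideanSpace.basisFun (Fin l) ℝ).toBasis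
        (EuclideanSpace.basisFun (Fin l) ℝ).toBasis
        ((ContinuousLinearMap.fst ℝ _ _ ∘L L ∘L ContinuousLinearMap.inl ℝ _ _ :
          E l →L[ℝ] E l) : E l →ₗ[ℝ] E l))
      (LinearMap.toMatrix (EuclideanSpace.basisFun (Fin l') ℝ).toBasis
        (EuclideanSpace.basisFun (Fin l) ℝ).toBasis
        ((ContinuousLinearMap.fst ℝ _ _ ∘L L ∘L ContinuousLinearMap.inr ℝ _ _ :
          E l' →L[ℝ] E l) : E l' →ₗ[ℝ] E l))
      (LinearMap.toMatrix (EuclideanSpace.basisFun (Fin l) ℝ).toBasis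
        (EuclideanSpace.basisFun (Fin l') ℝ).toBasis
        ((ContinuousLinearMap.snd ℝ _ _ ∘L L ∘L ContinuousLinearMap.inl ℝ _ _ :
          E l →L[ℝ] E l') : E l →ₗ[ℝ] E l'))
      (LinearMap.toMatrix (EuclideanSpace.basisFun (Fin l') ℝ).toBasis
        (EuclideanSpace.basisFun (Fin l') ℝ).toBasis
        ((ContinuousLinearMap.snd ℝ _ _ ∘L L ∘L ContinuousLinearMap.inr ℝ _ _ :
          E l' →L[ℝ] E l') : E l' →ₗ[ℝ] E l')) := by
  ext i j
  rcases i with i | i <;> rcases j with j | j <;>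
    simp [LinearMap.toMatrix_apply]

theorem adet_of_snd_inl {L : E l × E l' →L[ℝ] E l × E l'} (hL : ContinuousLinearMap.snd ℝ _ _ ∘L L ∘L
    ContinuousLinearMap.inl ℝ _ _ = 0) : adet L =
      adet (ContinuousLinearMap.fst ℝ _ _ ∘L L ∘L ContinuousLinearMap.inl ℝ _ _) *
      adet (ContinuousLinearMap.snd ℝ _ _ ∘L L ∘L ContinuousLinearMap.inr ℝ _ _) := by
  have h1 := toMatrix_prodBasis L
  rw [hL, ContinuousLinearMap.toLinearMap_zero, map_zero] at h1
  rw [adet, ← LinearMap.det_toMatrix ((EuclideanSpace.basisFun (Fin l) ℝ).toBasis.prod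
        (EuclideanSpace.basisFun (Fin l') ℝ).toBasis), h1, Matrix.det_fromBlocks_zero₂₁,
    LinearMap.det_toMatrix, LinearMap.det_toMatrix, abs_mul]
  rfl

theorem adet_of_fst_inr {L : E l × E l' →L[ℝ] E l × E l'} (hL : ContinuousLinearMap.fst ℝ _ _ ∘L L ∘L
    ContinuousLinearMap.inr ℝ _ _ = 0) : adet L =
      adet (ContinuousLinearMap.fst ℝ _ _ ∘L L ∘L ContinuousLinearMap.inl ℝ _ _) *
      adet (ContinuousLinearMap.snd ℝ _ _ ∘L L ∘L ContinuousLinearMap.inr ℝ _ _) := by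
  have h1 := toMatrix_prodBasis L
  rw [hL, ContinuousLinearMap.toLinearMap_zero, map_zero] at h1
  rw [adet, ← LinearMap.det_toMatrix ((EuclideanSpace.basisFun (Fin l) ℝ).toBasis.prod
        (EuclideanSpace.basisFun (Fin l') ℝ).toBasis), h1, Matrix.det_fromBlocks_zero₁₂,
    LinearMap.det_toMatrix, LinearMap.det_toMatrix, abs_mul]
  rfl

end BlockTriangular

/-! ### The push-forward by W in coefficients -/

section PushForward

variable {n k m : ℕ} {G : Type*} [Group G] [TopologicalSpace G] [ChartedSpace (E n) G]
  [LieGroup (𝓡 n) ∞ G]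
  {A B : Subgroup G} [ChartedSpace (E k) A] [LieGroup (𝓡 k) ∞ A]
  [ChartedSpace (E m) B] [LieGroup (𝓡 m) ∞ B]

/-- The standard basis of `E n × E n`. -/
def stdVec₂ (n : ℕ) (i : Fin n ⊕ Fin n) : E n × E n :=
  Sum.elim (fun i => ((stdVec n i, 0) : E n × E n)) (fun i => ((0, stdVec n i) : E n × E n)) i

theorem stdVec₂_eq (i : Fin n ⊕ Fin n) : stdVec₂ n i =
    ((EuclideanSpace.basisFun (Fin n) ℝ).toBasis.prod
      (EuclideanSpace.basisFun (Fin n) ℝ).toBasis) i := by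
  rcases i with i | i <;> simp [stdVec₂, stdVec]

theorem mdiff_mul_left₂ (q : G × G) :
    MDifferentiable ((𝓡 n).prod (𝓡 n)) ((𝓡 n).prod (𝓡 n)) (fun x : G × G => q * x) := fun x =>
  ((mdiff_mul_left q.1 x.1).prodMap (mdiff_mul_left q.2 x.2))

theorem td_mul_left₂ (q : G × G) (v : E n × E n) :
    td ((𝓡 n).prod (𝓡 n)) ((𝓡 n).prod (𝓡 n)) (fun x : G × G => q * x) 1 v =
      (td (𝓡 n) (𝓡 n) (fun x => q.1 * x) 1 v.1, td (𝓡 n) (𝓡 n) (fun x => q.2 * x) 1 v.2) := by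
  have h1 : td ((𝓡 n).prod (𝓡 n)) ((𝓡 n).prod (𝓡 n))
      (Prod.map (fun x => q.1 * x) (fun x => q.2 * x)) (1 : G × G) = _ :=
    mfderiv_prodMap (p := (1 : G × G)) (mdiff_mul_left q.1 1) (mdiff_mul_left q.2 1)
  exact congrArg (fun L => L v) h1

theorem leftFrame₂_eq (p : G × G) (i : Fin n ⊕ Fin n) : (leftFrame₂ n p i : E n × E n) =
    td ((𝓡 n).prod (𝓡 n)) ((𝓡 n).prod (𝓡 n)) (fun x : G × G => p * x) 1 (stdVec₂ n i) := by
  rw [td_mul_left₂]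
  rcases i with i | i
  · exact Prod.ext rfl (map_zero (td (𝓡 n) (𝓡 n) (fun x => p.2 * x) 1)).symm
  · exact Prod.ext (map_zero (td (𝓡 n) (𝓡 n) (fun x => p.1 * x) 1)).symm rfl

/-- Homogeneity of degree one half, on `G × G`. -/
def IsHomogeneous₂ (Ψ : FrameField₂ n G) : Prop :=
  ∀ (p : G × G) (M : Matrix (Fin n ⊕ Fin n) (Fin n ⊕ Fin n) ℝ)
    (u : Fin n ⊕ Fin n → TangentSpace ((𝓡 n).prod (𝓡 n)) p),
    Ψ p (fun j => ∑ i, M i j • u i) = ((|M.det| ^ (1 / 2 : ℝ) : ℝ) : ℂ) * Ψ p u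

theorem IsHomogeneous₂.eval {Ψ : FrameField₂ n G} (hΨ : IsHomogeneous₂ Ψ) (q : G × G)
    (L : E n × E n →L[ℝ] E n × E n) :
    Ψ q (fun i => (td ((𝓡 n).prod (𝓡 n)) ((𝓡 n).prod (𝓡 n)) (fun x : G × G => q * x) 1
      (L (stdVec₂ n i)) : E n × E n)) =
      ((adet L ^ (1 / 2 : ℝ) : ℝ) : ℂ) * coeff₂ n Ψ q := by
  set b := (EuclideanSpace.basisFun (Fin n) ℝ).toBasis.prod
      (EuclideanSpace.basisFun (Fin n) ℝ).toBasis with hb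
  have h1 := hΨ q (LinearMap.toMatrix b b (L : E n × E n →ₗ[ℝ] E n × E n)) (leftFrame₂ n q)
  rw [LinearMap.det_toMatrix] at h1
  refine Eq.trans ?_ h1
  refine congrArg (Ψ q) (funext fun j => ?_)
  set T := td ((𝓡 n).prod (𝓡 n)) ((𝓡 n).prod (𝓡 n)) (fun x : G × G => q * x) 1 with hT
  have h2 : L (stdVec₂ n j) = ∑ i, LinearMap.toMatrix b b (L : E n × E n →ₗ[ℝ] E n × E n) i j •
      stdVec₂ n i := by
    conv_lhs => rw [← b.sum_repr (L (stdVec₂ n j))]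
    refine Finset.sum_congr rfl fun i _ => ?_
    rw [LinearMap.toMatrix_apply, stdVec₂_eq, stdVec₂_eq]
    rfl
  have h3 : T (L (stdVec₂ n j)) = ∑ i, LinearMap.toMatrix b b
      (L : E n × E n →ₗ[ℝ] E n × E n) i j • T (stdVec₂ n i) := by
    nth_rewrite 1 [h2]
    exact map_sum_smul (T : E n × E n →ₗ[ℝ] E n × E n) _ _
  refine h3.trans (Finset.sum_congr rfl fun i _ => ?_)
  rw [hT, ← leftFrame₂_eq]
  rfl

variable [SecondCountableTopology G]

/-- The value of the pull-back of a half-density by a map of `G × G`. -/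
theorem IsHomogeneous₂.eval_comp {Ψ : FrameField₂ n G} (hΨ : IsHomogeneous₂ Ψ) {F : G × G → G × G}
    (hF : MDifferentiable ((𝓡 n).prod (𝓡 n)) ((𝓡 n).prod (𝓡 n)) F) (p : G × G) :
    Ψ (F p) (fun i => mfderiv ((𝓡 n).prod (𝓡 n)) ((𝓡 n).prod (𝓡 n)) F p (leftFrame₂ n p i)) =
      ((adet (gd ((𝓡 n).prod (𝓡 n)) ((𝓡 n).prod (𝓡 n)) F p) ^ (1 / 2 : ℝ) : ℝ) : ℂ) *
        coeff₂ n Ψ (F p) := by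
  refine Eq.trans ?_ (hΨ.eval (F p) (gd ((𝓡 n).prod (𝓡 n)) ((𝓡 n).prod (𝓡 n)) F p))
  refine congrArg (Ψ (F p)) (funext fun i => ?_)
  have h1 : td ((𝓡 n).prod (𝓡 n)) ((𝓡 n).prod (𝓡 n)) (fun x => F (p * x)) 1 =
      td ((𝓡 n).prod (𝓡 n)) ((𝓡 n).prod (𝓡 n)) F p ∘L
        td ((𝓡 n).prod (𝓡 n)) ((𝓡 n).prod (𝓡 n)) (fun x => p * x) 1 :=
    td_comp_of_eq (g := F) (f := fun x => p * x) (mul_one p) (hF p) (mdiff_mul_left₂ p 1)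
  have d1 : MDifferentiable ((𝓡 n).prod (𝓡 n)) ((𝓡 n).prod (𝓡 n)) (fun x => (F p)⁻¹ * F (p * x)) :=
    (mdiff_mul_left₂ (F p)⁻¹).comp (hF.comp (mdiff_mul_left₂ p))
  have h2 : td ((𝓡 n).prod (𝓡 n)) ((𝓡 n).prod (𝓡 n)) (fun x => F p * ((F p)⁻¹ * F (p * x))) 1 =
      td ((𝓡 n).prod (𝓡 n)) ((𝓡 n).prod (𝓡 n)) (fun x => F p * x) 1 ∘L
        td ((𝓡 n).prod (𝓡 n)) ((𝓡 n).prod (𝓡 n)) (fun x => (F p)⁻¹ * F (p * x)) 1 :=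
    td_comp_of_eq (g := fun x => F p * x) (f := fun x => (F p)⁻¹ * F (p * x)) (by simp)
      (mdiff_mul_left₂ (F p) 1) (d1 1)
  simp only [mul_inv_cancel_left] at h2
  have h3 := congrArg (fun L => L (stdVec₂ n i)) (h1.symm.trans h2)
  refine Eq.trans ?_ h3
  exact congrArg (fun x => td ((𝓡 n).prod (𝓡 n)) ((𝓡 n).prod (𝓡 n)) F p x) (leftFrame₂_eq p i)

theorem td_apply_fst {F : G × G → G × G} {p : G × G}
    (hF : MDifferentiableAt ((𝓡 n).prod (𝓡 n)) ((𝓡 n).prod (𝓡 n)) F p) (v : E n × E n) :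
    (td ((𝓡 n).prod (𝓡 n)) ((𝓡 n).prod (𝓡 n)) F p v).1 =
      td (𝓡 n) (𝓡 n) (fun z => (F (z, p.2)).1) p.1 v.1 +
        td (𝓡 n) (𝓡 n) (fun z => (F (p.1, z)).1) p.2 v.2 := by
  have h1 : MDifferentiableAt ((𝓡 n).prod (𝓡 n)) (𝓡 n) (Prod.fst : G × G → G) (F p) :=
    mdifferentiableAt_fst
  have h2 := td_prod_apply (f := fun q => (F q).1) (h1.comp p hF) v
  rw [td_comp (g := Prod.fst) (f := F) h1 hF, td_fst] at h2
  exact h2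

theorem td_apply_snd {F : G × G → G × G} {p : G × G}
    (hF : MDifferentiableAt ((𝓡 n).prod (𝓡 n)) ((𝓡 n).prod (𝓡 n)) F p) (v : E n × E n) :
    (td ((𝓡 n).prod (𝓡 n)) ((𝓡 n).prod (𝓡 n)) F p v).2 =
      td (𝓡 n) (𝓡 n) (fun z => (F (z, p.2)).2) p.1 v.1 +
        td (𝓡 n) (𝓡 n) (fun z => (F (p.1, z)).2) p.2 v.2 := by
  have h1 : MDifferentiableAt ((𝓡 n).prod (𝓡 n)) (𝓡 n) (Prod.snd : G × G → G) (F p) :=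
    mdifferentiableAt_snd
  have h2 := td_prod_apply (f := fun q => (F q).2) (h1.comp p hF) v
  rw [td_comp (g := Prod.snd) (f := F) h1 hF, td_snd] at h2
  exact h2

theorem mdiff_fst_smul {u : G → G} (hu : MDifferentiable (𝓡 n) (𝓡 n) u) :
    MDifferentiable ((𝓡 n).prod (𝓡 n)) ((𝓡 n).prod (𝓡 n))
      (fun q : G × G => (q.1, u q.1 * q.2)) :=
  mdifferentiable_fst.prodMk (mdiff_mul_mul (hu.comp mdifferentiable_fst) mdifferentiable_snd)

theorem mdiff_smul_snd {u : G → G} (hu : MDifferentiable (𝓡 n) (𝓡 n) u) :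
    MDifferentiable ((𝓡 n).prod (𝓡 n)) ((𝓡 n).prod (𝓡 n))
      (fun q : G × G => (q.1 * u q.2, q.2)) :=
  (mdiff_mul_mul mdifferentiable_fst (hu.comp mdifferentiable_snd)).prodMk mdifferentiable_snd

/-- The derivative is triangular with identity diagonal blocks: for a fixed first variable the
second is moved by a left translation, invisible in the left trivialisation. -/
theorem adet_gd_of_fst {u : G → G} (hu : MDifferentiable (𝓡 n) (𝓡 n) u) (p : G × G) :
    adet (gd ((𝓡 n).prod (𝓡 n)) ((𝓡 n).prod (𝓡 n)) (fun q : G × G => (q.1, u q.1 * q.2)) p) = 1 := by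
  set F : G × G → G × G := fun q : G × G => (q.1, u q.1 * q.2) with hF
  have d : MDifferentiable ((𝓡 n).prod (𝓡 n)) ((𝓡 n).prod (𝓡 n)) (fun x => (F p)⁻¹ * F (p * x)) :=
    (mdiff_mul_left₂ (F p)⁻¹).comp ((mdiff_fst_smul hu).comp (mdiff_mul_left₂ p))
  have e1 : ∀ v, (gd ((𝓡 n).prod (𝓡 n)) ((𝓡 n).prod (𝓡 n)) F p v).1 = v.1 := fun v => by
    rw [gd, td_apply_fst (d 1)]
    simp [hF, td_id, td_const]
  have e2 : ∀ w, (gd ((𝓡 n).prod (𝓡 n)) ((𝓡 n).prod (𝓡 n)) F p (0, w)).2 = w := fun w => by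
    rw [gd, td_apply_snd (d 1)]
    simp [hF, td_id, mul_assoc]
  rw [adet_of_fst_inr (by ext1 w; exact e1 _)]
  have x1 : ContinuousLinearMap.fst ℝ _ _ ∘L gd ((𝓡 n).prod (𝓡 n)) ((𝓡 n).prod (𝓡 n)) F p ∘L
      ContinuousLinearMap.inl ℝ _ _ = ContinuousLinearMap.id ℝ (E n) := by
    ext1 v; exact e1 _
  have x2 : ContinuousLinearMap.snd ℝ _ _ ∘L gd ((𝓡 n).prod (𝓡 n)) ((𝓡 n).prod (𝓡 n)) F p ∘L
      ContinuousLinearMap.inr ℝ _ _ = ContinuousLinearMap.id ℝ (E n) := by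
    ext1 v; exact e2 _
  rw [x1, x2, adet_id, one_mul]

/-- Here the first variable is moved by a right translation, so one diagonal block is `Ad (u⁻¹)`. -/
theorem adet_gd_of_snd {u : G → G} (hu : MDifferentiable (𝓡 n) (𝓡 n) u) (p : G × G) :
    adet (gd ((𝓡 n).prod (𝓡 n)) ((𝓡 n).prod (𝓡 n)) (fun q : G × G => (q.1 * u q.2, q.2)) p) =
      modG n (u p.2)⁻¹ := by
  set F : G × G → G × G := fun q : G × G => (q.1 * u q.2, q.2) with hF
  have d : MDifferentiable ((𝓡 n).prod (𝓡 n)) ((𝓡 n).prod (𝓡 n)) (fun x => (F p)⁻¹ * F (p * x)) :=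
    (mdiff_mul_left₂ (F p)⁻¹).comp ((mdiff_smul_snd hu).comp (mdiff_mul_left₂ p))
  have e1 : ∀ v, (gd ((𝓡 n).prod (𝓡 n)) ((𝓡 n).prod (𝓡 n)) F p v).2 = v.2 := fun v => by
    rw [gd, td_apply_snd (d 1)]
    simp [hF, td_id, td_const]
  have e2 : ∀ w, (gd ((𝓡 n).prod (𝓡 n)) ((𝓡 n).prod (𝓡 n)) F p (w, 0)).1 =
      adj (𝓡 n) (u p.2)⁻¹ w := fun w => by
    rw [gd, td_apply_fst (d 1)]
    have : (fun z : G => ((F p)⁻¹ * F (p * (z, (1 : G × G).2))).1) =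
        fun z => (u p.2)⁻¹ * z * ((u p.2)⁻¹)⁻¹ := by
      funext z; simp [hF, mul_assoc]
    rw [this]
    simp [adj]
  rw [adet_of_snd_inl (by ext1 w; exact e1 _)]
  have x1 : ContinuousLinearMap.fst ℝ _ _ ∘L gd ((𝓡 n).prod (𝓡 n)) ((𝓡 n).prod (𝓡 n)) F p ∘L
      ContinuousLinearMap.inl ℝ _ _ = adj (𝓡 n) (u p.2)⁻¹ := by
    ext1 v; exact e2 _
  have x2 : ContinuousLinearMap.snd ℝ _ _ ∘L gd ((𝓡 n).prod (𝓡 n)) ((𝓡 n).prod (𝓡 n)) F p ∘L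
      ContinuousLinearMap.inr ℝ _ _ = ContinuousLinearMap.id ℝ (E n) := by
    ext1 v; exact e1 _
  rw [x1, x2, adet_id, mul_one]
  rfl

variable (h : IsDoubleLieGroup n k m A B)
include h

theorem IsDoubleLieGroup.mdiff_bR_inv :
    MDifferentiable (𝓡 n) (𝓡 n) (fun g : G => (bR A B g : G)⁻¹) :=
  mdiff_inv_fun (h.mdiff_right.comp h.mdiff_bR)

theorem IsDoubleLieGroup.mdiff_aL_coe :
    MDifferentiable (𝓡 n) (𝓡 n) (fun g : G => (aL A B g : G)) :=
  h.mdiff_left.comp h.mdiff_aL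

theorem IsDoubleLieGroup.mdiff_Winv :
    MDifferentiable ((𝓡 n).prod (𝓡 n)) ((𝓡 n).prod (𝓡 n)) (Winv A B) :=
  (mdiff_smul_snd h.mdiff_aL_coe).comp (mdiff_fst_smul h.mdiff_bR_inv)

/-- The inverse pentagonal map is the shear (s,t) ↦ (s, b_R(s)⁻¹t) followed by the shear (s,t) ↦ (s
a_L(t), t); only the second contributes. -/
theorem IsDoubleLieGroup.adet_gd_Winv (p : G × G) :
    adet (gd ((𝓡 n).prod (𝓡 n)) ((𝓡 n).prod (𝓡 n)) (Winv A B) p) =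
      modG n (aL A B ((bR A B p.1 : G)⁻¹ * p.2) : G)⁻¹ := by
  have h1 := gd_comp (mdiff_smul_snd h.mdiff_aL_coe) (mdiff_fst_smul h.mdiff_bR_inv) p
  have h2 : gd ((𝓡 n).prod (𝓡 n)) ((𝓡 n).prod (𝓡 n)) (Winv A B) p = _ := h1
  rw [h2, adet_comp, adet_gd_of_fst h.mdiff_bR_inv, adet_gd_of_snd h.mdiff_aL_coe, mul_one]

/-- The coefficient of the push-forward by `W`. -/
theorem IsDoubleLieGroup.pushW_coeff {Ψ : FrameField₂ n G} (hΨ : IsHomogeneous₂ Ψ) (p : G × G) :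
    coeff₂ n (pushW n A B Ψ) p =
      ((modG n (aL A B ((bR A B p.1 : G)⁻¹ * p.2) : G)⁻¹ ^ (1 / 2 : ℝ) : ℝ) : ℂ) *
        coeff₂ n Ψ (Winv A B p) := by
  rw [← h.adet_gd_Winv p]
  exact hΨ.eval_comp h.mdiff_Winv p

end PushForward

end

end DLG

namespace DLG

set_option linter.unusedSectionVars false

noncomputable section

/-! ### Product coordinates on G = AB -/

section ProductMeasure

/-- The decomposition of the coordinates of `E n` into two groups. -/
def splitCoord {n m k : ℕ} (e : Fin m ⊕ Fin k ≃ Fin n) : E n →ₗ[ℝ] E m × E k where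
  toFun y := (WithLp.toLp 2 fun i => y (e (Sum.inl i)), WithLp.toLp 2 fun j => y (e (Sum.inr j)))
  map_add' _ _ := rfl
  map_smul' _ _ := rfl

theorem measurePreserving_splitCoord {n m k : ℕ} (e : Fin m ⊕ Fin k ≃ Fin n) :
    MeasurePreserving (splitCoord e) (volume : Measure (E n))
      ((volume : Measure (E m)).prod (volume : Measure (E k))) := by
  have h1 := PiLp.volume_preserving_ofLp (ι := Fin n)
  have h2 := volume_measurePreserving_piCongrLeft (fun _ : Fin m ⊕ Fin k => ℝ) e.symm
  have h3 := volume_measurePreserving_sumPiEquivProdPi (fun _ : Fin m ⊕ Fin k => ℝ)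
  have h4 := (PiLp.volume_preserving_toLp (ι := Fin m)).prod
    (PiLp.volume_preserving_toLp (ι := Fin k))
  have h5 := h4.comp (h3.comp (h2.comp h1))
  suffices hf : ⇑(splitCoord e) = _ by rw [hf]; exact h5
  funext y
  refine Prod.ext ?_ ?_
  · ext i
    have := MeasurableEquiv.piCongrLeft_apply_apply (β := fun _ : Fin m ⊕ Fin k => ℝ) e.symm
      (WithLp.ofLp y) (e (Sum.inl i))
    rw [Equiv.symm_apply_apply] at this
    exact this.symm
  · ext i
    have := MeasurableEquiv.piCongrLeft_apply_apply (β := fun _ : Fin m ⊕ Fin k => ℝ) e.symm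
      (WithLp.ofLp y) (e (Sum.inr i))
    rw [Equiv.symm_apply_apply] at this
    exact this.symm

variable {n k m : ℕ} {G : Type*} [Group G] [TopologicalSpace G] [ChartedSpace (E n) G]
  [LieGroup (𝓡 n) ∞ G]
  {A B : Subgroup G} [ChartedSpace (E k) A] [LieGroup (𝓡 k) ∞ A]
  [ChartedSpace (E m) B] [LieGroup (𝓡 m) ∞ B] [SecondCountableTopology G]
  (h : IsDoubleLieGroup n k m A B)
include h

/-- After identifying `E m × E k` with `E n` by a reindexing of coordinates, which preserves volume,
the sum map is an endomorphism of `E n` sending the standard basis to the base frame; its absolute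
determinant is `baseDet`. -/
theorem IsDoubleLieGroup.map_sumEquiv :
    ((volume : Measure (E m)).prod (volume : Measure (E k))).map h.sumEquiv =
      ENNReal.ofReal (baseDet n k m A B)⁻¹ • (volume : Measure (E n)) := by
  set e := Fintype.equivFinOfCardEq h.card_sum with he
  have hm : Measurable h.sumEquiv :=
    (LinearMap.continuous_of_finiteDimensional (h.sumEquiv : E m × E k →ₗ[ℝ] E n)).measurable
  set T : E n →ₗ[ℝ] E n := (h.sumEquiv : E m × E k →ₗ[ℝ] E n) ∘ₗ splitCoord e with hT
  have hdet : |LinearMap.det T| = baseDet n k m A B := by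
    rw [← frameDet_map_stdVec, baseDet]
    congr 2
    funext i
    rw [h.asFin_eq, Function.comp_apply, ← he]
    obtain ⟨j, rfl⟩ := e.surjective i
    rw [Equiv.symm_apply_apply]
    rcases j with j | j
    · have : splitCoord e (stdVec n (e (Sum.inl j))) = (stdVec m j, 0) := by
        refine Prod.ext ?_ ?_
        · ext i
          show stdVec n (e (Sum.inl j)) (e (Sum.inl i)) = stdVec m j i
          simp [stdVec]
        · ext i
          show stdVec n (e (Sum.inl j)) (e (Sum.inr i)) = 0
          simp [stdVec]
      show h.sumEquiv (splitCoord e _) = _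
      rw [this]
      simp [IsDoubleLieGroup.sumEquiv, baseFrame]
    · have : splitCoord e (stdVec n (e (Sum.inr j))) = (0, stdVec k j) := by
        refine Prod.ext ?_ ?_
        · ext i
          show stdVec n (e (Sum.inr j)) (e (Sum.inl i)) = 0
          simp [stdVec]
        · ext i
          show stdVec n (e (Sum.inr j)) (e (Sum.inr i)) = stdVec k j i
          simp [stdVec]
      show h.sumEquiv (splitCoord e _) = _
      rw [this]
      simp [IsDoubleLieGroup.sumEquiv, baseFrame]
  have hne : LinearMap.det T ≠ 0 := by
    have := h.baseDet_pos
    rw [← hdet] at this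
    exact abs_pos.mp this
  rw [← (measurePreserving_splitCoord e).map_eq,
    Measure.map_map hm (measurePreserving_splitCoord e).measurable]
  have h1 := Measure.map_linearMap_addHaar_eq_smul_addHaar (volume : Measure (E n)) hne
  rw [abs_inv, hdet] at h1
  exact h1

/-- The product map as a homeomorphism. -/
def IsDoubleLieGroup.mulHomeo : G ≃ₜ B × A where
  toFun g := (bR A B g, aL A B g)
  invFun p := (p.2 : G) * (p.1 : G)
  left_inv g := h.eq_aL_mul_bR g
  right_inv p := Prod.ext (h.bR_mul p.2 p.1) (h.aL_mul p.2 p.1)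
  continuous_toFun := h.contMDiff_bR.continuous.prodMk h.contMDiff_aL.continuous
  continuous_invFun := h.contMDiff_mulAB.continuous.comp
    (continuous_snd.prodMk continuous_fst : Continuous fun p : B × A => (p.2, p.1))

/-- The coordinates of `𝔟 × 𝔞`. -/
def IsDoubleLieGroup.sumCLE : (E m × E k) ≃L[ℝ] E n := h.sumEquiv.toContinuousLinearEquiv

/-- Coordinates on `G` given by coordinates on `A` and `B`. -/
def IsDoubleLieGroup.prodCoord (b : B) (a : A) : OpenPartialHomeomorph G (E n) :=
  (h.mulHomeo.transOpenPartialHomeomorph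
    ((chartAt (E m) b).prod (chartAt (E k) a))).transHomeomorph h.sumCLE.toHomeomorph

theorem IsDoubleLieGroup.prodCoord_symm_apply (b : B) (a : A) (y : E n) :
    (h.prodCoord b a).symm y = ((chartAt (E k) a).symm (projA n k A B y) : G) *
      ((chartAt (E m) b).symm (projB n m A B y) : G) := rfl

-- The logarithmic derivative of a product: moving the increment of `f` to the right past `e` costs
-- a conjugation by `(e x)⁻¹`.
omit h in
theorem ltd_mul {V₀ H₀ M : Type*} [NormedAddCommGroup V₀] [NormedSpace ℝ V₀] [TopologicalSpace H₀]
    {I₀ : ModelWithCorners ℝ V₀ H₀} [TopologicalSpace M] [ChartedSpace H₀ M]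
    {f e : M → G} {x : M} (hf : MDifferentiableAt I₀ (𝓡 n) f x)
    (he : MDifferentiableAt I₀ (𝓡 n) e x) :
    ltd I₀ (𝓡 n) (fun y => f y * e y) x =
      adj (𝓡 n) (e x)⁻¹ ∘L ltd I₀ (𝓡 n) f x + ltd I₀ (𝓡 n) e x := by
  have h1 : (fun y => (f x * e x)⁻¹ * (f y * e y)) =
      fun y => ((e x)⁻¹ * ((f x)⁻¹ * f y) * ((e x)⁻¹)⁻¹) * ((e x)⁻¹ * e y) := by
    funext y; group
  have d1 : MDifferentiableAt I₀ (𝓡 n) (fun y => (f x)⁻¹ * f y) x := (mdiff_mul_left _ _).comp x hf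
  have d2 : MDifferentiableAt I₀ (𝓡 n) (fun y => (e x)⁻¹ * ((f x)⁻¹ * f y) * ((e x)⁻¹)⁻¹) x :=
    (mdiff_conj (e x)⁻¹ _).comp x d1
  have d3 : MDifferentiableAt I₀ (𝓡 n) (fun y => (e x)⁻¹ * e y) x := (mdiff_mul_left _ _).comp x he
  rw [ltd, h1, td_mul_of_one d2 d3 (by simp) (by simp), td_conj_comp d1 (by simp)]
  rfl

omit h in
theorem gd_subtype {l : ℕ} {S : Subgroup G} [ChartedSpace (E l) S] (s : S) :
    gd (𝓡 l) (𝓡 n) (Subtype.val : S → G) s = incl n l S := by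
  simp [gd, incl]

omit h in
theorem td_clm {V V' : Type*} [NormedAddCommGroup V] [NormedSpace ℝ V] [NormedAddCommGroup V']
    [NormedSpace ℝ V'] (L : V →L[ℝ] V') (x : V) :
    td (modelWithCornersSelf ℝ V) (modelWithCornersSelf ℝ V') (fun y => L y) x = L :=
  L.hasMFDerivAt.mfderiv

omit h in
theorem ltd_symm_comp {l : ℕ} {S : Subgroup G} [ChartedSpace (E l) S] [LieGroup (𝓡 l) ∞ S]
    (hS : MDifferentiable (𝓡 l) (𝓡 n) (Subtype.val : S → G)) {e : OpenPartialHomeomorph S (E l)}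
    (he : IsCoord e) (L : E n →L[ℝ] E l) {y : E n} (hy : L y ∈ e.target) :
    MDifferentiableAt (𝓡 n) (𝓡 n) (fun y => (e.symm (L y) : G)) y ∧
    ltd (𝓡 n) (𝓡 n) (fun y => (e.symm (L y) : G)) y =
      incl n l S ∘L ltd (𝓡 l) (𝓡 l) e.symm (L y) ∘L L := by
  have hL : MDifferentiableAt (𝓡 n) (𝓡 l) (fun y => L y) y := L.hasMFDerivAt.mdifferentiableAt
  have h1 : MDifferentiableAt (𝓡 n) (𝓡 l) (fun y => e.symm (L y)) y :=
    (he.mdiffAt_symm hy).comp y hL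
  refine ⟨(hS _).comp y h1, ?_⟩
  rw [ltd_comp (f := (Subtype.val : S → G)) hS h1, gd_subtype]
  congr 1
  rw [ltd, td_comp_of_eq (g := fun u => (e.symm (L y))⁻¹ * e.symm u) (f := fun y => L y) rfl
    ((mdiff_mul_left _ _).comp (L y) (he.mdiffAt_symm hy)) hL, td_clm]
  rfl

theorem IsDoubleLieGroup.mem_prodCoord_target {b : B} {a : A} {y : E n} :
    y ∈ (h.prodCoord b a).target ↔
      projB n m A B y ∈ (chartAt (E m) b).target ∧ projA n k A B y ∈ (chartAt (E k) a).target :=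
  Iff.rfl

/-- By the product rule the derivative of ab is `Ad b⁻¹` on the increment of a plus the increment of
b. It preserves 𝔟, so only the 𝔞-block of `Ad b⁻¹` is seen. -/
theorem IsDoubleLieGroup.coordDens_prodCoord {b : B} {a : A} {y : E n}
    (hy : y ∈ (h.prodCoord b a).target) : coordDens (h.prodCoord b a) y =
      modA n k A B ((chartAt (E m) b).symm (projB n m A B y) : G)⁻¹ *
        coordDens (chartAt (E k) a) (projA n k A B y) *
        coordDens (chartAt (E m) b) (projB n m A B y) := by
  obtain ⟨d1, e1⟩ := ltd_symm_comp h.mdiff_right (isCoord_chartAt b) _ hy.1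
  obtain ⟨d2, e2⟩ := ltd_symm_comp h.mdiff_left (isCoord_chartAt a) _ hy.2
  have h1 := ltd_mul d2 d1
  rw [e1, e2] at h1
  have h2 : coordDens (h.prodCoord b a) y = adet (ltd (𝓡 n) (𝓡 n) (fun y =>
    ((chartAt (E k) a).symm (projA n k A B y) : G) *
      ((chartAt (E m) b).symm (projB n m A B y) : G)) y) := rfl
  rw [h2, h1]
  set c : G := ((chartAt (E m) b).symm (projB n m A B y) : G)⁻¹ with hc
  set TA := ltd (𝓡 k) (𝓡 k) (chartAt (E k) a).symm (projA n k A B y) with hTA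
  set TB := ltd (𝓡 m) (𝓡 m) (chartAt (E m) b).symm (projB n m A B y) with hTB
  rw [h.adet_of_lower]
  · have x1 : projA n k A B ∘L (adj (𝓡 n) c ∘L incl n k A ∘L TA ∘L projA n k A B +
        incl n m B ∘L TB ∘L projB n m A B) ∘L incl n k A =
        (projA n k A B ∘L adj (𝓡 n) c ∘L incl n k A) ∘L TA := by
      ext1 v; simp [h.projA_inclA, h.projB_inclA]
    have x2 : projB n m A B ∘L (adj (𝓡 n) c ∘L incl n k A ∘L TA ∘L projA n k A B +
        incl n m B ∘L TB ∘L projB n m A B) ∘L incl n m B = TB := by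
      ext1 v; simp [h.projA_inclB, h.projB_inclB]
    rw [x1, x2, adet_comp]
    rfl
  · ext1 v; simp [h.projA_inclB, h.projB_inclB]

theorem IsDoubleLieGroup.isCoord_prodCoord (b : B) (a : A) : IsCoord (h.prodCoord b a) := by
  constructor
  · intro g hg
    have hg1 : bR A B g ∈ (chartAt (E m) b).source := hg.1
    have hg2 : aL A B g ∈ (chartAt (E k) a).source := hg.2
    have d1 : MDifferentiableAt (𝓡 n) (𝓡 m) (fun g => chartAt (E m) b (bR A B g)) g :=
      ((isCoord_chartAt b).mdiffAt hg1).comp g (h.mdiff_bR g)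
    have d2 : MDifferentiableAt (𝓡 n) (𝓡 k) (fun g => chartAt (E k) a (aL A B g)) g :=
      ((isCoord_chartAt a).mdiffAt hg2).comp g (h.mdiff_aL g)
    have d3 : MDifferentiableAt (𝓡 n) (𝓡 n) (fun g => incl n m B (chartAt (E m) b (bR A B g))) g :=
      (incl n m B).hasMFDerivAt.mdifferentiableAt.comp g d1
    have d4 : MDifferentiableAt (𝓡 n) (𝓡 n) (fun g => incl n k A (chartAt (E k) a (aL A B g))) g :=
      (incl n k A).hasMFDerivAt.mdifferentiableAt.comp g d2
    exact (d3.add d4).mdifferentiableWithinAt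
  · intro y hy
    obtain ⟨d1, e1⟩ := ltd_symm_comp h.mdiff_right (isCoord_chartAt b) _ hy.1
    obtain ⟨d2, e2⟩ := ltd_symm_comp h.mdiff_left (isCoord_chartAt a) _ hy.2
    exact (MDifferentiableAt.comp (I' := (𝓡 n).prod (𝓡 n)) (g := fun p : G × G => p.1 * p.2) y
      (((contMDiff_mul (𝓡 n) ∞).mdifferentiable (by simp)) _) (d2.prodMk d1)).mdifferentiableWithinAt

end ProductMeasure

end

end DLG

namespace DLG

set_option linter.unusedSectionVars false

noncomputable section

/-! ### The measure of G as a weighted product measure -/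

section ProductFormula

variable {n k m : ℕ} {G : Type*} [Group G] [TopologicalSpace G] [ChartedSpace (E n) G]
  [LieGroup (𝓡 n) ∞ G]
  {A B : Subgroup G} [ChartedSpace (E k) A] [LieGroup (𝓡 k) ∞ A]
  [ChartedSpace (E m) B] [LieGroup (𝓡 m) ∞ B] [SecondCountableTopology G]

theorem continuous_adj : Continuous (fun g : G => adj (𝓡 n) g) := (contMDiff_adj).continuous

theorem continuous_adet {V : Type*} [NormedAddCommGroup V] [NormedSpace ℝ V]
    [FiniteDimensional ℝ V] : Continuous (adet : (V →L[ℝ] V) → ℝ) :=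
  continuous_abs.comp continuous_det

theorem continuous_modG : Continuous (fun g : G => modG n g) := continuous_adet.comp continuous_adj

theorem continuous_modA : Continuous (fun g : G => modA n k A B g) :=
  continuous_adet.comp (continuous_const.clm_comp (continuous_adj.clm_comp continuous_const))

theorem continuous_modB : Continuous (fun g : G => modB n m A B g) :=
  continuous_adet.comp (continuous_const.clm_comp (continuous_adj.clm_comp continuous_const))

variable (h : IsDoubleLieGroup n k m A B)
include h

theorem IsDoubleLieGroup.modA_one : modA n k A B (1 : G) = 1 := by
  rw [← OneMemClass.coe_one A, h.modA_coe, modG_one]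

theorem IsDoubleLieGroup.modA_inv_right (b : B) :
    modA n k A B (b : G)⁻¹ = (modA n k A B (b : G))⁻¹ := by
  rw [← InvMemClass.coe_inv]
  refine eq_inv_of_mul_eq_one_left ?_
  rw [← h.modA_mul_left, InvMemClass.coe_inv, inv_mul_cancel, h.modA_one]

variable [MeasurableSpace G] [BorelSpace G]

theorem IsDoubleLieGroup.volume_eq_map :
    (volume : Measure (E n)) = ENNReal.ofReal (baseDet n k m A B) •
      ((volume : Measure (E m)).prod (volume : Measure (E k))).map h.sumCLE := by
  have h1 := h.map_sumEquiv
  have h2 : ((volume : Measure (E m)).prod (volume : Measure (E k))).map h.sumCLE = _ := h1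
  rw [h2, smul_smul, ← ENNReal.ofReal_mul h.baseDet_pos.le, mul_inv_cancel₀ h.baseDet_pos.ne',
    ENNReal.ofReal_one, one_smul]

theorem IsDoubleLieGroup.lintegral_sum (F : E n → ENNReal) :
    ∫⁻ y, F y = ENNReal.ofReal (baseDet n k m A B) *
      ∫⁻ p, F (h.sumCLE p) ∂((volume : Measure (E m)).prod (volume : Measure (E k))) := by
  rw [h.volume_eq_map, lintegral_smul_measure, smul_eq_mul]
  congr 1
  exact lintegral_map_equiv F h.sumCLE.toHomeomorph.toMeasurableEquiv

omit h in
theorem lintegral_coordMeasure_prod {l l' : ℕ} {H H' : Type*} [Group H] [TopologicalSpace H]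
    [ChartedSpace (E l) H] [LieGroup (𝓡 l) ∞ H] [MeasurableSpace H] [BorelSpace H]
    [SecondCountableTopology H] [Group H'] [TopologicalSpace H'] [ChartedSpace (E l') H']
    [LieGroup (𝓡 l') ∞ H'] [MeasurableSpace H'] [BorelSpace H'] [SecondCountableTopology H']
    (x : H) (x' : H') {W : H × H' → ENNReal} (hW : Measurable W) :
    ∫⁻ p in (chartAt (E l) x).source ×ˢ (chartAt (E l') x').source, W p
        ∂((refMeasure l H).prod (refMeasure l' H')) =
      ∫⁻ p in (chartAt (E l) x).target ×ˢ (chartAt (E l') x').target,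
        ENNReal.ofReal (coordDens (chartAt (E l) x) p.1) *
          (ENNReal.ofReal (coordDens (chartAt (E l') x') p.2) *
            W ((chartAt (E l) x).symm p.1, (chartAt (E l') x').symm p.2))
        ∂((volume : Measure (E l)).prod (volume : Measure (E l'))) := by
  set e := chartAt (E l) x with he
  set e' := chartAt (E l') x' with he'
  have c1 := aemeasurable_coordDens (n := l) (contMDiffOn_chartAt_symm' x)
  have c2 := aemeasurable_coordDens (n := l') (contMDiffOn_chartAt_symm' x')
  have c3 : AEMeasurable e.symm ((volume : Measure (E l)).restrict e.target) :=
    e.continuousOn_symm.aemeasurable e.open_target.measurableSet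
  have c4 : AEMeasurable e'.symm ((volume : Measure (E l')).restrict e'.target) :=
    e'.continuousOn_symm.aemeasurable e'.open_target.measurableSet
  rw [← Measure.prod_restrict, ← Measure.prod_restrict, lintegral_prod _ hW.aemeasurable,
    lintegral_prod]
  · rw [setLIntegral_chart x hW.lintegral_prod_right']
    refine lintegral_congr fun u => ?_
    exact (congrArg (fun z => ENNReal.ofReal (coordDens e u) * z)
      (setLIntegral_chart x' (hW.comp measurable_prodMk_left))).trans
        (lintegral_const_mul' _ _ ENNReal.ofReal_ne_top).symm
  · exact c1.comp_fst.mul (c2.comp_snd.mul (hW.comp_aemeasurable (c3.comp_fst.prodMk c4.comp_snd)))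

/-- The measure of `G` in terms of the measures of `A` and `B`. -/
theorem IsDoubleLieGroup.refMeasure_eq_map : refMeasure n G =
    (((refMeasure m B).prod (refMeasure k A)).withDensity fun p =>
      ENNReal.ofReal (baseDet n k m A B * modA n k A B (p.1 : G)⁻¹)).map
        (fun p => (p.2 : G) * (p.1 : G)) := by
  have hmul : Continuous fun p : B × A => (p.2 : G) * (p.1 : G) := h.mulHomeo.symm.continuous
  have hmod : Continuous fun p : B × A => baseDet n k m A B * modA n k A B (p.1 : G)⁻¹ := by
    have h1 : Continuous fun p : B × A => (p.1 : G)⁻¹ :=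
      (contMDiff_inv (𝓡 n) ∞).continuous.comp (continuous_subtype_val.comp continuous_fst)
    exact continuous_const.mul (continuous_modA.comp h1)
  refine measure_ext_of_nhds (fun g => (h.prodCoord (bR A B g) (aL A B g)).source)
    (fun g => (h.prodCoord (bR A B g) (aL A B g)).open_source.mem_nhds
      ⟨mem_chart_source _ (bR A B g), mem_chart_source _ (aL A B g)⟩)
    (fun g => (h.prodCoord (bR A B g) (aL A B g)).open_source) ?_
  intro g S hS hSm
  set b := bR A B g
  set a := aL A B g
  have hpre : MeasurableSet ((fun p : B × A => (p.2 : G) * (p.1 : G)) ⁻¹' S) :=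
    hmul.measurable hSm
  -- The weight is cut off to the preimage of `S`, which lies in a product of two chart domains.
  -- Tonelli in these charts and the linear change of variables `lintegral_sum` then reduce the
  -- claim to a pointwise identity of densities.
  set W : B × A → ENNReal := ((fun p : B × A => (p.2 : G) * (p.1 : G)) ⁻¹' S).indicator
    (fun p => ENNReal.ofReal (baseDet n k m A B * modA n k A B (p.1 : G)⁻¹)) with hWdef
  have hW : Measurable W := hmod.measurable.ennreal_ofReal.indicator hpre
  have hsub : ∀ p : B × A, p ∉ (chartAt (E m) b).source ×ˢ (chartAt (E k) a).source → W p = 0 := by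
    intro p hp
    refine Set.indicator_of_notMem (fun hpS => hp ?_) _
    have h1 := hS hpS
    have h2 : bR A B ((p.2 : G) * (p.1 : G)) ∈ (chartAt (E m) b).source := h1.1
    have h3 : aL A B ((p.2 : G) * (p.1 : G)) ∈ (chartAt (E k) a).source := h1.2
    rw [h.bR_mul] at h2
    rw [h.aL_mul] at h3
    exact ⟨h2, h3⟩
  rw [Measure.map_apply hmul.measurable hSm, withDensity_apply _ hpre, ← lintegral_indicator hpre,
    ← hWdef]
  have hR : ∫⁻ p, W p ∂((refMeasure m B).prod (refMeasure k A)) =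
      ∫⁻ p in (chartAt (E m) b).source ×ˢ (chartAt (E k) a).source, W p
        ∂((refMeasure m B).prod (refMeasure k A)) := by
    refine (setLIntegral_eq_of_support_subset ?_).symm
    intro p hp
    by_contra hc
    exact hp (hsub p hc)
  rw [hR, lintegral_coordMeasure_prod b a hW,
    refMeasure_apply_of_subset (h.isCoord_prodCoord b a) hSm hS, coordMeasure_apply _ hSm]
  have hT : MeasurableSet ((h.prodCoord b a).target ∩ (h.prodCoord b a).symm ⁻¹' S) :=
    measurableSet_inter_preimage (h.prodCoord b a).continuousOn_symm
      (h.prodCoord b a).open_target.measurableSet hSm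
  have hTT : MeasurableSet ((chartAt (E m) b).target ×ˢ (chartAt (E k) a).target) :=
    (chartAt (E m) b).open_target.measurableSet.prod (chartAt (E k) a).open_target.measurableSet
  rw [← lintegral_indicator hT, h.lintegral_sum, ← lintegral_const_mul' _ _ ENNReal.ofReal_ne_top,
    ← lintegral_indicator hTT]
  refine lintegral_congr fun p => ?_
  have hp1 : projB n m A B (h.sumCLE p) = p.1 :=
    congrArg Prod.fst (h.sumCLE.symm_apply_apply p)
  have hp2 : projA n k A B (h.sumCLE p) = p.2 :=
    congrArg Prod.snd (h.sumCLE.symm_apply_apply p)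
  by_cases hp : p ∈ (chartAt (E m) b).target ×ˢ (chartAt (E k) a).target
  · have ht : h.sumCLE p ∈ (h.prodCoord b a).target := by
      rw [h.mem_prodCoord_target, hp1, hp2]; exact hp
    have hs : (h.prodCoord b a).symm (h.sumCLE p) = ((chartAt (E k) a).symm p.2 : G) *
        ((chartAt (E m) b).symm p.1 : G) := by
      rw [h.prodCoord_symm_apply, hp1, hp2]
    rw [Set.indicator_of_mem hp]
    by_cases hpS : ((chartAt (E k) a).symm p.2 : G) * ((chartAt (E m) b).symm p.1 : G) ∈ S
    · rw [Set.indicator_of_mem (show _ ∈ _ ∩ _ from ⟨ht, by rw [Set.mem_preimage, hs]; exact hpS⟩),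
        hWdef, Set.indicator_of_mem (show ((chartAt (E m) b).symm p.1, (chartAt (E k) a).symm p.2) ∈
            (fun p : B × A => (p.2 : G) * (p.1 : G)) ⁻¹' S from hpS), h.coordDens_prodCoord ht, hp1, hp2,
        ← ENNReal.ofReal_mul (show 0 ≤ coordDens (chartAt (E k) a) p.2 from abs_nonneg _),
        ← ENNReal.ofReal_mul (show 0 ≤ coordDens (chartAt (E m) b) p.1 from abs_nonneg _),
        ← ENNReal.ofReal_mul h.baseDet_pos.le]
      congr 1
      ring
    · rw [Set.indicator_of_notMem (fun hc => hpS (by rw [← hs]; exact hc.2)), hWdef,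
        Set.indicator_of_notMem (show ((chartAt (E m) b).symm p.1, (chartAt (E k) a).symm p.2) ∉
            (fun p : B × A => (p.2 : G) * (p.1 : G)) ⁻¹' S from hpS)]
      simp
  · rw [Set.indicator_of_notMem hp, Set.indicator_of_notMem, mul_zero]
    intro hc
    have := hc.1
    rw [h.mem_prodCoord_target, hp1, hp2] at this
    exact hp this

/-- Functions on `G` and on `B × A`: integrability. -/
theorem IsDoubleLieGroup.integrable_prod_iff {F : G → ℂ} :
    Integrable F (refMeasure n G) ↔ Integrable (fun p : B × A =>
      ((baseDet n k m A B * modA n k A B (p.1 : G)⁻¹ : ℝ) : ℂ) * F ((p.2 : G) * (p.1 : G)))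
        ((refMeasure m B).prod (refMeasure k A)) := by
  have hmod : Continuous fun p : B × A => baseDet n k m A B * modA n k A B (p.1 : G)⁻¹ := by
    have h1 : Continuous fun p : B × A => (p.1 : G)⁻¹ :=
      (contMDiff_inv (𝓡 n) ∞).continuous.comp (continuous_subtype_val.comp continuous_fst)
    exact continuous_const.mul (continuous_modA.comp h1)
  conv_lhs => rw [h.refMeasure_eq_map]
  have h1 := integrable_map_equiv (μ := ((refMeasure m B).prod (refMeasure k A)).withDensity fun p =>
      ENNReal.ofReal (baseDet n k m A B * modA n k A B (p.1 : G)⁻¹))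
    h.mulHomeo.symm.toMeasurableEquiv F
  refine h1.trans ?_
  rw [integrable_withDensity_iff_integrable_smul' hmod.measurable.ennreal_ofReal
    (Filter.Eventually.of_forall fun _ => ENNReal.ofReal_lt_top)]
  refine integrable_congr (Filter.Eventually.of_forall fun p => ?_)
  simp only [Function.comp_apply, Complex.real_smul]
  rw [ENNReal.toReal_ofReal (mul_nonneg h.baseDet_pos.le (h.modA_pos _).le)]
  rfl

theorem IsDoubleLieGroup.integral_eq_iterated {F : G → ℂ} (hF : Integrable F (refMeasure n G)) :
    ∫ g, F g ∂(refMeasure n G) = ∫ b : B, ∫ a : A,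
      ((baseDet n k m A B * modA n k A B (b : G)⁻¹ : ℝ) : ℂ) * F ((a : G) * (b : G))
        ∂(refMeasure k A) ∂(refMeasure m B) := by
  have hmod : Continuous fun p : B × A => baseDet n k m A B * modA n k A B (p.1 : G)⁻¹ := by
    have h1 : Continuous fun p : B × A => (p.1 : G)⁻¹ :=
      (contMDiff_inv (𝓡 n) ∞).continuous.comp (continuous_subtype_val.comp continuous_fst)
    exact continuous_const.mul (continuous_modA.comp h1)
  have h2 := MeasureTheory.integral_prod _ (h.integrable_prod_iff.mp hF)
  refine Eq.trans ?_ h2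
  conv_lhs => rw [h.refMeasure_eq_map]
  have h1 := integral_map_equiv (μ := ((refMeasure m B).prod (refMeasure k A)).withDensity fun p =>
      ENNReal.ofReal (baseDet n k m A B * modA n k A B (p.1 : G)⁻¹))
    h.mulHomeo.symm.toMeasurableEquiv F
  refine h1.trans ?_
  rw [integral_withDensity_eq_integral_toReal_smul hmod.measurable.ennreal_ofReal
    (Filter.Eventually.of_forall fun _ => ENNReal.ofReal_lt_top)]
  refine integral_congr_ae (Filter.Eventually.of_forall fun p => ?_)
  simp only [Complex.real_smul]
  rw [ENNReal.toReal_ofReal (mul_nonneg h.baseDet_pos.le (h.modA_pos _).le)]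
  rfl

end ProductFormula

end

end DLG

namespace DLG

set_option linter.unusedSectionVars false

noncomputable section

/-! ### Smoothness of integrals depending on a parameter -/

section SmoothIntegral

variable {k n : ℕ} {H : Type*} [Group H] [TopologicalSpace H] [ChartedSpace (E k) H]
  [LieGroup (𝓡 k) ∞ H] [MeasurableSpace H] [BorelSpace H] [SecondCountableTopology H] [T2Space H]
  {G : Type*} [TopologicalSpace G] [ChartedSpace (E n) G] [IsManifold (𝓡 n) ∞ G]

theorem integral_chart (x : H) {K : Set H}
    (hKx : K ⊆ (chartAt (E k) x).source) {f : H → ℂ} (hf : Continuous f)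
    (hfK : ∀ a, a ∉ K → f a = 0) :
    ∫ a, f a ∂(refMeasure k H) = ∫ y, ((chartAt (E k) x) '' K).indicator
      (coordDens (chartAt (E k) x)) y • f ((chartAt (E k) x).symm y) := by
  set e := chartAt (E k) x with he
  have hKt : e '' K ⊆ e.target := by
    rintro _ ⟨a, ha, rfl⟩; exact e.map_source (hKx ha)
  have h1 : ∫ a, f a ∂(refMeasure k H) = ∫ a in e.source, f a ∂(refMeasure k H) :=
    (setIntegral_eq_integral_of_forall_compl_eq_zero fun a ha => hfK a fun h => ha (hKx h)).symm
  have hdens := (continuousOn_coordDens (contMDiffOn_chartAt_symm' x)).aemeasurable (μ := volume)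
    e.open_target.measurableSet
  rw [h1, refMeasure_restrict_eq (isCoord_chartAt x), coordMeasure,
    integral_map (aemeasurable_symm e _) hf.aestronglyMeasurable,
    integral_withDensity_eq_integral_toReal_smul₀ hdens.ennreal_ofReal
      (Filter.Eventually.of_forall fun _ => ENNReal.ofReal_lt_top),
    ← integral_indicator e.open_target.measurableSet]
  refine integral_congr_ae (Filter.Eventually.of_forall fun y => ?_)
  by_cases hy : y ∈ e '' K
  · simp only
    rw [Set.indicator_of_mem (hKt hy), Set.indicator_of_mem hy,
      ENNReal.toReal_ofReal (show 0 ≤ coordDens e y from abs_nonneg _)]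
  · simp only
    rw [Set.indicator_of_notMem hy, zero_smul]
    by_cases hyt : y ∈ e.target
    · rw [Set.indicator_of_mem hyt, hfK, smul_zero]
      intro hc
      exact hy ⟨_, hc, e.right_inv hyt⟩
    · rw [Set.indicator_of_notMem hyt]

/-- In a chart the integral is the value at 0 of the convolution of a fixed integrable function, the
density cut off to the image of `K`, with a smooth compactly supported function depending smoothly
on parameters. Such convolutions are smooth. -/
theorem contMDiff_integral_of_chart (x : H) {K : Set H} (hK : IsCompact K)
    (hKx : K ⊆ (chartAt (E k) x).source) {F : G → H → ℂ}
    (hF : ContMDiff ((𝓡 n).prod (𝓡 k)) 𝓘(ℝ, ℂ) ∞ (fun p : G × H => F p.1 p.2))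
    (hFK : ∀ g a, a ∉ K → F g a = 0) :
    ContMDiff (𝓡 n) 𝓘(ℝ, ℂ) ∞ (fun g => ∫ a, F g a ∂(refMeasure k H)) := by
  intro g₀
  set e := chartAt (E k) x with he
  set ψ := chartAt (E n) g₀ with hψ
  have hKt : e '' K ⊆ e.target := by
    rintro _ ⟨a, ha, rfl⟩; exact e.map_source (hKx ha)
  have heK : IsCompact (e '' K) := hK.image_of_continuousOn (e.continuousOn.mono hKx)
  set f : E k → ℝ := (e '' K).indicator (coordDens e) with hf
  have hfi : LocallyIntegrable f := by
    refine Integrable.locallyIntegrable ?_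
    rw [hf, integrable_indicator_iff heK.measurableSet]
    exact ((continuousOn_coordDens (contMDiffOn_chartAt_symm' x)).mono hKt).integrableOn_compact heK
  classical
  -- The sign compensates the reflection in a convolution: at 0 the integrand is `f y • w p (-y)`.
  -- Extension by zero off the target is smooth because `F` vanishes outside `K`, whose image is
  -- closed.
  set w : E n → E k → ℂ := fun p y =>
    if -y ∈ e.target then F (ψ.symm p) (e.symm (-y)) else 0 with hw
  have hsmooth : ContDiffOn ℝ ∞ (fun q : E n × E k => w q.1 q.2) (ψ.target ×ˢ Set.univ) := by
    rintro ⟨p, y⟩ ⟨hp, -⟩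
    refine ContDiffAt.contDiffWithinAt ?_
    by_cases hy : -y ∈ e.target
    · have hev : (fun q : E n × E k => w q.1 q.2) =ᶠ[nhds (p, y)]
          fun q => F (ψ.symm q.1) (e.symm (-q.2)) := by
        have : ∀ᶠ q : E n × E k in nhds (p, y), -q.2 ∈ e.target :=
          (continuous_snd.neg.continuousAt (x := (p, y))).eventually_mem
            (e.open_target.mem_nhds hy)
        filter_upwards [this] with q hq
        simp only [hw, if_pos hq]
      refine ContDiffAt.congr_of_eventuallyEq ?_ hev
      rw [← contMDiffAt_iff_contDiffAt]
      have h1 : ContMDiffAt 𝓘(ℝ, E n × E k) (𝓡 n) ∞ (fun q : E n × E k => ψ.symm q.1) (p, y) :=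
        ContMDiffAt.comp (p, y) (I' := 𝓡 n) (g := ψ.symm) (f := Prod.fst)
          ((contMDiffOn_chart_symm p hp).contMDiffAt (ψ.open_target.mem_nhds hp))
          contDiff_fst.contMDiff.contMDiffAt
      have h2 : ContMDiffAt 𝓘(ℝ, E n × E k) (𝓡 k) ∞ (fun q : E n × E k => e.symm (-q.2)) (p, y) :=
        ContMDiffAt.comp (p, y) (I' := 𝓡 k) (g := e.symm) (f := fun q : E n × E k => -q.2)
          ((contMDiffOn_chart_symm (-y) hy).contMDiffAt (e.open_target.mem_nhds hy))
          contDiff_snd.neg.contMDiff.contMDiffAt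
      exact hF.contMDiffAt.comp (p, y) (h1.prodMk h2)
    · have hcl : IsClosed (e '' K) := heK.isClosed
      have hnm : -y ∉ e '' K := fun hc => hy (hKt hc)
      have hev : (fun q : E n × E k => w q.1 q.2) =ᶠ[nhds (p, y)] fun _ => 0 := by
        have : ∀ᶠ q : E n × E k in nhds (p, y), -q.2 ∈ (e '' K)ᶜ :=
          (continuous_snd.neg.continuousAt (x := (p, y))).eventually_mem
            (hcl.isOpen_compl.mem_nhds hnm)
        filter_upwards [this] with q hq
        simp only [hw]
        split_ifs with ht
        · exact hFK _ _ fun hc => hq ⟨_, hc, e.right_inv ht⟩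
        · rfl
      exact contDiffAt_const.congr_of_eventuallyEq hev
  have hconv := contDiffOn_convolution_right_with_param (𝕜 := ℝ) (n := ⊤) (μ := volume)
    (ContinuousLinearMap.lsmul ℝ ℝ : ℝ →L[ℝ] ℂ →L[ℝ] ℂ) (g := w) (s := ψ.target)
    (k := (fun y => -y) '' (e '' K)) ψ.open_target (heK.image continuous_neg)
    (by
      intro p y _ hy
      simp only [hw]
      split_ifs with ht
      · exact hFK _ _ fun hc => hy ⟨-y, ⟨_, hc, e.right_inv ht⟩, neg_neg y⟩
      · rfl) hfi hsmooth
  have hJ : ContDiffOn ℝ ∞ (fun p => ∫ a, F (ψ.symm p) a ∂(refMeasure k H)) ψ.target := by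
    have h1 : ContDiffOn ℝ ∞ (fun p : E n => (p, (0 : E k))) ψ.target :=
      (contDiff_id.prodMk contDiff_const).contDiffOn
    refine (hconv.comp h1 fun p hp => ⟨hp, trivial⟩).congr fun p hp => ?_
    have hc : Continuous fun a => F (ψ.symm p) a :=
      hF.continuous.comp (continuous_const.prodMk continuous_id)
    rw [integral_chart x hKx hc (hFK _)]
    refine integral_congr_ae (Filter.Eventually.of_forall fun y => ?_)
    simp only [ContinuousLinearMap.lsmul_apply, hw, zero_sub, neg_neg]
    by_cases hy : y ∈ e '' K
    · rw [if_pos (hKt hy)]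
    · rw [Set.indicator_of_notMem hy, zero_smul, hf, Set.indicator_of_notMem hy, zero_smul]
  have h2 : ContMDiffAt (𝓡 n) 𝓘(ℝ, ℂ) ∞
      (fun g => ∫ a, F (ψ.symm (ψ g)) a ∂(refMeasure k H)) g₀ := by
    have h3 : ContMDiffAt 𝓘(ℝ, E n) 𝓘(ℝ, ℂ) ∞
        (fun p => ∫ a, F (ψ.symm p) a ∂(refMeasure k H)) (ψ g₀) :=
      (hJ.contDiffAt (ψ.open_target.mem_nhds (mem_chart_target _ g₀))).contMDiffAt
    exact h3.comp g₀ (contMDiffOn_chart.contMDiffAt (chart_source_mem_nhds _ g₀))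
  refine h2.congr_of_eventuallyEq ?_
  filter_upwards [chart_source_mem_nhds (E n) g₀] with g hg
  rw [ψ.left_inv hg]

/-- A partition of unity subordinate to the charts splits the integrand; only finitely many of its
members meet the compact set `C`. -/
theorem contMDiff_integral {C : Set H} (hC : IsCompact C) {F : G → H → ℂ}
    (hF : ContMDiff ((𝓡 n).prod (𝓡 k)) 𝓘(ℝ, ℂ) ∞ (fun p : G × H => F p.1 p.2))
    (hFC : ∀ g a, a ∉ C → F g a = 0) :
    ContMDiff (𝓡 n) 𝓘(ℝ, ℂ) ∞ (fun g => ∫ a, F g a ∂(refMeasure k H)) := by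
  have : LocallyCompactSpace H := ChartedSpace.locallyCompactSpace (E k) H
  have : SigmaCompactSpace H := inferInstance
  obtain ⟨ρ, hρ⟩ := SmoothPartitionOfUnity.exists_isSubordinate_chartAt_source (𝓡 k) H
  have hfin : {i | (Function.support (ρ i) ∩ C).Nonempty}.Finite :=
    ρ.locallyFinite.finite_nonempty_inter_compact hC
  set S := hfin.toFinset with hS
  have hsum : ∀ g a, F g a = ∑ i ∈ S, ((ρ i a : ℝ) : ℂ) * F g a := by
    intro g a
    by_cases ha : a ∈ C
    · rw [← Finset.sum_mul, ← Complex.ofReal_sum]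
      have h1 : ∑ i ∈ S, ρ i a = 1 := by
        rw [← ρ.sum_eq_one (Set.mem_univ a)]
        refine (finsum_eq_sum_of_support_subset _ ?_).symm
        intro i hi
        rw [hS, Set.Finite.coe_toFinset]
        exact ⟨a, hi, ha⟩
      rw [h1, Complex.ofReal_one, one_mul]
    · rw [hFC g a ha]; simp
  have hsm : ∀ i, ContMDiff ((𝓡 n).prod (𝓡 k)) 𝓘(ℝ, ℂ) ∞
      (fun p : G × H => ((ρ i p.2 : ℝ) : ℂ) * F p.1 p.2) := by
    intro i
    have h1 : ContMDiff ((𝓡 n).prod (𝓡 k)) 𝓘(ℝ, ℝ) ∞ (fun p : G × H => ρ i p.2) :=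
      (ρ i).contMDiff.comp contMDiff_snd
    have h2 := h1.smul hF
    exact h2.congr fun p => Complex.real_smul.symm
  have hcont : ∀ i g, Continuous fun a => ((ρ i a : ℝ) : ℂ) * F g a := fun i g =>
    (hsm i).continuous.comp (continuous_const.prodMk continuous_id)
  have hK : ∀ i, IsCompact (tsupport (ρ i) ∩ C) := fun i =>
    hC.inter_left (isClosed_tsupport _)
  have hzero : ∀ i g a, a ∉ tsupport (ρ i) ∩ C → ((ρ i a : ℝ) : ℂ) * F g a = 0 := by
    intro i g a ha
    by_cases hac : a ∈ C
    · have : a ∉ tsupport (ρ i) := fun h => ha ⟨h, hac⟩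
      rw [image_eq_zero_of_notMem_tsupport this]; simp
    · rw [hFC g a hac, mul_zero]
  have hint : ∀ i g, Integrable (fun a => ((ρ i a : ℝ) : ℂ) * F g a) (refMeasure k H) := fun i g =>
    (hcont i g).integrable_of_hasCompactSupport
      (HasCompactSupport.intro (hK i) fun a ha => hzero i g a ha)
  have heq : (fun g => ∫ a, F g a ∂(refMeasure k H)) =
      fun g => ∑ i ∈ S, ∫ a, ((ρ i a : ℝ) : ℂ) * F g a ∂(refMeasure k H) := by
    funext g
    rw [← integral_finsetSum _ fun i _ => hint i g]
    exact integral_congr_ae (Filter.Eventually.of_forall fun a => hsum g a)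
  rw [heq]
  refine ContMDiff.sum fun i _ => ?_
  exact contMDiff_integral_of_chart i (hK i) (Set.inter_subset_left.trans (hρ i)) (hsm i) (hzero i)

end SmoothIntegral

end

end DLG

namespace DLG

set_option linter.unusedSectionVars false

noncomputable section

/-! ### Φ̂(φ, ψ) is a smooth compactly supported bidensity -/

section Bidensity

theorem ContMDiff.complex_mul {V H₀ M : Type*} [NormedAddCommGroup V] [NormedSpace ℝ V]
    [TopologicalSpace H₀] {I : ModelWithCorners ℝ V H₀} [TopologicalSpace M] [ChartedSpace H₀ M]
    {f g : M → ℂ} (hf : ContMDiff I 𝓘(ℝ, ℂ) ∞ f) (hg : ContMDiff I 𝓘(ℝ, ℂ) ∞ g) :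
    ContMDiff I 𝓘(ℝ, ℂ) ∞ (fun x => f x * g x) :=
  (contDiff_mul (𝕜 := ℝ) (𝔸 := ℂ)).comp_contMDiff (hf.prodMk_space hg)

theorem ContMDiff.complex_conj {V H₀ M : Type*} [NormedAddCommGroup V] [NormedSpace ℝ V]
    [TopologicalSpace H₀] {I : ModelWithCorners ℝ V H₀} [TopologicalSpace M] [ChartedSpace H₀ M]
    {f : M → ℂ} (hf : ContMDiff I 𝓘(ℝ, ℂ) ∞ f) :
    ContMDiff I 𝓘(ℝ, ℂ) ∞ (fun x => starRingEnd ℂ (f x)) :=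
  Complex.conjCLE.contDiff.comp_contMDiff hf

theorem contDiffAt_adet {V : Type*} [NormedAddCommGroup V] [NormedSpace ℝ V]
    [FiniteDimensional ℝ V] {L : V →L[ℝ] V} (hL : 0 < adet L) : ContDiffAt ℝ ∞ adet L :=
  (contDiffAt_abs (abs_pos.mp hL)).comp L contDiff_det.contDiffAt

variable {n k m : ℕ} {G : Type*} [Group G] [TopologicalSpace G] [ChartedSpace (E n) G]
  [LieGroup (𝓡 n) ∞ G]
  {A B : Subgroup G} [ChartedSpace (E k) A] [LieGroup (𝓡 k) ∞ A]
  [ChartedSpace (E m) B] [LieGroup (𝓡 m) ∞ B] [SecondCountableTopology G]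

theorem contMDiff_modG : ContMDiff (𝓡 n) 𝓘(ℝ, ℝ) ∞ (fun g : G => modG n g) := fun g =>
  (contDiffAt_adet (modG_pos g)).comp_contMDiffAt (contMDiff_adj g)

variable (h : IsDoubleLieGroup n k m A B)
include h

theorem IsDoubleLieGroup.contMDiff_modA :
    ContMDiff (𝓡 n) 𝓘(ℝ, ℝ) ∞ (fun g : G => modA n k A B g) := fun g => by
  have h1 : ContDiff ℝ ∞ (fun L : E n →L[ℝ] E n => projA n k A B ∘L L ∘L incl n k A) :=
    contDiff_const.clm_comp (contDiff_id.clm_comp contDiff_const)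
  have h2 : ContDiffAt ℝ ∞ (fun L : E n →L[ℝ] E n => adet (projA n k A B ∘L L ∘L incl n k A))
      (adj (𝓡 n) g) :=
    ContDiffAt.comp (g := adet) (f := fun L : E n →L[ℝ] E n => projA n k A B ∘L L ∘L incl n k A)
      (adj (𝓡 n) g) (contDiffAt_adet (h.modA_pos g)) h1.contDiffAt
  exact h2.comp_contMDiffAt (contMDiff_adj g)

variable [MeasurableSpace G] [BorelSpace G]

/-- Because a_L(a b_L(g)) = a, the integration variable stays in the `aL`-image of the support of
`f₁`, a set which does not depend on `g` and is compact when that support is. -/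
theorem IsDoubleLieGroup.corr_zero {f₁ f₂ : G → ℂ} {g : G} {a : A}
    (ha : a ∉ aL A B '' tsupport f₁) :
    starRingEnd ℂ (f₁ ((a : G) * bL A B g)) * f₂ ((a : G) * g) = 0 := by
  rw [image_eq_zero_of_notMem_tsupport (f := f₁), map_zero, zero_mul]
  exact fun hc => ha ⟨_, hc, h.aL_mul _ _⟩

theorem IsDoubleLieGroup.hasCompactSupport_corr {f₁ f₂ : G → ℂ} (h₁ : HasCompactSupport f₁)
    (h₂ : HasCompactSupport f₂) [T2Space G] : HasCompactSupport (corr k A B f₁ f₂) := by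
  have hC : IsCompact (aL A B '' tsupport f₁) := h₁.image h.contMDiff_aL.continuous
  have hc : Continuous fun p : A × G => (p.1 : G)⁻¹ * p.2 :=
    ((((h.smooth_left.comp contMDiff_fst).inv).mul contMDiff_snd :
      ContMDiff ((𝓡 k).prod (𝓡 n)) (𝓡 n) ∞ fun p : A × G => (p.1 : G)⁻¹ * p.2)).continuous
  -- A nonzero integrand needs a in that set and ag in the support of `f₂`, so g = a⁻¹(ag) lies in a
  -- continuous image of a compact product.
  refine HasCompactSupport.intro ((hC.prod h₂).image hc) fun g hg => ?_
  rw [corr]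
  refine (integral_congr_ae (Filter.Eventually.of_forall fun a => ?_)).trans (integral_zero _ _)
  by_cases ha : a ∈ aL A B '' tsupport f₁
  · by_cases hag : (a : G) * g ∈ tsupport f₂
    · exact (hg ⟨(a, (a : G) * g), ⟨ha, hag⟩, inv_mul_cancel_left _ _⟩).elim
    · exact (congrArg _ (image_eq_zero_of_notMem_tsupport hag)).trans (mul_zero _)
  · exact h.corr_zero ha

theorem IsDoubleLieGroup.contMDiff_corr [T2Space G] {f₁ f₂ : G → ℂ}
    (s₁ : ContMDiff (𝓡 n) 𝓘(ℝ, ℂ) ∞ f₁) (s₂ : ContMDiff (𝓡 n) 𝓘(ℝ, ℂ) ∞ f₂)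
    (h₁ : HasCompactSupport f₁) : ContMDiff (𝓡 n) 𝓘(ℝ, ℂ) ∞ (corr k A B f₁ f₂) := by
  have hC : IsCompact (aL A B '' tsupport f₁) := h₁.image h.contMDiff_aL.continuous
  have e1 : ContMDiff ((𝓡 n).prod (𝓡 k)) (𝓡 n) ∞ (fun p : G × A => (p.2 : G) * bL A B p.1) :=
    (h.smooth_left.comp contMDiff_snd).mul
      (h.smooth_right.comp (h.contMDiff_bL.comp contMDiff_fst))
  have e2 : ContMDiff ((𝓡 n).prod (𝓡 k)) (𝓡 n) ∞ (fun p : G × A => (p.2 : G) * p.1) :=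
    (h.smooth_left.comp contMDiff_snd).mul contMDiff_fst
  exact contMDiff_integral (F := fun g (a : A) => starRingEnd ℂ (f₁ ((a : G) * bL A B g)) *
    f₂ ((a : G) * g)) hC (ContMDiff.complex_mul (ContMDiff.complex_conj (s₁.comp e1)) (s₂.comp e2))
    fun g a ha => h.corr_zero ha

theorem IsDoubleLieGroup.isBidensity_PhiHat [T2Space G] {φ ψ : FrameField n G}
    (hφ : IsHalfDensity n φ) (hψ : IsHalfDensity n ψ) :
    IsBidensity n m B (PhiHat n k m A B φ ψ) := by
  have hb := h.isBihomogeneous_PhiHat hφ.homogeneous hψ.homogeneous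
  have hco := funext (h.PhiHat_coeff hφ.homogeneous hψ.homogeneous)
  refine ⟨hb.left, hb.right, ?_, ?_⟩
  · rw [hco]
    refine ContMDiff.complex_mul ?_ (h.contMDiff_corr hφ.smooth hψ.smooth hφ.compact)
    refine Complex.ofRealCLM.contDiff.comp_contMDiff (I := 𝓡 n) (?_ : ContMDiff (𝓡 n) 𝓘(ℝ, ℝ) ∞
      (fun g : G => (baseDet n k m A B ^ 2 /
        (modA n k A B g * modG n (bL A B g : G))) ^ (1 / 2 : ℝ)))
    intro g
    have p1 := h.modA_pos g
    have p2 := modG_pos (n := n) (bL A B g : G)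
    have p3 := h.baseDet_pos
    have h1 : ContMDiff (𝓡 n) 𝓘(ℝ, ℝ × ℝ) ∞
        (fun g : G => (modA n k A B g, modG n (bL A B g : G))) :=
      h.contMDiff_modA.prodMk_space
        (contMDiff_modG.comp (h.smooth_right.comp h.contMDiff_bL))
    have h2 : ContDiffAt ℝ ∞ (fun p : ℝ × ℝ => (baseDet n k m A B ^ 2 / (p.1 * p.2)) ^ (1 / 2 : ℝ))
        (modA n k A B g, modG n (bL A B g : G)) :=
      ContDiffAt.rpow_const_of_ne (f := fun p : ℝ × ℝ => baseDet n k m A B ^ 2 / (p.1 * p.2))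
        (ContDiffAt.div (f := fun _ : ℝ × ℝ => baseDet n k m A B ^ 2)
          (g := fun p : ℝ × ℝ => p.1 * p.2) contDiffAt_const
          (contDiff_fst.mul contDiff_snd).contDiffAt (mul_pos p1 p2).ne')
        (div_pos (pow_pos p3 2) (mul_pos p1 p2)).ne'
    exact ContDiffAt.comp_contMDiffAt (g := fun p : ℝ × ℝ =>
      (baseDet n k m A B ^ 2 / (p.1 * p.2)) ^ (1 / 2 : ℝ))
      (f := fun g : G => (modA n k A B g, modG n (bL A B g : G))) h2 (h1 g)
  · rw [hco]
    exact (h.hasCompactSupport_corr hφ.compact hψ.compact).mul_left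

end Bidensity

end

end DLG

namespace DLG

set_option linter.unusedSectionVars false

noncomputable section

/-! ### The kernel of the slices and its agreement with π_id -/

section SliceKernel

variable {n k m : ℕ} {G : Type*} [Group G] [TopologicalSpace G] [ChartedSpace (E n) G]
  [LieGroup (𝓡 n) ∞ G]
  {A B : Subgroup G} [ChartedSpace (E k) A] [LieGroup (𝓡 k) ∞ A]
  [ChartedSpace (E m) B] [LieGroup (𝓡 m) ∞ B] [SecondCountableTopology G]
  (h : IsDoubleLieGroup n k m A B)
include h

theorem IsDoubleLieGroup.contMDiff_bL_mul (z : G) :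
    ContMDiff (𝓡 m) (𝓡 m) ∞ (fun b : B => bL A B (z * b)) :=
  h.contMDiff_bL.comp (contMDiff_const.mul h.smooth_right)

theorem IsDoubleLieGroup.contMDiff_bR_inv_mul (z : G) :
    ContMDiff (𝓡 m) (𝓡 m) ∞ (fun b : B => (bR A B ((b : G)⁻¹ * z))⁻¹) :=
  (h.contMDiff_bR.comp (h.smooth_right.inv.mul contMDiff_const)).inv

/-- The left fibre `z B` of the groupoid, parametrised by `b` or by the unit `b_L(z b)`. -/
def IsDoubleLieGroup.fibreHomeo (z : G) : B ≃ₜ B where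
  toFun b := bL A B (z * b)
  invFun b := (bR A B ((b : G)⁻¹ * z))⁻¹
  left_inv b := by
    have h1 : (bL A B (z * b) : G)⁻¹ * z = (aR A B (z * b) : G) * ((b⁻¹ : B) : G) := by
      rw [inv_mul_eq_iff_eq_mul, ← mul_assoc, h.eq_bL_mul_aR]; simp
    simp only
    rw [h1, h.bR_mul, inv_inv]
  right_inv b := by
    have h1 : z * (((bR A B ((b : G)⁻¹ * z))⁻¹ : B) : G) =
        (b : G) * (aL A B ((b : G)⁻¹ * z) : G) := by
      rw [InvMemClass.coe_inv, mul_inv_eq_iff_eq_mul, mul_assoc, h.eq_aL_mul_bR,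
        mul_inv_cancel_left]
    simp only
    rw [h1, h.bL_mul]
  continuous_toFun := (h.contMDiff_bL_mul z).continuous
  continuous_invFun := (h.contMDiff_bR_inv_mul z).continuous

/-- By `bL_mul_eq` the increment of b_L(zb) is b_L of the increment of b conjugated by a_R(zb),
whose derivative is a 𝔟-block. -/
theorem IsDoubleLieGroup.adet_gd_fibreHomeo (z : G) (b : B) :
    adet (gd (𝓡 m) (𝓡 m) (h.fibreHomeo z) b) = modB n m A B (aR A B (z * b) : G) := by
  have h1 : (fun s : B => (h.fibreHomeo z b)⁻¹ * h.fibreHomeo z (b * s)) =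
      fun s : B => bL A B ((aR A B (z * b) : G) * s * (aR A B (z * b) : G)⁻¹) := by
    funext s
    show (bL A B (z * b))⁻¹ * bL A B (z * (b * s : B)) = _
    rw [Subgroup.coe_mul, ← mul_assoc z, h.bL_mul_eq (z * b), inv_mul_cancel_left]
  rw [gd, h1, h.td_bL_conj]
  rfl

variable [MeasurableSpace G] [BorelSpace G]

theorem IsDoubleLieGroup.integral_fibre (z : G) (F : B → ℂ) :
    ∫ b : B, ((modB n m A B (aR A B (z * b) : G) : ℝ) : ℂ) * F (bL A B (z * b)) ∂(refMeasure m B) =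
      ∫ b : B, F b ∂(refMeasure m B) := by
  rw [← integral_refMeasure_diffeo (h.fibreHomeo z) (h.contMDiff_bL_mul z)
    (h.contMDiff_bR_inv_mul z) F]
  simp only [h.adet_gd_fibreHomeo]
  rfl

/-- The integrand of the slices of `W`. -/
def sliceKernel (n : ℕ) {G : Type*} [Group G] [TopologicalSpace G] [ChartedSpace (E n) G]
    (A B : Subgroup G) (f₁ f₂ f : G → ℂ) (z s : G) : ℂ :=
  starRingEnd ℂ (f₁ s) * (((modG n (aL A B ((bR A B s : G)⁻¹ * z) : G)⁻¹ ^ (1 / 2 : ℝ) : ℝ) : ℂ) *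
    (f₂ (s * aL A B ((bR A B s : G)⁻¹ * z)) * f ((bR A B s : G)⁻¹ * z)))

theorem IsDoubleLieGroup.continuous_sliceKernel {f₁ f₂ f : G → ℂ} (c₁ : Continuous f₁)
    (c₂ : Continuous f₂) (c : Continuous f) (z : G) :
    Continuous (sliceKernel n A B f₁ f₂ f z) := by
  have e1 : Continuous fun s : G => (bR A B s : G)⁻¹ * z :=
    (((h.smooth_right.comp h.contMDiff_bR).inv).mul contMDiff_const).continuous
  have e2 : Continuous fun s : G => (aL A B ((bR A B s : G)⁻¹ * z) : G) :=
    (h.smooth_left.comp h.contMDiff_aL).continuous.comp e1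
  have e3 : Continuous fun s : G => s * (aL A B ((bR A B s : G)⁻¹ * z) : G) := by
    have : IsTopologicalGroup G := topologicalGroup_of_lieGroup (𝓡 n) ∞
    exact continuous_id.mul e2
  have e4 : Continuous fun s : G => (modG n (aL A B ((bR A B s : G)⁻¹ * z) : G)⁻¹ : ℝ) := by
    have : Continuous fun g : G => modG n g⁻¹ :=
      continuous_modG.comp (contMDiff_inv (𝓡 n) ∞).continuous
    exact this.comp e2
  exact (Complex.continuous_conj.comp c₁).mul
    ((Complex.continuous_ofReal.comp (e4.rpow_const fun s => Or.inl (modG_pos _).ne')).mul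
      ((c₂.comp e3).mul (c.comp e1)))

theorem IsDoubleLieGroup.integrable_sliceKernel {f₁ f₂ f : G → ℂ} (c₁ : Continuous f₁)
    (hc : HasCompactSupport f₁) (c₂ : Continuous f₂) (c : Continuous f) (z : G) :
    Integrable (sliceKernel n A B f₁ f₂ f z) (refMeasure n G) :=
  (h.continuous_sliceKernel c₁ c₂ c z).integrable_of_hasCompactSupport
    ((hc.comp_left (map_zero (starRingEnd ℂ))).mul_right)

/-- This is the numerical match of the two constructions. On the left stand the weights of Φ̂ and
π_id at zb = βa; on the right the Jacobian of b ↦ β, the density of dg in the coordinates of `A` and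
`B`, and the weight of W. After squaring it follows from modG = modA modB on each of the two
subgroups. -/
theorem IsDoubleLieGroup.weight_eq (a : A) (β : B) :
    (baseDet n k m A B ^ 2 / (modA n k A B ((β : G) * a) * modG n (β : G))) ^ (1 / 2 : ℝ) *
      (modB n m A B (β : G) * modB n m A B (a : G)) ^ (1 / 2 : ℝ) =
    modB n m A B (a : G) * (baseDet n k m A B * modA n k A B (β : G)⁻¹ *
      modG n (a : G)⁻¹ ^ (1 / 2 : ℝ)) := by
  have p1 := h.baseDet_pos
  have p2 := h.modA_pos (a : G)
  have p3 := h.modA_pos (β : G)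
  have p4 := h.modB_pos (a : G)
  have p5 := h.modB_pos (β : G)
  rw [h.modA_mul_left, h.modG_coe_right, modG_inv, h.modG_coe_left, h.modA_inv_right]
  rw [← Real.sqrt_eq_rpow, ← Real.sqrt_eq_rpow, ← Real.sqrt_eq_rpow,
    ← Real.sqrt_mul (by positivity), ← sq_eq_sq₀ (by positivity) (by positivity), mul_pow, mul_pow,
    Real.sq_sqrt (by positivity), Real.sq_sqrt (by positivity)]
  field_simp

/-- Write the integral over s = aβ as an iterated one and substitute β = b_L(zb). Then b_R(s)⁻¹z =
a_R(zb) b⁻¹, whose left `A`-factor is a_R(zb), and the argument of ψ becomes a b_L(zb) a_R(zb) = a z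
b, as in Φ̂(φ,ψ)(zb). -/
theorem IsDoubleLieGroup.piId_PhiHat_coeff {φ ψ Ψ : FrameField n G} (hφ : IsHalfDensity n φ)
    (hψ : IsHalfDensity n ψ) (hΨ : IsHalfDensity n Ψ) (z : G) :
    coeff n (piId n k m A B (PhiHat n k m A B φ ψ) Ψ) z =
      ∫ s, sliceKernel n A B (coeff n φ) (coeff n ψ) (coeff n Ψ) z s ∂(refMeasure n G) := by
  rw [h.piId_coeff (h.isBihomogeneous_PhiHat hφ.homogeneous hψ.homogeneous) hΨ.homogeneous,
    h.integral_eq_iterated (h.integrable_sliceKernel hφ.smooth.continuous hφ.compact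
      hψ.smooth.continuous hΨ.smooth.continuous z)]
  refine Eq.trans ?_ (h.integral_fibre z _)
  refine integral_congr_ae (Filter.Eventually.of_forall fun b => ?_)
  have hz : (bL A B (z * b) : G) * aR A B (z * b) = z * b := h.eq_bL_mul_aR _
  have hz' : (bL A B (z * b) : G)⁻¹ * z = (aR A B (z * b) : G) * ((b⁻¹ : B) : G) := by
    rw [inv_mul_eq_iff_eq_mul, ← mul_assoc, hz]; simp
  have hw := h.weight_eq (aR A B (z * b)) (bL A B (z * b))
  rw [hz] at hw
  simp only
  rw [h.PhiHat_coeff hφ.homogeneous hψ.homogeneous, corr, ← integral_const_mul,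
    ← integral_mul_const, ← integral_const_mul]
  refine integral_congr_ae (Filter.Eventually.of_forall fun a => ?_)
  simp only [sliceKernel]
  rw [h.bR_mul]
  have ha : aL A B ((bL A B (z * b) : G)⁻¹ * z) = aR A B (z * b) := by rw [hz', h.aL_mul]
  rw [ha, mul_assoc (a : G), hz]
  have hw' := congrArg (fun x : ℝ => (x : ℂ)) hw
  simp only [Complex.ofReal_mul] at hw'
  rw [Complex.ofReal_mul]
  linear_combination (starRingEnd ℂ (coeff n φ ((a : G) * (bL A B (z * b) : G))) *
    coeff n ψ ((a : G) * (z * b)) * coeff n Ψ ((bL A B (z * b) : G)⁻¹ * z)) * hw'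

end SliceKernel

end

end DLG

namespace DLG

set_option linter.unusedSectionVars false

noncomputable section

/-! ### Isometries of L² given by maps with a Jacobian -/

section WeightedComposition

variable {X : Type*} [MeasurableSpace X] {μ : Measure X} {J : X → ℝ} {T : X → X}

/-- The half-density `f`, carried by the inverse of a map `T` with Jacobian `J`. -/
def wcomp (J : X → ℝ) (T : X → X) (f : X → ℂ) (x : X) : ℂ := ((J x ^ (1 / 2 : ℝ) : ℝ) : ℂ) * f (T x)

/-- The function `J` is the Jacobian of the map `T` of a measure space. -/
structure IsJacobian (μ : Measure X) (J : X → ℝ) (T : X → X) : Prop where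
  measurable : Measurable J
  measurable_map : Measurable T
  pos : ∀ x, 0 < J x
  lintegral_eq : ∀ F : X → ENNReal, Measurable F →
    ∫⁻ x, ENNReal.ofReal (J x) * F (T x) ∂μ = ∫⁻ x, F x ∂μ

variable (hJ : IsJacobian μ J T)
include hJ

/-- The integral identity applied to the indicator of a null set forces the preimage to be null, as
the Jacobian is nowhere zero. So weighted composition is well defined on classes. -/
theorem IsJacobian.quasiMeasurePreserving : Measure.QuasiMeasurePreserving T μ μ := by
  refine ⟨hJ.measurable_map, Measure.AbsolutelyContinuous.mk fun s hs h0 => ?_⟩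
  have hm : Measurable (s.indicator (1 : X → ENNReal)) := measurable_one.indicator hs
  have h1 := hJ.lintegral_eq _ hm
  rw [lintegral_indicator_one hs, h0] at h1
  replace h1 := (lintegral_eq_zero_iff
    (hJ.measurable.ennreal_ofReal.mul (hm.comp hJ.measurable_map))).mp h1
  rw [Measure.map_apply hJ.measurable_map hs]
  refine measure_mono_null (fun x hx => ?_) h1
  simpa [hJ.pos x] using hx

theorem IsJacobian.stronglyMeasurable_wcomp {f : X → ℂ} (hf : StronglyMeasurable f) :
    StronglyMeasurable (wcomp J T f) :=
  (Complex.measurable_ofReal.comp (hJ.measurable.pow_const _)).stronglyMeasurable.mul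
    (hf.comp_measurable hJ.measurable_map)

theorem IsJacobian.wcomp_congr {f g : X → ℂ} (hfg : f =ᵐ[μ] g) : wcomp J T f =ᵐ[μ] wcomp J T g := by
  filter_upwards [hJ.quasiMeasurePreserving.ae_eq_comp hfg] with x hx
  exact congrArg (fun z => ((J x ^ (1 / 2 : ℝ) : ℝ) : ℂ) * z) hx

theorem IsJacobian.eLpNorm_wcomp {f : X → ℂ} (hf : StronglyMeasurable f) :
    eLpNorm (wcomp J T f) 2 μ = eLpNorm f 2 μ := by
  rw [eLpNorm_eq_lintegral_rpow_enorm_toReal (by simp) (by simp),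
    eLpNorm_eq_lintegral_rpow_enorm_toReal (by simp) (by simp), ENNReal.toReal_ofNat]
  congr 1
  rw [← hJ.lintegral_eq (fun x => ‖f x‖ₑ ^ (2 : ℝ)) (hf.measurable.enorm.pow_const _)]
  refine lintegral_congr fun x => ?_
  have hx := (hJ.pos x).le
  rw [wcomp, enorm_mul, ENNReal.mul_rpow_of_nonneg _ _ (by norm_num)]
  congr 1
  rw [← ofReal_norm, Complex.norm_real, Real.norm_of_nonneg (Real.rpow_nonneg hx _),
    ENNReal.ofReal_rpow_of_nonneg (Real.rpow_nonneg hx _) (by norm_num), ← Real.rpow_mul hx]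
  norm_num

theorem IsJacobian.memLp_wcomp (f : Lp ℂ 2 μ) : MemLp (wcomp J T f) 2 μ :=
  ⟨(hJ.stronglyMeasurable_wcomp (Lp.stronglyMeasurable f)).aestronglyMeasurable, by
    rw [hJ.eLpNorm_wcomp (Lp.stronglyMeasurable f)]; exact Lp.eLpNorm_lt_top f⟩

/-- The isometry of `L²` defined by a map with a Jacobian. -/
def IsJacobian.isometry : Lp ℂ 2 μ →ₗᵢ[ℂ] Lp ℂ 2 μ where
  toFun f := (hJ.memLp_wcomp f).toLp
  map_add' f g := by
    refine Lp.ext ?_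
    filter_upwards [(hJ.memLp_wcomp (f + g)).coeFn_toLp, (hJ.memLp_wcomp f).coeFn_toLp,
      (hJ.memLp_wcomp g).coeFn_toLp, Lp.coeFn_add ((hJ.memLp_wcomp f).toLp)
        ((hJ.memLp_wcomp g).toLp), hJ.wcomp_congr (Lp.coeFn_add f g)] with x h1 h2 h3 h4 h5
    rw [h1, h4, Pi.add_apply, h2, h3, h5]
    exact mul_add _ _ _
  map_smul' c f := by
    refine Lp.ext ?_
    filter_upwards [(hJ.memLp_wcomp (c • f)).coeFn_toLp, (hJ.memLp_wcomp f).coeFn_toLp,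
      Lp.coeFn_smul c ((hJ.memLp_wcomp f).toLp), hJ.wcomp_congr (Lp.coeFn_smul c f)]
      with x h1 h2 h4 h5
    rw [h1, RingHom.id_apply, h4, Pi.smul_apply, h2, h5]
    exact mul_left_comm _ _ _
  norm_map' f := by
    show ‖(hJ.memLp_wcomp f).toLp‖ = ‖f‖
    rw [Lp.norm_toLp, hJ.eLpNorm_wcomp (Lp.stronglyMeasurable f), Lp.norm_def]

theorem IsJacobian.coeFn_isometry (f : Lp ℂ 2 μ) : hJ.isometry f =ᵐ[μ] wcomp J T f :=
  (hJ.memLp_wcomp f).coeFn_toLp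

theorem IsJacobian.isometry_surjective {T' : X → X} (hT' : Measurable T')
    (hl : ∀ x, T' (T x) = x) : Function.Surjective hJ.isometry := by
  intro g
  -- Solve `wcomp J T f = g` pointwise, with the left inverse `T'` of `T`. Square-integrability of
  -- `f` is then read off from the isometry property.
  set f : X → ℂ := fun y => ((J (T' y) ^ (1 / 2 : ℝ) : ℝ) : ℂ)⁻¹ * g (T' y) with hf
  have hfm : StronglyMeasurable f :=
    (Complex.measurable_ofReal.comp
      ((hJ.measurable.comp hT').pow_const _)).inv.stronglyMeasurable.mul
      ((Lp.stronglyMeasurable g).comp_measurable hT')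
  have hfg : wcomp J T f = g := by
    funext x
    have h1 : ((J x ^ (1 / 2 : ℝ) : ℝ) : ℂ) ≠ 0 :=
      Complex.ofReal_ne_zero.mpr (Real.rpow_pos_of_pos (hJ.pos x) _).ne'
    rw [wcomp, hf]
    simp only [hl]
    rw [mul_inv_cancel_left₀ h1]
  have hmem : MemLp f 2 μ := ⟨hfm.aestronglyMeasurable, by
    rw [← hJ.eLpNorm_wcomp hfm, hfg]; exact Lp.eLpNorm_lt_top g⟩
  refine ⟨hmem.toLp, Lp.ext ((hJ.coeFn_isometry _).trans ((hJ.wcomp_congr hmem.coeFn_toLp).trans ?_))⟩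
  rw [hfg]

end WeightedComposition

/-! ### Density of smooth vectors in L² -/

section Density

theorem toL2_ae {X : Type*} [MeasurableSpace X] {μ : Measure X} {f : X → ℂ} (hf : MemLp f 2 μ) :
    (toL2 f : Lp ℂ 2 μ) =ᵐ[μ] f := by
  rw [toL2, dif_pos hf]
  exact hf.coeFn_toLp

variable {V H M : Type*} [NormedAddCommGroup V] [NormedSpace ℝ V] [FiniteDimensional ℝ V]
  [TopologicalSpace H] (I : ModelWithCorners ℝ V H) [TopologicalSpace M] [ChartedSpace H M]
  [MeasurableSpace M] [BorelSpace M] (μ : Measure M) [IsLocallyFiniteMeasure μ]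

theorem memLp_of_contMDiff {I : ModelWithCorners ℝ V H} {μ : Measure M} [IsLocallyFiniteMeasure μ]
    {f : M → ℂ} (hf : ContMDiff I 𝓘(ℝ, ℂ) ∞ f) (hc : HasCompactSupport f) :
    MemLp f 2 μ := hf.continuous.memLp_of_hasCompactSupport hc

/-- The classes of the smooth functions with compact support. -/
def smoothVectors : Submodule ℂ (Lp ℂ 2 μ) where
  carrier := {v | ∃ f : M → ℂ, ContMDiff I 𝓘(ℝ, ℂ) ∞ f ∧ HasCompactSupport f ∧ v = toL2 f}
  zero_mem' := ⟨0, contMDiff_const, HasCompactSupport.zero, by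
    refine Lp.ext ((Lp.coeFn_zero _ _ _).trans (toL2_ae MemLp.zero).symm)⟩
  add_mem' := by
    rintro _ _ ⟨f, hf, hfc, rfl⟩ ⟨g, hg, hgc, rfl⟩
    refine ⟨f + g, hf.add hg, hfc.add hgc, Lp.ext ?_⟩
    filter_upwards [toL2_ae (memLp_of_contMDiff (μ := μ) hf hfc),
      toL2_ae (memLp_of_contMDiff (μ := μ) hg hgc),
      toL2_ae (memLp_of_contMDiff (μ := μ) (hf.add hg) (hfc.add hgc)),
      Lp.coeFn_add (toL2 f : Lp ℂ 2 μ) (toL2 g)] with x h1 h2 h3 h4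
    rw [h4, Pi.add_apply, h1, h2, h3, Pi.add_apply]
  smul_mem' := by
    rintro c _ ⟨f, hf, hfc, rfl⟩
    have hcf : ContMDiff I 𝓘(ℝ, ℂ) ∞ (fun x => c * f x) := ContMDiff.complex_mul contMDiff_const hf
    refine ⟨fun x => c * f x, hcf, hfc.mul_left, Lp.ext ?_⟩
    filter_upwards [toL2_ae (memLp_of_contMDiff (μ := μ) hf hfc),
      toL2_ae (memLp_of_contMDiff (μ := μ) hcf hfc.mul_left),
      Lp.coeFn_smul c (toL2 f : Lp ℂ 2 μ)] with x h1 h2 h3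
    rw [h3, Pi.smul_apply, h1, h2, smul_eq_mul]

theorem locallyIntegrable_L2 {X : Type*} [TopologicalSpace X] [MeasurableSpace X]
    {μ : Measure X} [IsLocallyFiniteMeasure μ] (f : Lp ℂ 2 μ) :
    LocallyIntegrable f μ :=
  (Lp.memLp f).locallyIntegrable (by norm_num)

/-- A vector orthogonal to all smooth test functions is locally integrable and integrates to zero
against each of them, hence vanishes almost everywhere. -/
theorem dense_smoothVectors [IsManifold I ∞ M] [T2Space M] [SigmaCompactSpace M] :
    Dense (smoothVectors I μ : Set (Lp ℂ 2 μ)) := by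
  rw [Submodule.dense_iff_topologicalClosure_eq_top, Submodule.topologicalClosure_eq_top_iff,
    Submodule.eq_bot_iff]
  intro v hv
  refine Lp.ext (Filter.EventuallyEq.trans ?_ (Lp.coeFn_zero _ _ _).symm)
  refine ae_eq_zero_of_integral_contMDiff_smul_eq_zero I (locallyIntegrable_L2 v) fun g hg hgc => ?_
  have hs : ContMDiff I 𝓘(ℝ, ℂ) ∞ (fun x => ((g x : ℝ) : ℂ)) :=
    Complex.ofRealCLM.contDiff.comp_contMDiff hg
  have hsc : HasCompactSupport (fun x => ((g x : ℝ) : ℂ)) := hgc.comp_left Complex.ofReal_zero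
  have h1 := (Submodule.mem_orthogonal _ _).mp hv (toL2 fun x => ((g x : ℝ) : ℂ))
    ⟨_, hs, hsc, rfl⟩
  rw [L2.inner_def] at h1
  rw [← h1]
  refine integral_congr_ae ?_
  filter_upwards [toL2_ae (memLp_of_contMDiff (μ := μ) hs hsc)] with x hx
  rw [hx, RCLike.inner_apply, Complex.conj_ofReal, mul_comm, Complex.real_smul]

end Density

end

end DLG

namespace DLG

set_option linter.unusedSectionVars false

noncomputable section

/-! ### Haar properties for nonnegative functions -/

section Translations

variable {n : ℕ} {H : Type*} [Group H] [TopologicalSpace H] [ChartedSpace (E n) H]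
  [LieGroup (𝓡 n) ∞ H] [MeasurableSpace H] [BorelSpace H] [SecondCountableTopology H]

theorem lintegral_refMeasure_mul_right (c : H) {f : H → ENNReal} (hf : Measurable f) :
    ENNReal.ofReal (modG n c)⁻¹ * ∫⁻ h, f (h * c) ∂(refMeasure n H) =
      ∫⁻ h, f h ∂(refMeasure n H) := by
  have hc : Continuous fun x : H => x * c :=
    (contMDiff_mul_right (I := 𝓡 n) (n := ∞) (a := c)).continuous
  have h1 := lintegral_refMeasure_diffeo
    ({ toEquiv := Equiv.mulRight c,
       continuous_toFun := hc
       continuous_invFun := (contMDiff_mul_right (I := 𝓡 n) (n := ∞) (a := c⁻¹)).continuous } :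
      H ≃ₜ H) (contMDiff_mul_right (I := 𝓡 n) (n := ∞) (a := c))
    (contMDiff_mul_right (I := 𝓡 n) (n := ∞) (a := c⁻¹)) hf
  refine (lintegral_const_mul _ (hf.comp hc.measurable)).symm.trans (Eq.trans ?_ h1)
  refine lintegral_congr fun x => ?_
  have h2 : adet (gd (𝓡 n) (𝓡 n) (fun x => x * c) x) = (modG n c)⁻¹ := by
    rw [gd_mul_right, ← modG_inv]
    rfl
  rw [← h2]
  rfl

theorem lintegral_refMeasure_mul_left (c : H) {f : H → ENNReal} (hf : Measurable f) :
    ∫⁻ h, f (c * h) ∂(refMeasure n H) = ∫⁻ h, f h ∂(refMeasure n H) := by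
  have hc : Continuous fun x : H => c * x :=
    (contMDiff_mul_left (I := 𝓡 n) (n := ∞) (a := c)).continuous
  have h1 := lintegral_refMeasure_diffeo
    ({ toEquiv := Equiv.mulLeft c,
       continuous_toFun := hc
       continuous_invFun := (contMDiff_mul_left (I := 𝓡 n) (n := ∞) (a := c⁻¹)).continuous } :
      H ≃ₜ H) (contMDiff_mul_left (I := 𝓡 n) (n := ∞) (a := c))
    (contMDiff_mul_left (I := 𝓡 n) (n := ∞) (a := c⁻¹)) hf
  rw [← h1]
  refine lintegral_congr fun x => ?_
  have h2 : adet (gd (𝓡 n) (𝓡 n) (fun x => c * x) x) = 1 := by rw [gd_mul_left, adet_id]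
  have h3 : ENNReal.ofReal (1 : ℝ) * f (c * x) = f (c * x) := by simp
  exact h3.symm.trans (by rw [← h2]; rfl)

end Translations

/-! ### Tensor products of vectors and slices of operators -/

section Tensor

variable {n : ℕ} {G : Type*} [Group G] [TopologicalSpace G] [ChartedSpace (E n) G]
  [LieGroup (𝓡 n) ∞ G] [MeasurableSpace G] [BorelSpace G] [SecondCountableTopology G]

theorem eLpNorm_tensor {X : Type*} [MeasurableSpace X] {μ : Measure X} [SigmaFinite μ]
    {f g : X → ℂ} (hf : AEStronglyMeasurable f μ) (hg : AEStronglyMeasurable g μ) :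
    eLpNorm (fun p : X × X => f p.1 * g p.2) 2 (μ.prod μ) = eLpNorm f 2 μ * eLpNorm g 2 μ := by
  rw [eLpNorm_eq_lintegral_rpow_enorm_toReal (by simp) (by simp),
    eLpNorm_eq_lintegral_rpow_enorm_toReal (by simp) (by simp),
    eLpNorm_eq_lintegral_rpow_enorm_toReal (by simp) (by simp), ENNReal.toReal_ofNat,
    ← ENNReal.mul_rpow_of_nonneg _ _ (by norm_num),
    ← lintegral_prod_mul (hf.aemeasurable.enorm.pow_const _) (hg.aemeasurable.enorm.pow_const _)]
  congr 1
  refine lintegral_congr fun p => ?_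
  rw [enorm_mul, ENNReal.mul_rpow_of_nonneg _ _ (by norm_num)]

theorem memLp_tensor {X : Type*} [MeasurableSpace X] {μ : Measure X} [SigmaFinite μ]
    {f g : X → ℂ} (hf : MemLp f 2 μ) (hg : MemLp g 2 μ) :
    MemLp (fun p : X × X => f p.1 * g p.2) 2 (μ.prod μ) :=
  ⟨hf.1.comp_fst.mul hg.1.comp_snd, by
    rw [eLpNorm_tensor hf.1 hg.1]; exact ENNReal.mul_lt_top hf.2 hg.2⟩

theorem tensor_ae (x y : L2 n G) : (tensor n x y : G × G → ℂ) =ᵐ[(refMeasure n G).prod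
    (refMeasure n G)] fun p => x p.1 * y p.2 := toL2_ae (memLp_tensor (Lp.memLp x) (Lp.memLp y))

theorem norm_tensor (x y : L2 n G) : ‖tensor n x y‖ = ‖x‖ * ‖y‖ := by
  rw [Lp.norm_def, eLpNorm_congr_ae (tensor_ae x y),
    eLpNorm_tensor (Lp.aestronglyMeasurable x) (Lp.aestronglyMeasurable y), ENNReal.toReal_mul]
  rfl

theorem ae_fst_of_ae {p : G → Prop} (hp : ∀ᵐ x ∂(refMeasure n G), p x) :
    ∀ᵐ q ∂((refMeasure n G).prod (refMeasure n G)), p q.1 :=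
  Measure.quasiMeasurePreserving_fst.ae hp

theorem ae_snd_of_ae {p : G → Prop} (hp : ∀ᵐ x ∂(refMeasure n G), p x) :
    ∀ᵐ q ∂((refMeasure n G).prod (refMeasure n G)), p q.2 :=
  Measure.quasiMeasurePreserving_snd.ae hp

/-- The tensor product of vectors, as a bounded bilinear map. -/
def tensorCLM (n : ℕ) (G : Type*) [Group G] [TopologicalSpace G] [ChartedSpace (E n) G]
    [LieGroup (𝓡 n) ∞ G] [MeasurableSpace G] [BorelSpace G] [SecondCountableTopology G] :
    L2 n G →L[ℂ] L2 n G →L[ℂ] L2₂ n G :=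
  LinearMap.mkContinuous₂ (LinearMap.mk₂ ℂ (tensor n)
    (fun x x' y => by
      refine Lp.ext ?_
      filter_upwards [tensor_ae (x + x') y, tensor_ae x y, tensor_ae x' y,
        Lp.coeFn_add (tensor n x y) (tensor n x' y), ae_fst_of_ae (Lp.coeFn_add x x')]
        with p h1 h2 h3 h4 h5
      rw [h1, h4, Pi.add_apply, h2, h3, h5, Pi.add_apply, add_mul])
    (fun c x y => by
      refine Lp.ext ?_
      filter_upwards [tensor_ae (c • x) y, tensor_ae x y,
        Lp.coeFn_smul c (tensor n x y), ae_fst_of_ae (Lp.coeFn_smul c x)]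
        with p h1 h2 h4 h5
      rw [h1, h4, Pi.smul_apply, h2, h5, Pi.smul_apply, smul_eq_mul, smul_eq_mul, mul_assoc])
    (fun x y y' => by
      refine Lp.ext ?_
      filter_upwards [tensor_ae x (y + y'), tensor_ae x y, tensor_ae x y',
        Lp.coeFn_add (tensor n x y) (tensor n x y'), ae_snd_of_ae (Lp.coeFn_add y y')]
        with p h1 h2 h3 h4 h5
      rw [h1, h4, Pi.add_apply, h2, h3, h5, Pi.add_apply, mul_add])
    (fun c x y => by
      refine Lp.ext ?_
      filter_upwards [tensor_ae x (c • y), tensor_ae x y,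
        Lp.coeFn_smul c (tensor n x y), ae_snd_of_ae (Lp.coeFn_smul c y)]
        with p h1 h2 h4 h5
      rw [h1, h4, Pi.smul_apply, h2, h5, Pi.smul_apply, smul_eq_mul, smul_eq_mul, mul_left_comm]))
    1 (fun x y => by rw [one_mul]; exact (norm_tensor x y).le)

/-- The operator `(η_{xy} ⊗ id) W`. -/
def sliceOp (W : L2₂ n G ≃ₗᵢ[ℂ] L2₂ n G) (x y : L2 n G) : L2 n G →L[ℂ] L2 n G :=
  ContinuousLinearMap.adjoint (tensorCLM n G x) ∘L
    (W.toContinuousLinearEquiv : L2₂ n G →L[ℂ] L2₂ n G) ∘L tensorCLM n G y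

/-- A bounded operator is determined by its matrix elements, and those of the slice are produced by
the adjoint of z ↦ x ⊗ z. -/
theorem isSlice_iff {W : L2₂ n G ≃ₗᵢ[ℂ] L2₂ n G} {x y : L2 n G} {T : L2 n G →L[ℂ] L2 n G} :
    IsSlice W x y T ↔ T = sliceOp W x y := by
  have h1 : ∀ z t : L2 n G, ⟪z, sliceOp W x y t⟫_ℂ = ⟪tensor n x z, W (tensor n y t)⟫_ℂ :=
    fun z t => (ContinuousLinearMap.adjoint_inner_right (tensorCLM n G x) z
      (W (tensorCLM n G y t)) :)
  constructor
  · intro hT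
    refine ContinuousLinearMap.ext fun t => ext_inner_left ℂ fun z => ?_
    rw [hT, h1]
  · rintro rfl
    exact h1

/-- Joint continuity in the two vectors, in operator norm, is what allows general vectors to be
replaced by smooth ones. -/
theorem continuous_sliceOp (W : L2₂ n G ≃ₗᵢ[ℂ] L2₂ n G) :
    Continuous (Function.uncurry (sliceOp W)) := by
  have h1 : Continuous fun p : L2 n G × L2 n G =>
      ContinuousLinearMap.adjoint (tensorCLM n G p.1) :=
    ContinuousLinearMap.adjoint.continuous.comp ((tensorCLM n G).continuous.comp continuous_fst)
  exact h1.clm_comp (continuous_const.clm_comp ((tensorCLM n G).continuous.comp continuous_snd))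

end Tensor

/-! ### Half-densities with prescribed coefficients -/

section HalfDensities

variable {n : ℕ} {G : Type*} [Group G] [TopologicalSpace G] [ChartedSpace (E n) G]
  [LieGroup (𝓡 n) ∞ G]

theorem det_sum_smul {ι V : Type*} [Fintype ι] [DecidableEq ι] [AddCommGroup V] [Module ℝ V]
    (b : Module.Basis ι ℝ V) (M : Matrix ι ι ℝ) (u : ι → V) :
    b.det (fun j => ∑ i, M i j • u i) = M.det * b.det u := by
  rw [Module.Basis.det_apply, Module.Basis.det_apply, mul_comm, ← Matrix.det_mul]
  congr 1
  ext i j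
  simp [Module.Basis.toMatrix_apply, Matrix.mul_apply, mul_comm]

/-- The half-density on `G` with a given coefficient. -/
def ofCoeff (n : ℕ) {G : Type*} [Group G] [TopologicalSpace G] [ChartedSpace (E n) G]
    (f : G → ℂ) : FrameField n G := fun g u =>
  ((|(EuclideanSpace.basisFun (Fin n) ℝ).toBasis.det fun i =>
    td (𝓡 n) (𝓡 n) (fun x : G => g⁻¹ * x) g (u i)| ^ (1 / 2 : ℝ) : ℝ) : ℂ) * f g

theorem coeff_ofCoeff (f : G → ℂ) : coeff n (ofCoeff n f) = f := by
  funext g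
  have h1 : (fun i => td (𝓡 n) (𝓡 n) (fun x : G => g⁻¹ * x) g (leftFrame n g i)) =
      (EuclideanSpace.basisFun (Fin n) ℝ).toBasis := by
    funext i
    have h2 := congrArg (fun L : E n →L[ℝ] E n => L (stdVec n i))
      (td_mul_left_inverse (I₁ := 𝓡 n) g)
    refine Eq.trans h2 ?_
    simp [stdVec]
  refine (congrArg (fun z => ((|(EuclideanSpace.basisFun (Fin n) ℝ).toBasis.det z| ^ (1 / 2 : ℝ) :
    ℝ) : ℂ) * f g) h1).trans ?_
  rw [Module.Basis.det_self]
  simp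

theorem isHalfDensity_ofCoeff {f : G → ℂ} (hf : ContMDiff (𝓡 n) 𝓘(ℝ, ℂ) ∞ f)
    (hc : HasCompactSupport f) : IsHalfDensity n (ofCoeff n f) := by
  refine ⟨fun g M u => ?_, by rwa [coeff_ofCoeff], by rwa [coeff_ofCoeff]⟩
  have h1 : (fun j => td (𝓡 n) (𝓡 n) (fun x : G => g⁻¹ * x) g (∑ i, M i j • u i)) =
      fun j => ∑ i, M i j • td (𝓡 n) (𝓡 n) (fun x : G => g⁻¹ * x) g (u i) := funext fun j =>
    map_sum_smul (td (𝓡 n) (𝓡 n) (fun x : G => g⁻¹ * x) g : E n →ₗ[ℝ] E n) _ _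
  refine (congrArg (fun z => ((|(EuclideanSpace.basisFun (Fin n) ℝ).toBasis.det z| ^ (1 / 2 : ℝ) :
    ℝ) : ℂ) * f g) h1).trans ?_
  rw [det_sum_smul, abs_mul, Real.mul_rpow (abs_nonneg _) (abs_nonneg _), Complex.ofReal_mul,
    mul_assoc]
  rfl

/-- The half-density on `G × G` with a given coefficient. -/
def ofCoeff₂ (n : ℕ) {G : Type*} [Group G] [TopologicalSpace G] [ChartedSpace (E n) G]
    (f : G × G → ℂ) : FrameField₂ n G := fun p u =>
  ((|((EuclideanSpace.basisFun (Fin n) ℝ).toBasis.prod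
      (EuclideanSpace.basisFun (Fin n) ℝ).toBasis).det fun i =>
    td ((𝓡 n).prod (𝓡 n)) ((𝓡 n).prod (𝓡 n)) (fun x : G × G => p⁻¹ * x) p (u i)| ^ (1 / 2 : ℝ) : ℝ)
      : ℂ) * f p

theorem coeff₂_ofCoeff₂ (f : G × G → ℂ) : coeff₂ n (ofCoeff₂ n f) = f := by
  funext p
  have h1 : (fun i => td ((𝓡 n).prod (𝓡 n)) ((𝓡 n).prod (𝓡 n)) (fun x : G × G => p⁻¹ * x) p
      (leftFrame₂ n p i)) = (EuclideanSpace.basisFun (Fin n) ℝ).toBasis.prod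
        (EuclideanSpace.basisFun (Fin n) ℝ).toBasis := by
    funext i
    have h2 := congrArg (fun L : E n × E n →L[ℝ] E n × E n => L (stdVec₂ n i))
      (td_mul_left_inverse (I₁ := (𝓡 n).prod (𝓡 n)) p)
    refine (congrArg (fun v => td ((𝓡 n).prod (𝓡 n)) ((𝓡 n).prod (𝓡 n)) (fun x : G × G => p⁻¹ * x)
      p v) (leftFrame₂_eq p i)).trans (h2.trans (stdVec₂_eq i))
  refine (congrArg (fun z => ((|((EuclideanSpace.basisFun (Fin n) ℝ).toBasis.prod
      (EuclideanSpace.basisFun (Fin n) ℝ).toBasis).det z| ^ (1 / 2 : ℝ) :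
    ℝ) : ℂ) * f p) h1).trans ?_
  rw [Module.Basis.det_self]
  simp

theorem isHalfDensity₂_ofCoeff₂ {f : G × G → ℂ}
    (hf : ContMDiff ((𝓡 n).prod (𝓡 n)) 𝓘(ℝ, ℂ) ∞ f)
    (hc : HasCompactSupport f) : IsHalfDensity₂ n (ofCoeff₂ n f) := by
  refine ⟨fun p M u => ?_, by rwa [coeff₂_ofCoeff₂], by rwa [coeff₂_ofCoeff₂]⟩
  have h1 : (fun j => td ((𝓡 n).prod (𝓡 n)) ((𝓡 n).prod (𝓡 n)) (fun x : G × G => p⁻¹ * x) p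
        (∑ i, M i j • u i)) = fun j => ∑ i, M i j • td ((𝓡 n).prod (𝓡 n)) ((𝓡 n).prod (𝓡 n))
          (fun x : G × G => p⁻¹ * x) p (u i) := funext fun j =>
    map_sum_smul (td ((𝓡 n).prod (𝓡 n)) ((𝓡 n).prod (𝓡 n)) (fun x : G × G => p⁻¹ * x) p :
      E n × E n →ₗ[ℝ] E n × E n) _ _
  refine (congrArg (fun z => ((|((EuclideanSpace.basisFun (Fin n) ℝ).toBasis.prod
      (EuclideanSpace.basisFun (Fin n) ℝ).toBasis).det z| ^ (1 / 2 : ℝ) :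
    ℝ) : ℂ) * f p) h1).trans ?_
  rw [det_sum_smul, abs_mul, Real.mul_rpow (abs_nonneg _) (abs_nonneg _), Complex.ofReal_mul,
    mul_assoc]
  rfl

end HalfDensities

end

end DLG

namespace DLG

set_option linter.unusedSectionVars false

noncomputable section

/-! ### Existence and uniqueness of the unitary W -/

section MultUnitary

variable {n k m : ℕ} {G : Type*} [Group G] [TopologicalSpace G] [ChartedSpace (E n) G]
  [LieGroup (𝓡 n) ∞ G]
  {A B : Subgroup G} [ChartedSpace (E k) A] [LieGroup (𝓡 k) ∞ A]
  [ChartedSpace (E m) B] [LieGroup (𝓡 m) ∞ B] [SecondCountableTopology G]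

theorem sigmaCompactSpace_of_lieGroup (n : ℕ) (G : Type*) [TopologicalSpace G]
    [ChartedSpace (E n) G] [SecondCountableTopology G] : SigmaCompactSpace G := by
  have := ChartedSpace.locallyCompactSpace (E n) G
  infer_instance

/-- The Jacobian of the inverse of the pentagonal map. -/
def jacW (n : ℕ) {G : Type*} [Group G] [TopologicalSpace G] [ChartedSpace (E n) G]
    (A B : Subgroup G) (p : G × G) : ℝ := modG n (aL A B ((bR A B p.1 : G)⁻¹ * p.2) : G)⁻¹

/-- The pentagonal map. -/
def pentMap (A B : Subgroup G) (p : G × G) : G × G :=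
  (p.1 * (aL A B p.2 : G)⁻¹, (bR A B (p.1 * (aL A B p.2 : G)⁻¹) : G) * p.2)

variable (h : IsDoubleLieGroup n k m A B)
include h

theorem IsDoubleLieGroup.pentMap_Winv (p : G × G) : pentMap A B (Winv A B p) = p := by
  simp [pentMap, Winv]

theorem IsDoubleLieGroup.continuous_jacW : Continuous (jacW n A B) := by
  have : IsTopologicalGroup G := topologicalGroup_of_lieGroup (𝓡 n) ∞
  have e1 : Continuous fun p : G × G => (bR A B p.1 : G)⁻¹ * p.2 :=
    (((h.smooth_right.comp h.contMDiff_bR).continuous.comp continuous_fst).inv).mul continuous_snd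
  exact continuous_modG.comp ((h.smooth_left.comp h.contMDiff_aL).continuous.comp e1).inv

theorem IsDoubleLieGroup.continuous_pentMap : Continuous (pentMap A B) := by
  have : IsTopologicalGroup G := topologicalGroup_of_lieGroup (𝓡 n) ∞
  have e1 : Continuous fun p : G × G => p.1 * (aL A B p.2 : G)⁻¹ :=
    continuous_fst.mul ((h.smooth_left.comp h.contMDiff_aL).continuous.comp continuous_snd).inv
  exact e1.prodMk
    (((h.smooth_right.comp h.contMDiff_bR).continuous.comp e1).mul continuous_snd)

theorem IsDoubleLieGroup.continuous_Winv : Continuous (Winv A B) := h.mdiff_Winv.continuous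

variable [MeasurableSpace G] [BorelSpace G]

theorem IsDoubleLieGroup.isJacobian :
    IsJacobian ((refMeasure n G).prod (refMeasure n G)) (jacW n A B) (Winv A B) := by
  refine ⟨h.continuous_jacW.measurable, h.continuous_Winv.measurable, fun p => modG_pos _,
    fun F hF => ?_⟩
  have : IsTopologicalGroup G := topologicalGroup_of_lieGroup (𝓡 n) ∞
  have ca : Continuous fun t : G => (aL A B t : G) := (h.smooth_left.comp h.contMDiff_aL).continuous
  -- `Φ` is the integrand after the left-invariant substitution t ↦ b_R(s) t, which removes the
  -- dependence on b_R(s). Exchanging the integrals and translating s on the right by a_L(t) then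
  -- cancels the modular factor.
  obtain ⟨Φ, hΦ⟩ : ∃ Φ : G × G → ENNReal, Φ = fun p =>
      ENNReal.ofReal (modG n (aL A B p.2 : G))⁻¹ * F (p.1 * aL A B p.2, p.2) := ⟨_, rfl⟩
  have m1 : Measurable Φ := by
    rw [hΦ]
    refine Measurable.mul ?_ (hF.comp ?_)
    · have c1 : Continuous fun p : G × G => (modG n (aL A B p.2 : G))⁻¹ :=
        (continuous_modG.comp (ca.comp continuous_snd)).inv₀ fun p => (modG_pos _).ne'
      exact c1.measurable.ennreal_ofReal
    · have c2 : Continuous fun p : G × G => (p.1 * (aL A B p.2 : G), p.2) :=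
        (continuous_fst.mul (ca.comp continuous_snd)).prodMk continuous_snd
      exact c2.measurable
  refine (lintegral_prod _ (h.continuous_jacW.measurable.ennreal_ofReal.mul
    (hF.comp h.continuous_Winv.measurable)).aemeasurable).trans ?_
  have e1 : ∀ s : G, ∫⁻ t, ENNReal.ofReal (jacW n A B (s, t)) * F (Winv A B (s, t))
      ∂(refMeasure n G) = ∫⁻ t, Φ (s, t) ∂(refMeasure n G) := fun s => by
    have m2 : Measurable fun t : G => Φ (s, t) := m1.comp (measurable_prodMk_left (x := s))
    have m3 : ∀ t : G, ENNReal.ofReal (jacW n A B (s, t)) * F (Winv A B (s, t)) =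
        Φ (s, (bR A B s : G)⁻¹ * t) := fun t => by
      rw [jacW, modG_inv, Winv, hΦ]
    exact (lintegral_congr m3).trans (lintegral_refMeasure_mul_left (n := n) (bR A B s : G)⁻¹ m2)
  refine (lintegral_congr e1).trans ?_
  rw [lintegral_lintegral_swap (f := fun s t => Φ (s, t)) m1.aemeasurable, lintegral_prod_symm _ hF.aemeasurable]
  refine lintegral_congr fun t => ?_
  rw [hΦ]
  have m4 : Measurable fun s : G => F (s, t) := hF.comp (measurable_prodMk_right (y := t))
  have m5 : Measurable fun s : G => F (s * aL A B t, t) :=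
    m4.comp (continuous_mul_const (aL A B t : G)).measurable
  exact (lintegral_const_mul _ m5).trans
    (lintegral_refMeasure_mul_right (n := n) (aL A B t : G) m4)

omit h in
theorem IsHalfDensity₂.memLp {Ψ : FrameField₂ n G} (hΨ : IsHalfDensity₂ n Ψ) :
    MemLp (coeff₂ n Ψ) 2 ((refMeasure n G).prod (refMeasure n G)) :=
  memLp_of_contMDiff hΨ.smooth hΨ.compact

omit h in
theorem IsHalfDensity.memLp {φ : FrameField n G} (hφ : IsHalfDensity n φ) :
    MemLp (coeff n φ) 2 (refMeasure n G) :=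
  memLp_of_contMDiff hφ.smooth hφ.compact

theorem IsDoubleLieGroup.isometry_vec₂ {Ψ : FrameField₂ n G} (hΨ : IsHalfDensity₂ n Ψ) :
    h.isJacobian.isometry (vec₂ n Ψ) =ᵐ[(refMeasure n G).prod (refMeasure n G)]
      coeff₂ n (pushW n A B Ψ) := by
  have h1 : coeff₂ n (pushW n A B Ψ) = wcomp (jacW n A B) (Winv A B) (coeff₂ n Ψ) :=
    funext fun p => h.pushW_coeff hΨ.homogeneous p
  rw [h1]
  exact (h.isJacobian.coeFn_isometry _).trans (h.isJacobian.wcomp_congr (toL2_ae hΨ.memLp))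

/-- The push-forward of smooth half-densities is the weighted composition with the Jacobian of the
inverse pentagonal map, and smooth half-densities are dense. Hence W is prescribed on the whole
Hilbert space, and existence and uniqueness reduce to the isometry being onto. -/
theorem IsDoubleLieGroup.isMultUnitary_iff [T2Space G] {W : L2₂ n G ≃ₗᵢ[ℂ] L2₂ n G} :
    IsMultUnitary n A B W ↔ ∀ f, W f = h.isJacobian.isometry f := by
  constructor
  · intro hW
    have := sigmaCompactSpace_of_lieGroup n G
    refine fun f => congrFun (Continuous.ext_on (dense_smoothVectors ((𝓡 n).prod (𝓡 n))
      ((refMeasure n G).prod (refMeasure n G))) W.continuous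
        h.isJacobian.isometry.continuous ?_) f
    rintro _ ⟨f, hf, hfc, rfl⟩
    have h1 : toL2 f = vec₂ n (ofCoeff₂ n f) := by rw [vec₂, coeff₂_ofCoeff₂]
    rw [h1]
    have hΨ := isHalfDensity₂_ofCoeff₂ hf hfc
    exact Lp.ext ((hW _ hΨ).trans (h.isometry_vec₂ hΨ).symm)
  · intro hW Ψ hΨ
    rw [hW]
    exact h.isometry_vec₂ hΨ

theorem IsDoubleLieGroup.existsUnique_multUnitary [T2Space G] :
    ∃! W : L2₂ n G ≃ₗᵢ[ℂ] L2₂ n G, IsMultUnitary n A B W := by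
  refine ⟨LinearIsometryEquiv.ofSurjective h.isJacobian.isometry
    (h.isJacobian.isometry_surjective h.continuous_pentMap.measurable h.pentMap_Winv),
    h.isMultUnitary_iff.mpr fun f => rfl, fun W hW => ?_⟩
  exact LinearIsometryEquiv.ext fun f => h.isMultUnitary_iff.mp hW f

end MultUnitary

end

end DLG

namespace DLG

set_option linter.unusedSectionVars false

noncomputable section

/-! ### Slices as operators π_id, and the inclusion of algebras -/

section Algebras

variable {n k m : ℕ} {G : Type*} [Group G] [TopologicalSpace G] [ChartedSpace (E n) G]
  [LieGroup (𝓡 n) ∞ G]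
  {A B : Subgroup G} [ChartedSpace (E k) A] [LieGroup (𝓡 k) ∞ A]
  [ChartedSpace (E m) B] [LieGroup (𝓡 m) ∞ B] [SecondCountableTopology G]
  [MeasurableSpace G] [BorelSpace G]

theorem tensor_toL2_ae {f g : G → ℂ} (hf : MemLp f 2 (refMeasure n G))
    (hg : MemLp g 2 (refMeasure n G)) :
    (tensor n (toL2 f) (toL2 g) : G × G → ℂ) =ᵐ[(refMeasure n G).prod (refMeasure n G)]
      fun p => f p.1 * g p.2 := by
  filter_upwards [tensor_ae (toL2 f) (toL2 g), ae_fst_of_ae (toL2_ae hf), ae_snd_of_ae (toL2_ae hg)]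
    with p h1 h2 h3
  rw [h1, h2, h3]

variable (h : IsDoubleLieGroup n k m A B)
include h

/-- The integration is over the compact support of `f₁`. Continuity supplies the local integrability
needed to identify the function by testing. -/
theorem IsDoubleLieGroup.continuous_integral_sliceKernel {f₁ f₂ f : G → ℂ} (c₁ : Continuous f₁)
    (hc : HasCompactSupport f₁) (c₂ : Continuous f₂) (c : Continuous f) :
    Continuous fun z => ∫ s, sliceKernel n A B f₁ f₂ f z s ∂(refMeasure n G) := by
  have : LocallyCompactSpace G := ChartedSpace.locallyCompactSpace (E n) G
  have h1 : ∀ z, ∫ s, sliceKernel n A B f₁ f₂ f z s ∂(refMeasure n G) =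
      ∫ s in tsupport f₁, sliceKernel n A B f₁ f₂ f z s ∂(refMeasure n G) := fun z => by
    refine (setIntegral_eq_integral_of_forall_compl_eq_zero fun s hs => ?_).symm
    rw [sliceKernel, image_eq_zero_of_notMem_tsupport hs, map_zero, zero_mul]
  simp only [h1]
  refine continuous_parametric_integral_of_continuous ?_ hc
  have e1 : Continuous fun p : G × G => ((((jacW n A B p.swap) ^ (1 / 2 : ℝ) : ℝ) : ℂ) *
      (f₂ (Winv A B p.swap).1 * f (Winv A B p.swap).2)) := by
    have e2 : Continuous fun p : G × G => Winv A B p.swap :=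
      h.continuous_Winv.comp continuous_swap
    exact (Complex.continuous_ofReal.comp ((h.continuous_jacW.comp continuous_swap).rpow_const
      fun p => Or.inl (modG_pos _).ne')).mul
      ((c₂.comp (continuous_fst.comp e2)).mul (c.comp (continuous_snd.comp e2)))
  exact (Complex.continuous_conj.comp (c₁.comp continuous_snd)).mul e1

/-- The matrix elements of the slice against smooth test functions are, by Fubini, those of the
integral of `sliceKernel`, which is the coefficient of π_id(Φ̂(φ,ψ))Ψ. The slice is bounded by
construction, so boundedness of π_id(Φ̂(φ,ψ)) comes for free. -/
theorem IsDoubleLieGroup.isPiId_sliceOp [T2Space G] {W : L2₂ n G ≃ₗᵢ[ℂ] L2₂ n G}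
    (hW : IsMultUnitary n A B W) {φ ψ : FrameField n G} (hφ : IsHalfDensity n φ)
    (hψ : IsHalfDensity n ψ) :
    IsPiId n k m A B (PhiHat n k m A B φ ψ) (sliceOp W (vec n φ) (vec n ψ)) := by
  intro Ψ hΨ
  have := sigmaCompactSpace_of_lieGroup n G
  set K : G → ℂ := fun z => ∫ s, sliceKernel n A B (coeff n φ) (coeff n ψ) (coeff n Ψ) z s
    ∂(refMeasure n G) with hK
  have hK1 : coeff n (piId n k m A B (PhiHat n k m A B φ ψ) Ψ) = K :=
    funext fun z => h.piId_PhiHat_coeff hφ hψ hΨ z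
  have hKc : Continuous K := h.continuous_integral_sliceKernel hφ.smooth.continuous hφ.compact
    hψ.smooth.continuous hΨ.smooth.continuous
  rw [hK1]
  refine ae_eq_of_integral_contMDiff_smul_eq (𝓡 n) (locallyIntegrable_L2 _)
    hKc.locallyIntegrable fun g hg hgc => ?_
  have hs : ContMDiff (𝓡 n) 𝓘(ℝ, ℂ) ∞ (fun x => ((g x : ℝ) : ℂ)) :=
    Complex.ofRealCLM.contDiff.comp_contMDiff hg
  have hsc : HasCompactSupport (fun x => ((g x : ℝ) : ℂ)) := hgc.comp_left Complex.ofReal_zero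
  have hgm : MemLp (fun x => ((g x : ℝ) : ℂ)) 2 (refMeasure n G) := memLp_of_contMDiff hs hsc
  set T := sliceOp W (vec n φ) (vec n ψ) with hT
  have h1 : ⟪(toL2 fun x => ((g x : ℝ) : ℂ) : L2 n G), T (vec n Ψ)⟫_ℂ =
      ∫ x, g x • (T (vec n Ψ) : G → ℂ) x ∂(refMeasure n G) := by
    rw [L2.inner_def]
    refine integral_congr_ae ?_
    filter_upwards [toL2_ae hgm] with x hx
    rw [hx, RCLike.inner_apply, Complex.conj_ofReal, mul_comm, Complex.real_smul]
  rw [← h1, isSlice_iff.mpr hT, L2.inner_def]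
  have h2 : (fun p : G × G => ⟪(tensor n (vec n φ) (toL2 fun x => ((g x : ℝ) : ℂ)) : G × G → ℂ) p,
      (W (tensor n (vec n ψ) (vec n Ψ)) : G × G → ℂ) p⟫_ℂ)
      =ᵐ[(refMeasure n G).prod (refMeasure n G)] fun p => ((g p.2 : ℝ) : ℂ) *
        sliceKernel n A B (coeff n φ) (coeff n ψ) (coeff n Ψ) p.2 p.1 := by
    rw [h.isMultUnitary_iff.mp hW]
    filter_upwards [tensor_toL2_ae hφ.memLp hgm, h.isJacobian.coeFn_isometry
      (tensor n (vec n ψ) (vec n Ψ)), h.isJacobian.wcomp_congr (tensor_toL2_ae hψ.memLp hΨ.memLp)]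
      with p h3 h4 h5
    have h3' : (tensor n (vec n φ) (toL2 fun x => ((g x : ℝ) : ℂ)) : G × G → ℂ) p = _ := h3
    rw [h3', h4]
    refine (congrArg (fun w => ⟪coeff n φ p.1 * ((g p.2 : ℝ) : ℂ), w⟫_ℂ) h5).trans ?_
    rw [RCLike.inner_apply, map_mul, Complex.conj_ofReal]
    simp only [wcomp, sliceKernel, jacW, Winv]
    ring
  -- Integrability on `G × G` is that of an inner product of two L² functions, so no estimate of the
  -- kernel is needed.
  rw [integral_congr_ae h2, integral_prod_symm _ ((integrable_congr h2).mp (L2.integrable_inner _ _))]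
  refine integral_congr_ae (Filter.Eventually.of_forall fun z => ?_)
  simp only
  rw [integral_const_mul, Complex.real_smul]

/-- Since `B` is closed, `b ↦ z b` is a closed embedding, so a compactly supported bidensity has
compact support along each left fibre. The lemma is needed for additivity of Ω ↦ π_id(Ω). -/
theorem IsDoubleLieGroup.integrable_piId [T2Space G] {Ω : BiField n m B}
    (hΩ : IsBidensity n m B Ω) {Ψ : FrameField n G} (hΨ : IsHalfDensity n Ψ) (z : G) :
    Integrable (fun b : B => Ω (z * b) (lFrame n m B (z * b)) (rFrame n m B (z * b)) *
        ((((modB n m A B (bL A B (z * b) : G) *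
          modB n m A B (aR A B (z * b) : G)) ^ (1 / 2 : ℝ) : ℝ) : ℂ) *
        coeff n Ψ ((bL A B (z * b) : G)⁻¹ * z))) (refMeasure m B) := by
  have : IsTopologicalGroup G := topologicalGroup_of_lieGroup (𝓡 n) ∞
  have e0 : Continuous fun b : B => z * (b : G) := continuous_const.mul continuous_subtype_val
  have e1 : Continuous fun b : B => (bL A B (z * b) : G) :=
    (h.smooth_right.comp h.contMDiff_bL).continuous.comp e0
  have e2 : Continuous fun b : B => (aR A B (z * b) : G) :=
    (h.smooth_left.comp h.contMDiff_aR).continuous.comp e0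
  have e3 : Topology.IsClosedEmbedding fun b : B => z * (b : G) :=
    (Homeomorph.mulLeft z).isClosedEmbedding.comp h.isClosed_right.isClosedEmbedding_subtypeVal
  have e4 : HasCompactSupport fun b : B =>
      Ω (z * b) (lFrame n m B (z * b)) (rFrame n m B (z * b)) :=
    hΩ.compact.comp_isClosedEmbedding e3
  refine Continuous.integrable_of_hasCompactSupport ?_ e4.mul_right
  exact (hΩ.smooth.continuous.comp e0).mul ((Complex.continuous_ofReal.comp
    (((continuous_modB.comp e1).mul (continuous_modB.comp e2)).rpow_const fun b =>
      Or.inl (mul_pos (h.modB_pos _) (h.modB_pos _)).ne')).mul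
    (hΨ.smooth.continuous.comp (e1.inv.mul continuous_const)))

/-- The operators `π_id(Ω)`. -/
def IsDoubleLieGroup.piIdSubmodule [T2Space G] : Submodule ℂ (L2 n G →L[ℂ] L2 n G) where
  carrier := {T | ∃ Ω : BiField n m B, IsBidensity n m B Ω ∧ IsPiId n k m A B Ω T}
  zero_mem' := by
    have h0 : IsBidensity n m B (fun _ _ _ => 0 : BiField n m B) :=
      ⟨fun _ _ _ _ => (mul_zero _).symm, fun _ _ _ _ => (mul_zero _).symm, contMDiff_const,
        HasCompactSupport.zero⟩
    refine ⟨_, h0, fun Ψ hΨ => ?_⟩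
    rw [_root_.zero_apply]
    filter_upwards [Lp.coeFn_zero ℂ 2 (refMeasure n G)] with z hz
    rw [hz, h.piId_coeff h0.isBihomogeneous hΨ.homogeneous]
    simp
  add_mem' := by
    rintro S T ⟨Ω, hΩ, hS⟩ ⟨Ω', hΩ', hT⟩
    have h0 : IsBidensity n m B (fun g v w => Ω g v w + Ω' g v w : BiField n m B) :=
      ⟨fun g M v w => (congrArg₂ (· + ·) (hΩ.homogeneous_left g M v w)
          (hΩ'.homogeneous_left g M v w)).trans (mul_add _ _ _).symm,
        fun g M v w => (congrArg₂ (· + ·) (hΩ.homogeneous_right g M v w)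
          (hΩ'.homogeneous_right g M v w)).trans (mul_add _ _ _).symm,
        hΩ.smooth.add hΩ'.smooth, hΩ.compact.add hΩ'.compact⟩
    refine ⟨_, h0, fun Ψ hΨ => ?_⟩
    rw [_root_.add_apply]
    filter_upwards [Lp.coeFn_add (S (vec n Ψ)) (T (vec n Ψ)), hS Ψ hΨ, hT Ψ hΨ] with z h1 h2 h3
    rw [h1, Pi.add_apply, h2, h3, h.piId_coeff h0.isBihomogeneous hΨ.homogeneous,
      h.piId_coeff hΩ.isBihomogeneous hΨ.homogeneous,
      h.piId_coeff hΩ'.isBihomogeneous hΨ.homogeneous,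
      ← integral_add (h.integrable_piId hΩ hΨ z) (h.integrable_piId hΩ' hΨ z)]
    simp only [add_mul]
  smul_mem' := by
    rintro c T ⟨Ω, hΩ, hT⟩
    have h0 : IsBidensity n m B (fun g v w => c * Ω g v w : BiField n m B) :=
      ⟨fun g M v w => (congrArg (c * ·) (hΩ.homogeneous_left g M v w)).trans (mul_left_comm _ _ _),
        fun g M v w => (congrArg (c * ·) (hΩ.homogeneous_right g M v w)).trans
          (mul_left_comm _ _ _),
        ContMDiff.complex_mul contMDiff_const hΩ.smooth, hΩ.compact.mul_left⟩
    refine ⟨_, h0, fun Ψ hΨ => ?_⟩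
    rw [_root_.smul_apply]
    filter_upwards [Lp.coeFn_smul c (T (vec n Ψ)), hT Ψ hΨ] with z h1 h2
    rw [h1, Pi.smul_apply, h2, h.piId_coeff h0.isBihomogeneous hΨ.homogeneous,
      h.piId_coeff hΩ.isBihomogeneous hΨ.homogeneous, smul_eq_mul, ← integral_const_mul]
    simp only [mul_assoc]

/-- For smooth vectors the slice is some π_id(Ω) with Ω = Φ̂(φ,ψ); the general case follows by
density and joint continuity. -/
theorem IsDoubleLieGroup.sliceOp_mem_reducedAlgebra [T2Space G] {W : L2₂ n G ≃ₗᵢ[ℂ] L2₂ n G}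
    (hW : IsMultUnitary n A B W) (x y : L2 n G) : sliceOp W x y ∈ reducedAlgebra n k m A B := by
  have := sigmaCompactSpace_of_lieGroup n G
  have hd := dense_smoothVectors (𝓡 n) (refMeasure n G)
  refine map_mem_closure₂ (continuous_sliceOp W) (hd x) (hd y) ?_
  rintro _ ⟨f, hf, hfc, rfl⟩ _ ⟨g, hg, hgc, rfl⟩
  have h1 := isHalfDensity_ofCoeff hf hfc
  have h2 := isHalfDensity_ofCoeff hg hgc
  have h3 := h.isPiId_sliceOp hW h1 h2
  rw [vec, vec, coeff_ofCoeff, coeff_ofCoeff] at h3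
  exact ⟨_, h.isBidensity_PhiHat h1 h2, h3⟩

/-- The operators π_id(Ω) form a subspace, so their closure is a closed subspace and contains the
closed span of the slices as soon as it contains the slices. -/
theorem IsDoubleLieGroup.sliceAlgebra_subset [T2Space G] {W : L2₂ n G ≃ₗᵢ[ℂ] L2₂ n G}
    (hW : IsMultUnitary n A B W) : sliceAlgebra W ⊆ reducedAlgebra n k m A B := by
  refine closure_minimal ?_ isClosed_closure
  refine fun T hT => (Submodule.span_le (p := h.piIdSubmodule.topologicalClosure)).mpr ?_ hT
  rintro _ ⟨x, y, hxy⟩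
  rw [isSlice_iff.mp hxy]
  exact h.sliceOp_mem_reducedAlgebra hW x y

end Algebras

end

end DLG

theorem proposition8p1 {n k m : ℕ} {G : Type*} [Group G] [TopologicalSpace G] [T2Space G]
    [SecondCountableTopology G] [ChartedSpace (DLG.E n) G] [LieGroup (𝓡 n) ∞ G]
    [MeasurableSpace G] [BorelSpace G] (A B : Subgroup G)
    [ChartedSpace (DLG.E k) A] [LieGroup (𝓡 k) ∞ A]
    [ChartedSpace (DLG.E m) B] [LieGroup (𝓡 m) ∞ B]
    (hDLG : DLG.IsDoubleLieGroup n k m A B) :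
    (∀ φ ψ : DLG.FrameField n G, DLG.IsHalfDensity n φ → DLG.IsHalfDensity n ψ →
      DLG.IsBidensity n m B (DLG.PhiHat n k m A B φ ψ) ∧
      DLG.kappa n k m A B (DLG.PhiHat n k m A B φ ψ) =
        DLG.bistar n m A B (DLG.PhiHat n k m A B ψ φ)) ∧
    (∃! W : DLG.L2₂ n G ≃ₗᵢ[ℂ] DLG.L2₂ n G, DLG.IsMultUnitary n A B W) ∧
    ∀ W : DLG.L2₂ n G ≃ₗᵢ[ℂ] DLG.L2₂ n G, DLG.IsMultUnitary n A B W →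
      (∀ φ ψ : DLG.FrameField n G, DLG.IsHalfDensity n φ → DLG.IsHalfDensity n ψ →
        ∃ T : DLG.L2 n G →L[ℂ] DLG.L2 n G,
          DLG.IsSlice W (DLG.vec n φ) (DLG.vec n ψ) T ∧
          DLG.IsPiId n k m A B (DLG.PhiHat n k m A B φ ψ) T) ∧
      DLG.sliceAlgebra W ⊆ DLG.reducedAlgebra n k m A B := by
  refine ⟨fun φ ψ hφ hψ => ⟨hDLG.isBidensity_PhiHat hφ hψ,
    hDLG.kappa_PhiHat hφ.homogeneous hψ.homogeneous⟩, hDLG.existsUnique_multUnitary,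
    fun W hW => ⟨fun φ ψ hφ hψ => ⟨_, DLG.isSlice_iff.mpr rfl, hDLG.isPiId_sliceOp hW hφ hψ⟩,
      hDLG.sliceAlgebra_subset hW⟩⟩
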